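/- Let $n\in\{2,3,4,5,6,7,8,9,10,12,13,16,18,25\}$, i.e. let $n>1$ be an integer such that $X_0(n)$ has genus $0$, and let $K$ be a field whose characteristic is $0$ or relatively prime to $6n$. Let $K(t,d)$ be the field of rational functions in two variables. For $1\le i\le N_n$, where $N_n=2$ for $n=2,3,5,7,13$; $N_n=3$ for $n=9,25$; $N_n=4$ for $n=4,6,10$; $N_n=6$ for $n=8,18$; $N_n=8$ for $n=12,16$, put $$\mathcal C_{n,i}(t,d):\ y^2=x^3+d^2\mathcal A_{n,i}(t)\,x+d^3\mathcal B_{n,i}(t),$$ with $\mathcal A_{n,i},\mathcal B_{n,i}\in\mathbb Z[t]$ as in list (A) below, and let $j_{n,1}(t),j_{n,2}(t)$ be the Fricke parameterizations in list (B) below. Define $(k_1,k_2)$ to be $(1,2)$ for $n=2,3,5,7,13$; $(4,2)$ for $n=4$; $(1,4)$ for $n=6,10$; $(3,6)$ for $n=8$; $(1,3)$ for $n=9,25$; $(5,4)$ for $n=12$; $(2,8)$ for $n=16$; $(1,6)$ for $n=18$. An isogeny over a field $F$ between elliptic curves over $F$ is a surjective group homomorphism on $\overline F$-points given, at all but finitely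 many points, by rational functions in the coordinates with coefficients in $F$. Then the $\mathcal C_{n,i}(t,d)$ are elliptic curves over $K(t,d)$, and: (i) the $j$-invariant of $\mathcal C_{n,k_1}(t,d)$ is $j_{n,1}(t)$, and the $j$-invariant of $\mathcal C_{n,k_2}(t,d)$ is $j_{n,2}(t)$; (ii) for $i\ne k$ the curves $\mathcal C_{n,i}(t,d)$ and $\mathcal C_{n,k}(t,d)$ are not isomorphic over $K(t,d)$; (iii) the isogeny class of $\mathcal C_{n,1}(t,d)$ over $K(t,d)$ (the set of $K(t,d)$-isomorphism classes of elliptic curves isogenous to it over $K(t,d)$) contains the $K(t,d)$-isomorphism class of every $\mathcal C_{n,i}(t,d)$; (iv) for every arrow $\psi_{n,i}^{(m)}:k\to l$ in list (C) below there is an isogeny $\psi_{n,i}:\mathcal C_{n,k}(t,d)\to\mathcal C_{n,l}(t,d)$ over $K(t,d)$ whose kernel is cyclic of order $m$ and which is of the form $\psi_{n,i}(x,y)=\bigl(f(x),\,c\,y f'(x)\bigr)$, where $f\in K(t,d)(x)$ is a rational function of degree $m$ whose numerator has degree $m$ and whose denominator has smaller degree (so $\psi_{n,i}$ has degree $m$;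 the affine points sent to the point at infinity are those at whose $x$-coordinate the denominator vanishes). Here $c=1$, i.e. $\psi_{n,i}$ is normalized, for all arrows except $\psi_{12,2}$, for which $c=\tfrac12$ (so that $\psi_{12,2}$ is a normalized isogeny followed by an isomorphism). More generally, for every nonzero $u\in K(t,d)$ all of the above remains true with $\mathcal C_{n,i}(t,ud)$ in place of $\mathcal C_{n,i}(t,d)$ (and the same $j_{n,1}(t),j_{n,2}(t)$). **(A) The coefficients.** - $\mathcal A_{2,1}=-27(t^{2}+320t+16384)$, $\mathcal B_{2,1}=54(t^{3}-384t^{2}-61440t-2097152)$ - $\mathcal A_{2,2}=-432(t^{2}+80t+1024)$, $\mathcal B_{2,2}=3456(t^{3}+120t^{2}+3072t-32768)$ - $\mathcal A_{3,1}=-3(t^{2}+270t+6561)$, $\mathcal B_{3,1}=-2(t^{3}-459t^{2}-32805t-531441)$ - $\mathcal A_{3,2}=-243(t^{2}+30t+81)$, $\mathcal B_{3,2}=-1458(t^{3}+45t^{2}+459t-729)$ - $\mathcal A_{4,1}=-432(t^{2}+16t+256)$, $\mathcal B_{4,1}=3456(t^{3}+24t^{2}-384t-4096)$ - $\mathcal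 A_{4,2}=-6912(t^{2}+16t+16)$, $\mathcal B_{4,2}=221184(t^{3}+24t^{2}+120t-64)$ - $\mathcal A_{4,3}=-432(t^{2}-224t+256)$, $\mathcal B_{4,3}=3456(t^{3}+528t^{2}-8448t-4096)$ - $\mathcal A_{4,4}=-27(t^{2}+256t+4096)$, $\mathcal B_{4,4}=54(t^{3}-480t^{2}-24576t-262144)$ - $\mathcal A_{5,1}=-27(t^{4}+272t^{3}+8750t^{2}+100000t+390625)$, $\mathcal B_{5,1}=54(t^{6}-456t^{5}-36891t^{4}-1049000t^{3}-14203125t^{2}-93750000t-244140625)$ - $\mathcal A_{5,2}=-16875(t^{4}+32t^{3}+350t^{2}+1360t+625)$, $\mathcal B_{5,2}=843750(t^{6}+48t^{5}+909t^{4}+8392t^{3}+36891t^{2}+57000t-15625)$ - $\mathcal A_{6,1}=-3(t^{4}+264t^{3}+6912t^{2}+62208t+186624)$, $\mathcal B_{6,1}=-2(t^{6}-468t^{5}-31752t^{4}-730944t^{3}-7838208t^{2}-40310784t-80621568)$ - $\mathcal A_{6,2}=-48(t^{4}+24t^{3}+432t^{2}+3888t+11664)$, $\mathcal B_{6,2}=-128(t^{6}+36t^{5}-9720t^{3}-122472t^{2}-629856t-1259712)$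 - $\mathcal A_{6,3}=-243(t^{4}+24t^{3}+192t^{2}+768t+2304)$, $\mathcal B_{6,3}=-1458(t^{6}+36t^{5}+504t^{4}+2880t^{3}-55296t-110592)$ - $\mathcal A_{6,4}=-3888(t^{4}+24t^{3}+192t^{2}+528t+144)$, $\mathcal B_{6,4}=-93312(t^{6}+36t^{5}+504t^{4}+3384t^{3}+10584t^{2}+11232t-1728)$ - $\mathcal A_{7,1}=-27(t^{4}+258t^{3}+5635t^{2}+43218t+117649)$, $\mathcal B_{7,1}=54(t^{6}-477t^{5}-27930t^{4}-540225t^{3}-4941258t^{2}-22235661t-40353607)$ - $\mathcal A_{7,2}=-64827(t^{4}+18t^{3}+115t^{2}+258t+49)$, $\mathcal B_{7,2}=6353046(t^{6}+27t^{5}+294t^{4}+1575t^{3}+3990t^{2}+3339t-343)$ - $\mathcal A_{8,1}=-432(t^{4}+224t^{2}+256)$, $\mathcal B_{8,1}=3456(t^{6}-528t^{4}-8448t^{2}+4096)$ - $\mathcal A_{8,2}=-432(t^{4}-240t^{3}+2144t^{2}-3840t+256)$, $\mathcal B_{8,2}=3456(t^{6}+504t^{5}-16656t^{4}+112896t^{3}-266496t^{2}+129024t+4096)$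 - $\mathcal A_{8,3}=-27(t^{4}+240t^{3}+2144t^{2}+3840t+256)$, $\mathcal B_{8,3}=54(t^{6}-504t^{5}-16656t^{4}-112896t^{3}-266496t^{2}-129024t+4096)$ - $\mathcal A_{8,4}=-6912(t^{4}-16t^{2}+256)$, $\mathcal B_{8,4}=221184(t^{6}-24t^{4}-384t^{2}+4096)$ - $\mathcal A_{8,5}=-6912(t^{4}-256t^{2}+4096)$, $\mathcal B_{8,5}=221184(t^{6}+480t^{4}-24576t^{2}+262144)$ - $\mathcal A_{8,6}=-110592(t^{4}-16t^{2}+16)$, $\mathcal B_{8,6}=14155776(t^{6}-24t^{4}+120t^{2}+64)$ - $\mathcal A_{9,1}=-3(t^{4}+240t^{3}+2160t^{2}+6696t+12960)$, $\mathcal B_{9,1}=-2(t^{6}-504t^{5}-16632t^{4}-123012t^{3}-517104t^{2}-1143072t-1475496)$ - $\mathcal A_{9,2}=-243(t^{4}+216t)$, $\mathcal B_{9,2}=-1458(t^{6}-540t^{3}-5832)$ - $\mathcal A_{9,3}=-19683(t^{4}-24t)$, $\mathcal B_{9,3}=-1062882(t^{6}-36t^{3}+216)$ - $\mathcal A_{10,1}=-27(t^{8}+236t^{7}+1444t^{6}+2864t^{5}+9600t^{4}+7936t^{3}+15616t^{2}+1024t+1024)$,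 $\mathcal B_{10,1}=54(t^{12}-510t^{11}-14100t^{10}-60512t^{9}-233808t^{8}-524640t^{7}-1257408t^{6}-1420032t^{5}-2445312t^{4}-1015808t^{3}-1007616t^{2}+49152t+32768)$ - $\mathcal A_{10,2}=-432(t^{8}-4t^{7}+244t^{6}-496t^{5}+2400t^{4}-2864t^{3}+5776t^{2}-3776t+64)$, $\mathcal B_{10,2}=3456(t^{12}-6t^{11}-492t^{10}+1984t^{9}-19104t^{8}+44376t^{7}-157176t^{6}+262320t^{5}-467616t^{4}+484096t^{3}-451200t^{2}+65280t+512)$ - $\mathcal A_{10,3}=-16875(t^{8}-4t^{7}+4t^{6}-16t^{5}+256t^{3}+256t^{2}+1024t+1024)$, $\mathcal B_{10,3}=843750(t^{12}-6t^{11}+12t^{10}-32t^{9}+48t^{8}-480t^{7}+576t^{6}-768t^{5}+6144t^{4}+16384t^{3}+24576t^{2}+49152t+32768)$ - $\mathcal A_{10,4}=-270000(t^{8}-4t^{7}+4t^{6}-16t^{5}+16t^{3}+16t^{2}+64t+64)$, $\mathcal B_{10,4}=54000000(t^{12}-6t^{11}+12t^{10}-32t^{9}+48t^{8}+24t^{7}+72t^{6}+240t^{5}+96t^{4}+256t^{3}+384t^{2}+768t+512)$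 - $\mathcal A_{12,1}=-48(t^{8}+228t^{6}+270t^{4}-972t^{2}+729)$, $\mathcal B_{12,1}=-128(t^{12}-522t^{10}-9477t^{8}+18468t^{6}-24057t^{4}+39366t^{2}-19683)$ - $\mathcal A_{12,2}=-3888(t^{8}-12t^{6}+30t^{4}+228t^{2}+9)$, $\mathcal B_{12,2}=-93312(t^{12}-18t^{10}+99t^{8}-684t^{6}+3159t^{4}+1566t^{2}-27)$ - $\mathcal A_{12,3}=-768(t^{8}-12t^{6}+270t^{4}-972t^{2}+729)$, $\mathcal B_{12,3}=-8192(t^{12}-18t^{10}-405t^{8}+4860t^{6}-24057t^{4}+39366t^{2}-19683)$ - $\mathcal A_{12,4}=-62208(t^{8}-12t^{6}+30t^{4}-12t^{2}+9)$, $\mathcal B_{12,4}=-5971968(t^{12}-18t^{10}+99t^{8}-180t^{6}+135t^{4}+54t^{2}-27)$ - $\mathcal A_{12,5}=-3(t^{8}+240t^{7}+2148t^{6}+4320t^{5}+270t^{4}-6480t^{3}-972t^{2}+729)$, $\mathcal B_{12,5}=-2(t^{12}-504t^{11}-16650t^{10}-114912t^{9}-299781t^{8}-136080t^{7}+453924t^{6}+489888t^{5}-24057t^{4}-367416t^{3}+39366t^{2}-19683)$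 - $\mathcal A_{12,6}=-243(t^{8}-12t^{6}+240t^{5}+30t^{4}-1440t^{3}+2148t^{2}-720t+9)$, $\mathcal B_{12,6}=-1458(t^{12}-18t^{10}-504t^{9}+99t^{8}+6048t^{7}-16812t^{6}-15120t^{5}+99927t^{4}-114912t^{3}+49950t^{2}-4536t-27)$ - $\mathcal A_{12,7}=-48(t^{8}-240t^{7}+2148t^{6}-4320t^{5}+270t^{4}+6480t^{3}-972t^{2}+729)$, $\mathcal B_{12,7}=-128(t^{12}+504t^{11}-16650t^{10}+114912t^{9}-299781t^{8}+136080t^{7}+453924t^{6}-489888t^{5}-24057t^{4}+367416t^{3}+39366t^{2}-19683)$ - $\mathcal A_{12,8}=-3888(t^{8}-12t^{6}-240t^{5}+30t^{4}+1440t^{3}+2148t^{2}+720t+9)$, $\mathcal B_{12,8}=-93312(t^{12}-18t^{10}+504t^{9}+99t^{8}-6048t^{7}-16812t^{6}+15120t^{5}+99927t^{4}+114912t^{3}+49950t^{2}+4536t-27)$ - $\mathcal A_{13,1}=-27(t^{8}+258t^{7}+6153t^{6}+66534t^{5}+422500t^{4}+1700478t^{3}+4369833t^{2}+6683274t+4826809)$,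 $\mathcal B_{13,1}=54(t^{12}-477t^{11}-28881t^{10}-653850t^{9}-8436441t^{8}-71768385t^{7}-430497756t^{6}-1877228847t^{5}-5993782899t^{4}-13814327358t^{3}-22024729467t^{2}-22024729467t-10604499373)$ - $\mathcal A_{13,2}=-771147(t^{8}+18t^{7}+153t^{6}+774t^{5}+2500t^{4}+5118t^{3}+6153t^{2}+3354t+169)$, $\mathcal B_{13,2}=260647686(t^{12}+27t^{11}+351t^{10}+2862t^{9}+16143t^{8}+65727t^{7}+195948t^{6}+424665t^{5}+648957t^{4}+653850t^{3}+375453t^{2}+80613t-2197)$ - $\mathcal A_{16,1}=-432(t^{8}+240t^{6}+2144t^{4}+3840t^{2}+256)$, $\mathcal B_{16,1}=3456(t^{12}-504t^{10}-16656t^{8}-112896t^{6}-266496t^{4}-129024t^{2}+4096)$ - $\mathcal A_{16,2}=-27(t^{8}+240t^{7}+2160t^{6}+6720t^{5}+17504t^{4}+26880t^{3}+34560t^{2}+15360t+256)$, $\mathcal B_{16,2}=54(t^{12}-504t^{11}-16632t^{10}-122976t^{9}-532752t^{8}-1564416t^{7}-3725568t^{6}-6257664t^{5}-8524032t^{4}-7870464t^{3}-4257792t^{2}-516096t+4096)$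 - $\mathcal A_{16,3}=-432(t^{8}-240t^{7}+2160t^{6}-6720t^{5}+17504t^{4}-26880t^{3}+34560t^{2}-15360t+256)$, $\mathcal B_{16,3}=3456(t^{12}+504t^{11}-16632t^{10}+122976t^{9}-532752t^{8}+1564416t^{7}-3725568t^{6}+6257664t^{5}-8524032t^{4}+7870464t^{3}-4257792t^{2}+516096t+4096)$ - $\mathcal A_{16,4}=-6912(t^{8}+224t^{4}+256)$, $\mathcal B_{16,4}=221184(t^{12}-528t^{8}-8448t^{4}+4096)$ - $\mathcal A_{16,5}=-6912(t^{8}-240t^{6}+2144t^{4}-3840t^{2}+256)$, $\mathcal B_{16,5}=221184(t^{12}+504t^{10}-16656t^{8}+112896t^{6}-266496t^{4}+129024t^{2}+4096)$ - $\mathcal A_{16,6}=-110592(t^{8}-16t^{4}+256)$, $\mathcal B_{16,6}=14155776(t^{12}-24t^{8}-384t^{4}+4096)$ - $\mathcal A_{16,7}=-110592(t^{8}-256t^{4}+4096)$, $\mathcal B_{16,7}=14155776(t^{12}+480t^{8}-24576t^{4}+262144)$ - $\mathcal A_{16,8}=-1769472(t^{8}-16t^{4}+16)$, $\mathcal B_{16,8}=905969664(t^{12}-24t^{8}+120t^{4}+64)$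 - $\mathcal A_{18,1}=-3(t^{12}+240t^{11}+2160t^{10}+6712t^{9}+15840t^{8}+17280t^{7}+26880t^{6}+11520t^{5}+34560t^{4}+256t^{3}+15360t^{2}+256)$, $\mathcal B_{18,1}=-2(t^{18}-504t^{17}-16632t^{16}-122988t^{15}-527184t^{14}-1409184t^{13}-2951400t^{12}-4217472t^{11}-6168960t^{10}-5903296t^{9}-8596224t^{8}-4257792t^{7}-7868928t^{6}-645120t^{5}-4257792t^{4}+6144t^{3}-516096t^{2}+4096)$ - $\mathcal A_{18,2}=-48(t^{12}+240t^{10}-8t^{9}+2160t^{8}-1440t^{7}+6720t^{6}-8640t^{5}+15840t^{4}-13424t^{3}+8640t^{2}-1920t+16)$, $\mathcal B_{18,2}=-128(t^{18}-504t^{16}-12t^{15}-16632t^{14}+5040t^{13}-122952t^{12}+133056t^{11}-537264t^{10}+737912t^{9}-1542240t^{8}+2108736t^{7}-2951400t^{6}+2818368t^{5}-2108736t^{4}+983904t^{3}-266112t^{2}+16128t+64)$ - $\mathcal A_{18,3}=-243(t^{12}+232t^{9}+960t^{6}+256t^{3}+256)$, $\mathcal B_{18,3}=-1458(t^{18}-516t^{15}-12072t^{12}-24640t^{9}-30720t^{6}+6144t^{3}+4096)$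 - $\mathcal A_{18,4}=-3888(t^{12}-8t^{9}+240t^{6}-464t^{3}+16)$, $\mathcal B_{18,4}=-93312(t^{18}-12t^{15}-480t^{12}+3080t^{9}-12072t^{6}+4128t^{3}+64)$ - $\mathcal A_{18,5}=-19683(t^{12}-8t^{9}+256t^{3}+256)$, $\mathcal B_{18,5}=-1062882(t^{18}-12t^{15}+24t^{12}-448t^{9}+1536t^{6}+6144t^{3}+4096)$ - $\mathcal A_{18,6}=-314928(t^{12}-8t^{9}+16t^{3}+16)$, $\mathcal B_{18,6}=-68024448(t^{18}-12t^{15}+24t^{12}+56t^{9}+24t^{6}+96t^{3}+64)$ - $\mathcal A_{25,1}=-27(t^{12}+240t^{11}+2174t^{10}+9840t^{9}+43515t^{8}+119268t^{7}+345550t^{6}+648372t^{5}+1328385t^{4}+1678260t^{3}+2389556t^{2}+1698960t+1501504)$, $\mathcal B_{25,1}=54(t^{18}-504t^{17}-16611t^{16}-133056t^{15}-848550t^{14}-3873258t^{13}-15583283t^{12}-50025312t^{11}-148053462t^{10}-359395650t^{9}-820470687t^{8}-1538388072t^{7}-2734681643t^{6}-3903040458t^{5}-5302026300t^{4}-5402959056t^{3}-5275448016t^{2}-3122753184t-1839881024)$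 - $\mathcal A_{25,2}=-16875(t^{12}+14t^{10}+75t^{8}+228t^{7}+190t^{6}+2052t^{5}+225t^{4}+5700t^{3}+596t^{2}+4560t+1984)$, $\mathcal B_{25,2}=843750(t^{18}+21t^{16}+186t^{14}-522t^{13}+901t^{12}-8352t^{11}+2586t^{10}-52722t^{9}-5559t^{8}-164952t^{7}-105659t^{6}-261522t^{5}-407964t^{4}-187920t^{3}-559824t^{2}-41760t-160064)$ - $\mathcal A_{25,3}=-10546875(t^{12}+14t^{10}+75t^{8}-12t^{7}+190t^{6}-108t^{5}+225t^{4}-300t^{3}+116t^{2}-240t+64)$, $\mathcal B_{25,3}=13183593750(t^{18}+21t^{16}+186t^{14}-18t^{13}+901t^{12}-288t^{11}+2586t^{10}-1818t^{9}+4521t^{8}-5688t^{7}+5221t^{6}-9018t^{5}+5316t^{4}-6480t^{3}+4656t^{2}-1440t+1216)$ **(B) The Fricke parameterizations.** - $j_{2,1}=\frac{(t+256)^{3}}{t^{2}}$, $j_{2,2}=\frac{(t+16)^{3}}{t}$ - $j_{3,1}=\frac{(t+27)(t+243)^{3}}{t^{3}}$, $j_{3,2}=\frac{(t+27)(t+3)^{3}}{t}$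 - $j_{4,1}=\frac{(t^{2}+256t+4096)^{3}}{t^{4}(t+16)}$, $j_{4,2}=\frac{(t^{2}+16t+16)^{3}}{t(t+16)}$ - $j_{5,1}=\frac{(t^{2}+250t+3125)^{3}}{t^{5}}$, $j_{5,2}=\frac{(t^{2}+10t+5)^{3}}{t}$ - $j_{6,1}=\frac{(t+12)^{3}(t^{3}+252t^{2}+3888t+15552)^{3}}{t^{6}(t+8)^{2}(t+9)^{3}}$, $j_{6,2}=\frac{(t+6)^{3}(t^{3}+18t^{2}+84t+24)^{3}}{t(t+8)^{3}(t+9)^{2}}$ - $j_{7,1}=\frac{(t^{2}+13t+49)(t^{2}+245t+2401)^{3}}{t^{7}}$, $j_{7,2}=\frac{(t^{2}+13t+49)(t^{2}+5t+1)^{3}}{t}$ - $j_{8,1}=\frac{(t^{4}+240t^{3}+2144t^{2}+3840t+256)^{3}}{t(t-4)^{8}(t+4)^{2}}$, $j_{8,2}=\frac{(t^{4}-16t^{2}+16)^{3}}{t^{2}(t^{2}-16)}$ - $j_{9,1}=\frac{(t+6)^{3}(t^{3}+234t^{2}+756t+2160)^{3}}{(t-3)^{8}(t^{3}-27)}$,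 $j_{9,2}=\frac{t^{3}(t^{3}-24)^{3}}{t^{3}-27}$ - $j_{10,1}=\frac{(t^{6}+236t^{5}+1440t^{4}+1920t^{3}+3840t^{2}+256t+256)^{3}}{t^{2}(t-4)^{10}(t+1)^{5}}$, $j_{10,2}=\frac{(t^{6}-4t^{5}+16t+16)^{3}}{t^{5}(t+1)^{2}(t-4)}$ - $j_{12,1}=\frac{(t^{2}+6t-3)^{3}(t^{6}+234t^{5}+747t^{4}+540t^{3}-729t^{2}-486t-243)^{3}}{t^{3}(t-3)^{12}(t-1)(t+1)^{4}(t+3)^{3}}$, $j_{12,2}=\frac{(t^{2}-3)^{3}(t^{6}-9t^{4}+3t^{2}-3)^{3}}{t^{4}(t^{2}-9)(t^{2}-1)^{3}}$ - $j_{13,1}=\frac{(t^{2}+5t+13)(t^{4}+247t^{3}+3380t^{2}+15379t+28561)^{3}}{t^{13}}$, $j_{13,2}=\frac{(t^{2}+5t+13)(t^{4}+7t^{3}+20t^{2}+19t+1)^{3}}{t}$ - $j_{16,1}=\frac{(t^{8}+240t^{7}+2160t^{6}+6720t^{5}+17504t^{4}+26880t^{3}+34560t^{2}+15360t+256)^{3}}{t(t-2)^{16}(t+2)^{4}(t^{2}+4)}$,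 $j_{16,2}=\frac{(t^{8}-16t^{4}+16)^{3}}{t^{4}(t^{4}-16)}$ - $j_{18,1}=\frac{(t^{3}+6t^{2}+4)^{3}(t^{9}+234t^{8}+756t^{7}+2172t^{6}+1872t^{5}+3024t^{4}+48t^{3}+3744t^{2}+64)^{3}}{t^{2}(t-2)^{18}(t+1)^{9}(t^{2}-t+1)(t^{2}+2t+4)^{2}}$, $j_{18,2}=\frac{(t^{3}-2)^{3}(t^{9}-6t^{6}-12t^{3}-8)^{3}}{t^{9}(t^{3}-8)(t^{3}+1)^{2}}$ - $j_{25,1}=\frac{(t^{10}+240t^{9}+2170t^{8}+8880t^{7}+34835t^{6}+83748t^{5}+206210t^{4}+313380t^{3}+503545t^{2}+424740t+375376)^{3}}{(t-1)^{25}(t^{4}+t^{3}+6t^{2}+6t+11)}$, $j_{25,2}=\frac{(t^{10}+10t^{8}+35t^{6}-12t^{5}+50t^{4}-60t^{3}+25t^{2}-60t+16)^{3}}{t^{5}+5t^{3}+5t-11}$ **(C) The arrows of the partial isogeny graphs.** - $n=2,3,5,7,13$: $\psi_{n,1}^{(n)}:1\to2$. - $n=9,25$: $\psi_{n,1}^{(\sqrt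 n)}:1\to2$, $\psi_{n,2}^{(\sqrt n)}:2\to3$. - $n=6,10$: $\psi_{n,1}^{(2)}:1\to2$, $\psi_{n,2}^{(n/2)}:1\to3$, $\psi_{n,3}^{(2)}:3\to4$, $\psi_{n,4}^{(n/2)}:2\to4$. - $n=4$: $\psi_{4,1}^{(2)}:1\to2$, $\psi_{4,2}^{(2)}:1\to3$, $\psi_{4,3}^{(2)}:4\to1$. - $n=8$: $\psi_{8,1}^{(2)}:1\to2$, $\psi_{8,2}^{(2)}:3\to1$, $\psi_{8,3}^{(2)}:1\to4$, $\psi_{8,4}^{(2)}:4\to5$, $\psi_{8,5}^{(2)}:4\to6$. - $n=12$: $\psi_{12,1}^{(3)}:1\to2$, $\psi_{12,2}^{(2)}:8\to2$, $\psi_{12,3}^{(3)}:7\to8$, $\psi_{12,4}^{(2)}:1\to7$, $\psi_{12,5}^{(2)}:5\to1$, $\psi_{12,6}^{(3)}:5\to6$, $\psi_{12,7}^{(2)}:6\to2$, $\psi_{12,8}^{(2)}:2\to4$, $\psi_{12,9}^{(3)}:3\to4$, $\psi_{12,10}^{(2)}:1\to3$. - $n=16$: $\psi_{16,1}^{(2)}:1\to3$,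 $\psi_{16,2}^{(2)}:2\to1$, $\psi_{16,3}^{(2)}:1\to4$, $\psi_{16,4}^{(2)}:4\to5$, $\psi_{16,5}^{(2)}:4\to6$, $\psi_{16,6}^{(2)}:6\to7$, $\psi_{16,7}^{(2)}:6\to8$. - $n=18$: $\psi_{18,1}^{(3)}:1\to3$, $\psi_{18,2}^{(2)}:1\to2$, $\psi_{18,3}^{(3)}:2\to4$, $\psi_{18,4}^{(2)}:3\to4$, $\psi_{18,5}^{(3)}:3\to5$, $\psi_{18,6}^{(2)}:5\to6$, $\psi_{18,7}^{(3)}:4\to6$. -/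

import Mathlib

open Polynomial WeierstrassCurve

noncomputable section

namespace IsogenyGraphs

/-! ### Isogenies between Weierstrass curves over a field -/

section Isogeny

variable {F : Type*} [Field F]

/-- The geometric points of `W`: the nonsingular points, including the point at infinity, with
coordinates in an algebraic closure of `F`. -/
abbrev GeomPoint (W : WeierstrassCurve F) : Type _ :=
  (W.baseChange (AlgebraicClosure F)).toAffine.Point

open scoped Classical in
/-- The group law on the geometric points. -/
instance (W : WeierstrassCurve F) : AddCommGroup (GeomPoint W) :=
  inferInstanceAs (AddCommGroup (W.baseChange (AlgebraicClosure F)).toAffine.Point)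

/-- An isogeny `W → W'` defined over `F`: a surjective homomorphism on geometric points which is
given, at all but finitely many points `(x, y)`, by `(x, y) ↦ (p(x,y)/q(x,y), r(x,y)/s(x,y))` for
polynomials `p, q, r, s` with coefficients in `F` (the denominators not vanishing there). -/
structure Isogeny (W W' : WeierstrassCurve F) where
  toHom : GeomPoint W →+ GeomPoint W'
  surjective : Function.Surjective toHom
  rational : ∃ p q r s : MvPolynomial (Fin 2) F,
    {P : GeomPoint W | ¬ ∃ x y h h', P = Affine.Point.some x y h ∧
      MvPolynomial.aeval ![x, y] q ≠ 0 ∧ MvPolynomial.aeval ![x, y] s ≠ 0 ∧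
      toHom P = Affine.Point.some
        (MvPolynomial.aeval ![x, y] p / MvPolynomial.aeval ![x, y] q)
        (MvPolynomial.aeval ![x, y] r / MvPolynomial.aeval ![x, y] s) h'}.Finite

/-- The kernel of the isogeny on geometric points is cyclic of order `m`. -/
def Isogeny.HasCyclicKernel {W W' : WeierstrassCurve F} (φ : Isogeny W W') (m : ℕ) : Prop :=
  Nonempty (φ.toHom.ker ≃+ ZMod m)

/-- The isogeny is given by `(x, y) ↦ (f(x), c y f'(x))`, where `f = N / D ∈ F(x)` is a fraction in
lowest terms of degree `m`: precisely, `N` has degree `m`, `D` has smaller degree, the points with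
`D(x) = 0` are sent to the point at infinity, and all other affine points are sent to
`(f(x), c y f'(x))`. For `c = 1` the isogeny is called normalized. -/
def Isogeny.HasStandardForm {W W' : WeierstrassCurve F} (φ : Isogeny W W') (m : ℕ) (c : F) :
    Prop :=
  ∃ N D : F[X], IsCoprime N D ∧ N.natDegree = m ∧ D.natDegree < m ∧
    ∀ (x y : AlgebraicClosure F) (h : (W.baseChange (AlgebraicClosure F)).toAffine.Nonsingular x y),
      (aeval x D = 0 → φ.toHom (Affine.Point.some x y h) = 0) ∧
      (aeval x D ≠ 0 → ∃ h', φ.toHom (Affine.Point.some x y h) =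
        Affine.Point.some (aeval x N / aeval x D)
          (algebraMap F (AlgebraicClosure F) c * y *
            (aeval x (derivative N * D - N * derivative D) / aeval x D ^ 2)) h')

/-- The `F`-isomorphism class of a Weierstrass curve: its orbit under the admissible changes of
variables over `F`. -/
def isoClass (W : WeierstrassCurve F) :
    MulAction.orbitRel.Quotient (VariableChange F) (WeierstrassCurve F) :=
  Quotient.mk _ W

/-- The isogeny class of `W` over `F`: the set of `F`-isomorphism classes of the elliptic curves
that are isogenous to `W` over `F`. -/
def isogenyClass (W : WeierstrassCurve F) :
    Set (MulAction.orbitRel.Quotient (VariableChange F) (WeierstrassCurve F)) :=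
  {c | ∃ W' : WeierstrassCurve F, W'.IsElliptic ∧ Nonempty (Isogeny W W') ∧ isoClass W' = c}

end Isogeny

/-! ### The levels and the Fricke parameterizations -/

/-- The integers `n > 1` for which the modular curve `X₀(n)` has genus `0`. -/
def genusZeroLevels : Finset ℕ := {2, 3, 4, 5, 6, 7, 8, 9, 10, 12, 13, 16, 18, 25}

/-- The Fricke parameterization `j_{n,1}(t)`. -/
def jFricke1 {F : Type*} [Field F] (n : ℕ) (t : F) : F :=
  match n with
  | 2 => (t + 256) ^ 3 / t ^ 2
  | 3 => (t + 27) * (t + 243) ^ 3 / t ^ 3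
  | 4 => (t ^ 2 + 256 * t + 4096) ^ 3 / (t ^ 4 * (t + 16))
  | 5 => (t ^ 2 + 250 * t + 3125) ^ 3 / t ^ 5
  | 6 =>
      (t + 12) ^ 3 * (t ^ 3 + 252 * t ^ 2 + 3888 * t + 15552) ^ 3 / (t ^ 6 * (t + 8) ^ 2 * (t
      + 9) ^ 3)
  | 7 => (t ^ 2 + 13 * t + 49) * (t ^ 2 + 245 * t + 2401) ^ 3 / t ^ 7
  | 8 =>
      (t ^ 4 + 240 * t ^ 3 + 2144 * t ^ 2 + 3840 * t + 256) ^ 3 / (t * (t - 4) ^ 8 * (t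
      + 4) ^ 2)
  | 9 => (t + 6) ^ 3 * (t ^ 3 + 234 * t ^ 2 + 756 * t + 2160) ^ 3 / ((t - 3) ^ 8 * (t ^ 3 - 27))
  | 10 =>
      (t ^ 6 + 236 * t ^ 5 + 1440 * t ^ 4 + 1920 * t ^ 3 + 3840 * t ^ 2 + 256 * t + 256) ^ 3 /
      (t ^ 2 * (t - 4) ^ 10 * (t + 1) ^ 5)
  | 12 =>
      (t ^ 2 + 6 * t - 3) ^ 3 * (t ^ 6 + 234 * t ^ 5 + 747 * t ^ 4 + 540 * t ^ 3 - 729 * t ^ 2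
      - 486 * t - 243) ^ 3 / (t ^ 3 * (t - 3) ^ 12 * (t - 1) * (t + 1) ^ 4 * (t + 3) ^ 3)
  | 13 =>
      (t ^ 2 + 5 * t + 13) * (t ^ 4 + 247 * t ^ 3 + 3380 * t ^ 2 + 15379 * t + 28561) ^ 3 /
      t ^ 13
  | 16 =>
      (t ^ 8 + 240 * t ^ 7 + 2160 * t ^ 6 + 6720 * t ^ 5 + 17504 * t ^ 4 + 26880 * t ^ 3
      + 34560 * t ^ 2 + 15360 * t + 256) ^ 3 / (t * (t - 2) ^ 16 * (t + 2) ^ 4 * (t ^ 2 + 4))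
  | 18 =>
      (t ^ 3 + 6 * t ^ 2 + 4) ^ 3 * (t ^ 9 + 234 * t ^ 8 + 756 * t ^ 7 + 2172 * t ^ 6
      + 1872 * t ^ 5 + 3024 * t ^ 4 + 48 * t ^ 3 + 3744 * t ^ 2 + 64) ^ 3 / (t ^ 2 * (t
      - 2) ^ 18 * (t + 1) ^ 9 * (t ^ 2 - t + 1) * (t ^ 2 + 2 * t + 4) ^ 2)
  | 25 =>
      (t ^ 10 + 240 * t ^ 9 + 2170 * t ^ 8 + 8880 * t ^ 7 + 34835 * t ^ 6 + 83748 * t ^ 5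
      + 206210 * t ^ 4 + 313380 * t ^ 3 + 503545 * t ^ 2 + 424740 * t + 375376) ^ 3 / ((t
      - 1) ^ 25 * (t ^ 4 + t ^ 3 + 6 * t ^ 2 + 6 * t + 11))
  | _ => 0

/-- The Fricke parameterization `j_{n,2}(t)`. -/
def jFricke2 {F : Type*} [Field F] (n : ℕ) (t : F) : F :=
  match n with
  | 2 => (t + 16) ^ 3 / t
  | 3 => (t + 27) * (t + 3) ^ 3 / t
  | 4 => (t ^ 2 + 16 * t + 16) ^ 3 / (t * (t + 16))
  | 5 => (t ^ 2 + 10 * t + 5) ^ 3 / t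
  | 6 => (t + 6) ^ 3 * (t ^ 3 + 18 * t ^ 2 + 84 * t + 24) ^ 3 / (t * (t + 8) ^ 3 * (t + 9) ^ 2)
  | 7 => (t ^ 2 + 13 * t + 49) * (t ^ 2 + 5 * t + 1) ^ 3 / t
  | 8 => (t ^ 4 - 16 * t ^ 2 + 16) ^ 3 / (t ^ 2 * (t ^ 2 - 16))
  | 9 => t ^ 3 * (t ^ 3 - 24) ^ 3 / (t ^ 3 - 27)
  | 10 => (t ^ 6 - 4 * t ^ 5 + 16 * t + 16) ^ 3 / (t ^ 5 * (t + 1) ^ 2 * (t - 4))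
  | 12 =>
      (t ^ 2 - 3) ^ 3 * (t ^ 6 - 9 * t ^ 4 + 3 * t ^ 2 - 3) ^ 3 / (t ^ 4 * (t ^ 2 - 9) * (t ^ 2
      - 1) ^ 3)
  | 13 => (t ^ 2 + 5 * t + 13) * (t ^ 4 + 7 * t ^ 3 + 20 * t ^ 2 + 19 * t + 1) ^ 3 / t
  | 16 => (t ^ 8 - 16 * t ^ 4 + 16) ^ 3 / (t ^ 4 * (t ^ 4 - 16))
  | 18 =>
      (t ^ 3 - 2) ^ 3 * (t ^ 9 - 6 * t ^ 6 - 12 * t ^ 3 - 8) ^ 3 / (t ^ 9 * (t ^ 3 - 8) *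
      (t ^ 3 + 1) ^ 2)
  | 25 =>
      (t ^ 10 + 10 * t ^ 8 + 35 * t ^ 6 - 12 * t ^ 5 + 50 * t ^ 4 - 60 * t ^ 3 + 25 * t ^ 2
      - 60 * t + 16) ^ 3 / (t ^ 5 + 5 * t ^ 3 + 5 * t - 11)
  | _ => 0

/-- The number of curves `𝒞_{n,i}`: the index `i` runs through `1, …, numCurves n`. -/
def numCurves (n : ℕ) : ℕ :=
  match n with
  | 2 | 3 | 5 | 7 | 13 => 2
  | 4 | 6 | 10 => 4
  | 8 | 18 => 6
  | 9 | 25 => 3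
  | 12 | 16 => 8
  | _ => 0

/-- The index `k₁` of a curve with `j`-invariant `j_{n,1}`. -/
def k₁ (n : ℕ) : ℕ :=
  match n with
  | 2 | 3 | 5 | 6 | 7 | 9 | 10 | 13 | 18 | 25 => 1
  | 4 => 4
  | 8 => 3
  | 12 => 5
  | 16 => 2
  | _ => 0

/-- The index `k₂` of a curve with `j`-invariant `j_{n,2}`. -/
def k₂ (n : ℕ) : ℕ :=
  match n with
  | 2 | 3 | 4 | 5 | 7 | 13 => 2
  | 6 | 10 | 12 => 4
  | 8 | 18 => 6
  | 9 | 25 => 3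
  | 16 => 8
  | _ => 0

/-- The arrows of the partial isogeny graph for level `n`: an entry `(i, k, l, m)` is the arrow
`ψ_{n,i} : 𝒞_{n,k} → 𝒞_{n,l}`, labelled with the degree `m`. -/
def arrows (n : ℕ) : List (ℕ × ℕ × ℕ × ℕ) :=
  match n with
  | 2 => [(1, 1, 2, 2)]
  | 3 => [(1, 1, 2, 3)]
  | 4 => [(1, 1, 2, 2), (2, 1, 3, 2), (3, 4, 1, 2)]
  | 5 => [(1, 1, 2, 5)]
  | 6 => [(1, 1, 2, 2), (2, 1, 3, 3), (3, 3, 4, 2), (4, 2, 4, 3)]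
  | 7 => [(1, 1, 2, 7)]
  | 8 => [(1, 1, 2, 2), (2, 3, 1, 2), (3, 1, 4, 2), (4, 4, 5, 2), (5, 4, 6, 2)]
  | 9 => [(1, 1, 2, 3), (2, 2, 3, 3)]
  | 10 => [(1, 1, 2, 2), (2, 1, 3, 5), (3, 3, 4, 2), (4, 2, 4, 5)]
  | 12 =>
      [(1, 1, 2, 3), (2, 8, 2, 2), (3, 7, 8, 3), (4, 1, 7, 2), (5, 5, 1, 2), (6, 5, 6, 3),
      (7, 6, 2, 2), (8, 2, 4, 2), (9, 3, 4, 3), (10, 1, 3, 2)]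
  | 13 => [(1, 1, 2, 13)]
  | 16 =>
      [(1, 1, 3, 2), (2, 2, 1, 2), (3, 1, 4, 2), (4, 4, 5, 2), (5, 4, 6, 2), (6, 6, 7, 2),
      (7, 6, 8, 2)]
  | 18 =>
      [(1, 1, 3, 3), (2, 1, 2, 2), (3, 2, 4, 3), (4, 3, 4, 2), (5, 3, 5, 3), (6, 5, 6, 2),
      (7, 4, 6, 3)]
  | 25 => [(1, 1, 2, 5), (2, 2, 3, 5)]
  | _ => []

/-! ### The coefficients of the curves -/

/-- The value at `t` of the polynomial with the given coefficients, the leading one first: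
`horner t [a₀, a₁, …, aₘ] = a₀ t ^ m + a₁ t ^ (m - 1) + ⋯ + aₘ`. -/
def horner {R : Type*} [CommRing R] (t : R) (l : List ℤ) : R :=
  l.foldl (fun (s : R) (a : ℤ) => s * t + (a : R)) 0

/-- The coefficient `𝒜_{n,i}(t)` of the model `y² = x³ + d² 𝒜_{n,i}(t) x + d³ ℬ_{n,i}(t)`. -/
def coeffA {R : Type*} [CommRing R] (n i : ℕ) (t : R) : R :=
  match n, i with
  | 2, 1 => -27 * horner t [1, 320, 16384]
  | 2, 2 => -432 * horner t [1, 80, 1024]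
  | 3, 1 => -3 * horner t [1, 270, 6561]
  | 3, 2 => -243 * horner t [1, 30, 81]
  | 4, 1 => -432 * horner t [1, 16, 256]
  | 4, 2 => -6912 * horner t [1, 16, 16]
  | 4, 3 => -432 * horner t [1, -224, 256]
  | 4, 4 => -27 * horner t [1, 256, 4096]
  | 5, 1 => -27 * horner t [1, 272, 8750, 100000, 390625]
  | 5, 2 => -16875 * horner t [1, 32, 350, 1360, 625]
  | 6, 1 => -3 * horner t [1, 264, 6912, 62208, 186624]
  | 6, 2 => -48 * horner t [1, 24, 432, 3888, 11664]
  | 6, 3 => -243 * horner t [1, 24, 192, 768, 2304]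
  | 6, 4 => -3888 * horner t [1, 24, 192, 528, 144]
  | 7, 1 => -27 * horner t [1, 258, 5635, 43218, 117649]
  | 7, 2 => -64827 * horner t [1, 18, 115, 258, 49]
  | 8, 1 => -432 * horner t [1, 0, 224, 0, 256]
  | 8, 2 => -432 * horner t [1, -240, 2144, -3840, 256]
  | 8, 3 => -27 * horner t [1, 240, 2144, 3840, 256]
  | 8, 4 => -6912 * horner t [1, 0, -16, 0, 256]
  | 8, 5 => -6912 * horner t [1, 0, -256, 0, 4096]
  | 8, 6 => -110592 * horner t [1, 0, -16, 0, 16]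
  | 9, 1 => -3 * horner t [1, 240, 2160, 6696, 12960]
  | 9, 2 => -243 * horner t [1, 0, 0, 216, 0]
  | 9, 3 => -19683 * horner t [1, 0, 0, -24, 0]
  | 10, 1 => -27 * horner t [1, 236, 1444, 2864, 9600, 7936, 15616, 1024, 1024]
  | 10, 2 => -432 * horner t [1, -4, 244, -496, 2400, -2864, 5776, -3776, 64]
  | 10, 3 => -16875 * horner t [1, -4, 4, -16, 0, 256, 256, 1024, 1024]
  | 10, 4 => -270000 * horner t [1, -4, 4, -16, 0, 16, 16, 64, 64]
  | 12, 1 => -48 * horner t [1, 0, 228, 0, 270, 0, -972, 0, 729]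
  | 12, 2 => -3888 * horner t [1, 0, -12, 0, 30, 0, 228, 0, 9]
  | 12, 3 => -768 * horner t [1, 0, -12, 0, 270, 0, -972, 0, 729]
  | 12, 4 => -62208 * horner t [1, 0, -12, 0, 30, 0, -12, 0, 9]
  | 12, 5 => -3 * horner t [1, 240, 2148, 4320, 270, -6480, -972, 0, 729]
  | 12, 6 => -243 * horner t [1, 0, -12, 240, 30, -1440, 2148, -720, 9]
  | 12, 7 => -48 * horner t [1, -240, 2148, -4320, 270, 6480, -972, 0, 729]
  | 12, 8 => -3888 * horner t [1, 0, -12, -240, 30, 1440, 2148, 720, 9]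
  | 13, 1 => -27 * horner t [1, 258, 6153, 66534, 422500, 1700478, 4369833, 6683274, 4826809]
  | 13, 2 => -771147 * horner t [1, 18, 153, 774, 2500, 5118, 6153, 3354, 169]
  | 16, 1 => -432 * horner t [1, 0, 240, 0, 2144, 0, 3840, 0, 256]
  | 16, 2 => -27 * horner t [1, 240, 2160, 6720, 17504, 26880, 34560, 15360, 256]
  | 16, 3 => -432 * horner t [1, -240, 2160, -6720, 17504, -26880, 34560, -15360, 256]
  | 16, 4 => -6912 * horner t [1, 0, 0, 0, 224, 0, 0, 0, 256]
  | 16, 5 => -6912 * horner t [1, 0, -240, 0, 2144, 0, -3840, 0, 256]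
  | 16, 6 => -110592 * horner t [1, 0, 0, 0, -16, 0, 0, 0, 256]
  | 16, 7 => -110592 * horner t [1, 0, 0, 0, -256, 0, 0, 0, 4096]
  | 16, 8 => -1769472 * horner t [1, 0, 0, 0, -16, 0, 0, 0, 16]
  | 18, 1 =>
      -3 * horner t [1, 240, 2160, 6712, 15840, 17280, 26880, 11520, 34560, 256, 15360, 0, 256]
  | 18, 2 =>
      -48 * horner t [1, 0, 240, -8, 2160, -1440, 6720, -8640, 15840, -13424, 8640, -1920, 16]
  | 18, 3 => -243 * horner t [1, 0, 0, 232, 0, 0, 960, 0, 0, 256, 0, 0, 256]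
  | 18, 4 => -3888 * horner t [1, 0, 0, -8, 0, 0, 240, 0, 0, -464, 0, 0, 16]
  | 18, 5 => -19683 * horner t [1, 0, 0, -8, 0, 0, 0, 0, 0, 256, 0, 0, 256]
  | 18, 6 => -314928 * horner t [1, 0, 0, -8, 0, 0, 0, 0, 0, 16, 0, 0, 16]
  | 25, 1 =>
      -27 * horner t [1, 240, 2174, 9840, 43515, 119268, 345550, 648372, 1328385, 1678260,
      2389556, 1698960, 1501504]
  | 25, 2 => -16875 * horner t [1, 0, 14, 0, 75, 228, 190, 2052, 225, 5700, 596, 4560, 1984]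
  | 25, 3 => -10546875 * horner t [1, 0, 14, 0, 75, -12, 190, -108, 225, -300, 116, -240, 64]
  | _, _ => 0

/-- The coefficient `ℬ_{n,i}(t)` of the model `y² = x³ + d² 𝒜_{n,i}(t) x + d³ ℬ_{n,i}(t)`. -/
def coeffB {R : Type*} [CommRing R] (n i : ℕ) (t : R) : R :=
  match n, i with
  | 2, 1 => 54 * horner t [1, -384, -61440, -2097152]
  | 2, 2 => 3456 * horner t [1, 120, 3072, -32768]
  | 3, 1 => -2 * horner t [1, -459, -32805, -531441]
  | 3, 2 => -1458 * horner t [1, 45, 459, -729]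
  | 4, 1 => 3456 * horner t [1, 24, -384, -4096]
  | 4, 2 => 221184 * horner t [1, 24, 120, -64]
  | 4, 3 => 3456 * horner t [1, 528, -8448, -4096]
  | 4, 4 => 54 * horner t [1, -480, -24576, -262144]
  | 5, 1 => 54 * horner t [1, -456, -36891, -1049000, -14203125, -93750000, -244140625]
  | 5, 2 => 843750 * horner t [1, 48, 909, 8392, 36891, 57000, -15625]
  | 6, 1 => -2 * horner t [1, -468, -31752, -730944, -7838208, -40310784, -80621568]
  | 6, 2 => -128 * horner t [1, 36, 0, -9720, -122472, -629856, -1259712]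
  | 6, 3 => -1458 * horner t [1, 36, 504, 2880, 0, -55296, -110592]
  | 6, 4 => -93312 * horner t [1, 36, 504, 3384, 10584, 11232, -1728]
  | 7, 1 => 54 * horner t [1, -477, -27930, -540225, -4941258, -22235661, -40353607]
  | 7, 2 => 6353046 * horner t [1, 27, 294, 1575, 3990, 3339, -343]
  | 8, 1 => 3456 * horner t [1, 0, -528, 0, -8448, 0, 4096]
  | 8, 2 => 3456 * horner t [1, 504, -16656, 112896, -266496, 129024, 4096]
  | 8, 3 => 54 * horner t [1, -504, -16656, -112896, -266496, -129024, 4096]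
  | 8, 4 => 221184 * horner t [1, 0, -24, 0, -384, 0, 4096]
  | 8, 5 => 221184 * horner t [1, 0, 480, 0, -24576, 0, 262144]
  | 8, 6 => 14155776 * horner t [1, 0, -24, 0, 120, 0, 64]
  | 9, 1 => -2 * horner t [1, -504, -16632, -123012, -517104, -1143072, -1475496]
  | 9, 2 => -1458 * horner t [1, 0, 0, -540, 0, 0, -5832]
  | 9, 3 => -1062882 * horner t [1, 0, 0, -36, 0, 0, 216]
  | 10, 1 =>
      54 * horner t [1, -510, -14100, -60512, -233808, -524640, -1257408, -1420032, -2445312,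
      -1015808, -1007616, 49152, 32768]
  | 10, 2 =>
      3456 * horner t [1, -6, -492, 1984, -19104, 44376, -157176, 262320, -467616, 484096,
      -451200, 65280, 512]
  | 10, 3 =>
      843750 * horner t [1, -6, 12, -32, 48, -480, 576, -768, 6144, 16384, 24576, 49152, 32768]
  | 10, 4 => 54000000 * horner t [1, -6, 12, -32, 48, 24, 72, 240, 96, 256, 384, 768, 512]
  | 12, 1 => -128 * horner t [1, 0, -522, 0, -9477, 0, 18468, 0, -24057, 0, 39366, 0, -19683]
  | 12, 2 => -93312 * horner t [1, 0, -18, 0, 99, 0, -684, 0, 3159, 0, 1566, 0, -27]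
  | 12, 3 => -8192 * horner t [1, 0, -18, 0, -405, 0, 4860, 0, -24057, 0, 39366, 0, -19683]
  | 12, 4 => -5971968 * horner t [1, 0, -18, 0, 99, 0, -180, 0, 135, 0, 54, 0, -27]
  | 12, 5 =>
      -2 * horner t [1, -504, -16650, -114912, -299781, -136080, 453924, 489888, -24057,
      -367416, 39366, 0, -19683]
  | 12, 6 =>
      -1458 * horner t [1, 0, -18, -504, 99, 6048, -16812, -15120, 99927, -114912, 49950,
      -4536, -27]
  | 12, 7 =>
      -128 * horner t [1, 504, -16650, 114912, -299781, 136080, 453924, -489888, -24057,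
      367416, 39366, 0, -19683]
  | 12, 8 =>
      -93312 * horner t [1, 0, -18, 504, 99, -6048, -16812, 15120, 99927, 114912, 49950, 4536,
      -27]
  | 13, 1 =>
      54 * horner t [1, -477, -28881, -653850, -8436441, -71768385, -430497756, -1877228847,
      -5993782899, -13814327358, -22024729467, -22024729467, -10604499373]
  | 13, 2 =>
      260647686 * horner t [1, 27, 351, 2862, 16143, 65727, 195948, 424665, 648957, 653850,
      375453, 80613, -2197]
  | 16, 1 => 3456 * horner t [1, 0, -504, 0, -16656, 0, -112896, 0, -266496, 0, -129024, 0, 4096]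
  | 16, 2 =>
      54 * horner t [1, -504, -16632, -122976, -532752, -1564416, -3725568, -6257664, -8524032,
      -7870464, -4257792, -516096, 4096]
  | 16, 3 =>
      3456 * horner t [1, 504, -16632, 122976, -532752, 1564416, -3725568, 6257664, -8524032,
      7870464, -4257792, 516096, 4096]
  | 16, 4 => 221184 * horner t [1, 0, 0, 0, -528, 0, 0, 0, -8448, 0, 0, 0, 4096]
  | 16, 5 => 221184 * horner t [1, 0, 504, 0, -16656, 0, 112896, 0, -266496, 0, 129024, 0, 4096]
  | 16, 6 => 14155776 * horner t [1, 0, 0, 0, -24, 0, 0, 0, -384, 0, 0, 0, 4096]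
  | 16, 7 => 14155776 * horner t [1, 0, 0, 0, 480, 0, 0, 0, -24576, 0, 0, 0, 262144]
  | 16, 8 => 905969664 * horner t [1, 0, 0, 0, -24, 0, 0, 0, 120, 0, 0, 0, 64]
  | 18, 1 =>
      -2 * horner t [1, -504, -16632, -122988, -527184, -1409184, -2951400, -4217472, -6168960,
      -5903296, -8596224, -4257792, -7868928, -645120, -4257792, 6144, -516096, 0, 4096]
  | 18, 2 =>
      -128 * horner t [1, 0, -504, -12, -16632, 5040, -122952, 133056, -537264, 737912,
      -1542240, 2108736, -2951400, 2818368, -2108736, 983904, -266112, 16128, 64]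
  | 18, 3 =>
      -1458 * horner t [1, 0, 0, -516, 0, 0, -12072, 0, 0, -24640, 0, 0, -30720, 0, 0, 6144, 0,
      0, 4096]
  | 18, 4 =>
      -93312 * horner t [1, 0, 0, -12, 0, 0, -480, 0, 0, 3080, 0, 0, -12072, 0, 0, 4128, 0, 0,
      64]
  | 18, 5 =>
      -1062882 * horner t [1, 0, 0, -12, 0, 0, 24, 0, 0, -448, 0, 0, 1536, 0, 0, 6144, 0, 0,
      4096]
  | 18, 6 => -68024448 * horner t [1, 0, 0, -12, 0, 0, 24, 0, 0, 56, 0, 0, 24, 0, 0, 96, 0, 0, 64]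
  | 25, 1 =>
      54 * horner t [1, -504, -16611, -133056, -848550, -3873258, -15583283, -50025312,
      -148053462, -359395650, -820470687, -1538388072, -2734681643, -3903040458, -5302026300,
      -5402959056, -5275448016, -3122753184, -1839881024]
  | 25, 2 =>
      843750 * horner t [1, 0, 21, 0, 186, -522, 901, -8352, 2586, -52722, -5559, -164952,
      -105659, -261522, -407964, -187920, -559824, -41760, -160064]
  | 25, 3 =>
      13183593750 * horner t [1, 0, 21, 0, 186, -18, 901, -288, 2586, -1818, 4521, -5688, 5221,
      -9018, 5316, -6480, 4656, -1440, 1216]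
  | _, _ => 0

/-! ### The curves over the field `K(t, d)` -/

/-- The curve `𝒞_{n,i}(t, d) : y² = x³ + d² 𝒜_{n,i}(t) x + d³ ℬ_{n,i}(t)`. -/
def curve {R : Type*} [CommRing R] (n i : ℕ) (t d : R) : WeierstrassCurve R where
  a₁ := 0
  a₂ := 0
  a₃ := 0
  a₄ := d ^ 2 * coeffA n i t
  a₆ := d ^ 3 * coeffB n i t

/-- The field `K(t, d)` of rational functions in two variables. -/
abbrev RatFunc₂ (K : Type*) [Field K] : Type _ := FractionRing (MvPolynomial (Fin 2) K)

/-- The variable `t` of `K(t, d)`. -/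
def tVar (K : Type*) [Field K] : RatFunc₂ K :=
  algebraMap (MvPolynomial (Fin 2) K) (RatFunc₂ K) (MvPolynomial.X 0)

/-- The variable `d` of `K(t, d)`. -/
def dVar (K : Type*) [Field K] : RatFunc₂ K :=
  algebraMap (MvPolynomial (Fin 2) K) (RatFunc₂ K) (MvPolynomial.X 1)

/-- The constant `c` in the standard form `(f(x), c y f'(x))` of `ψ_{n,i}`: all of them are
normalized, except `ψ_{12,2}`. -/
def scale (F : Type*) [Field F] (n i : ℕ) : F := if n = 12 ∧ i = 2 then 1 / 2 else 1

end IsogenyGraphs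

end

/-!
The isogenies are constructed from explicit formulas. For a map `(x, y) ↦ (f(x), c y f'(x))` with
`f = N / D`, the condition that it sends `y² = x³ + a x + b` to `y² = x³ + a' x + b'` is a polynomial
identity, the differential equation `c² f'² (x³ + a x + b) = f³ + a' f + b'` of `StandardMap`.

A map of this kind is automatically a homomorphism. Three collinear points of the source have
collinear images: the norm of the line function `y - (l x + m)` to the function field of the target
has the form `A + B Y` with polynomials `A`, `B` in the coordinate `X`, its norm to `k[X]` has
degree three, and so `A` has degree at most one and `B` is constant (`StandardMap.exists_line`).
Hence the map is additive on points in general position, and a map that is additive up to finite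
exceptional sets agrees with a homomorphism (`exists_addMonoidHom_of_eventually_additive`).
Comparing the order of the kernel, which is at least the degree of `f` by a count in a separable
fibre, with the number of poles of `f` shows that the kernel consists of the poles
(`StandardMap.exists_hom`). All degrees in question are prime, so the kernels are cyclic.

The fractions `f` come from Vélu's formulas: for degrees two and three they are written in terms of
the abscissa of a kernel point (`standardMap_two`, `standardMap_three`), and for odd degree at least
five in terms of the kernel polynomial (`standardMap_of_kernelNumerator`). In the latter case the
differential equation is an identity between integral polynomials in two variables. It is verified
by Kronecker substitution: an integral polynomial vanishes if it vanishes at a point at which large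
powers of two prevent any cancellation (`PolyExpr.denote_eq_zero_of_vanishes`).

All statements about nonvanishing, which have to hold in every characteristic prime to `6 n`, are
read off from integral polynomials in `t⁻¹`: such a polynomial has a nonzero value if the greatest
common divisor of some of its coefficients is composed of primes that divide `6 n`. In this way the
discriminants are nonzero (`disc_ne_zero`), and the quotients `𝒜³ / ℬ²`, which determine the
isomorphism class over an algebraic closure, are pairwise distinct (`cross_ne_zero`). The
separability of the kernel polynomials is verified at the cusp `t = ∞`.

Every curve of a level is reached from the first one by arrows of the graph, together with four
isogenies of degree two that are dual to arrows ending at the first curve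
(`isogenous_curve_one`).
-/

open Polynomial WeierstrassCurve

noncomputable section

namespace IsogenyGraphs

/-! ### Maps in standard form and their fibres -/

/-- The numerator of the derivative of the fraction `N / D`. -/
def quotDeriv {R : Type*} [CommRing R] (N D : R[X]) : R[X] :=
  derivative N * D - N * derivative D

/-- The cubic `X³ + a X + b`. -/
def cubic {R : Type*} [CommRing R] (a b : R) : R[X] := X ^ 3 + C a * X + C b

/-- The fraction `f = N / D`, in lowest terms and of larger degree in the numerator, satisfies
`c² f'² (x³ + a x + b) = f³ + a' f + b'`, so that `(x, y) ↦ (f(x), c y f'(x))` maps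
`y² = x³ + a x + b` to `y² = x³ + a' x + b'`. -/
structure StandardMap {F : Type*} [Field F] (a b a' b' c : F) (N D : F[X]) : Prop where
  coprime : IsCoprime N D
  degree_lt : D.natDegree < N.natDegree
  c_ne_zero : c ≠ 0
  ode : C (c ^ 2) * quotDeriv N D ^ 2 * cubic a b =
    D * (N ^ 3 + C a' * N * D ^ 2 + C b' * D ^ 3)

section GenericFibre

variable {k : Type*} [Field k]

lemma cubic_natDegree (a b : k) : (cubic a b).natDegree = 3 := by
  unfold cubic; compute_degree!

lemma cubic_monic (a b : k) : (cubic a b).Monic := by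
  unfold cubic; monicity!

lemma cubic_ne_zero (a b : k) : cubic a b ≠ 0 := (cubic_monic a b).ne_zero

namespace StandardMap

variable {a b a' b' c : k} {N D : k[X]} (h : StandardMap a b a' b' c N D)
include h

lemma N_ne_zero : N ≠ 0 := by
  rintro rfl
  have := h.degree_lt
  simp at this

lemma D_ne_zero : D ≠ 0 := by
  rintro rfl
  have h1 := h.coprime
  rw [isCoprime_zero_right] at h1
  have h2 := natDegree_eq_zero_of_isUnit h1
  have := h.degree_lt
  simp [h2] at this

lemma cubicForm_natDegree :
    (N ^ 3 + C a' * N * D ^ 2 + C b' * D ^ 3).natDegree = 3 * N.natDegree := by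
  have hd := h.degree_lt
  have h1 : (C a' * N * D ^ 2 + C b' * D ^ 3).natDegree < (N ^ 3).natDegree := by
    rw [natDegree_pow]
    have e1 : (C a' * N * D ^ 2).natDegree ≤ N.natDegree + 2 * D.natDegree := by
      refine natDegree_mul_le.trans ?_
      rw [natDegree_pow]
      gcongr
      exact natDegree_C_mul_le _ _
    have e2 : (C b' * D ^ 3).natDegree ≤ 3 * D.natDegree := by
      refine (natDegree_C_mul_le _ _).trans ?_
      rw [natDegree_pow]
    have := natDegree_add_le (C a' * N * D ^ 2) (C b' * D ^ 3)
    omega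
  rw [add_assoc, natDegree_add_eq_left_of_natDegree_lt h1, natDegree_pow]

lemma quotDeriv_ne_zero : quotDeriv N D ≠ 0 := by
  intro h0
  have h1 := h.ode
  rw [h0] at h1
  have h2 : N ^ 3 + C a' * N * D ^ 2 + C b' * D ^ 3 ≠ 0 := by
    intro h3
    have := h.cubicForm_natDegree
    have := h.degree_lt
    rw [h3] at *
    simp at *
    omega
  simp only [ne_eq, OfNat.ofNat_ne_zero, not_false_eq_true, zero_pow, mul_zero, zero_mul] at h1
  exact mul_ne_zero h.D_ne_zero h2 h1.symm

end StandardMap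

/-- Over an algebraically closed field, an element of an extension field that is a root of a nonzero
polynomial is a constant. -/
lemma exists_algebraMap_eq_of_aeval_eq_zero [IsAlgClosed k] {M : Type*} [Field M] [Algebra k M]
    {q : k[X]} (hq : q ≠ 0) {r : M} (hr : aeval r q = 0) : ∃ r₀, algebraMap k M r₀ = r := by
  have h1 := (IsAlgClosed.splits q).eq_prod_roots
  rw [h1, map_mul, aeval_C, mul_eq_zero] at hr
  rcases hr with hr | hr
  · rw [map_eq_zero, leadingCoeff_eq_zero] at hr
    exact absurd hr hq
  · rw [map_multiset_prod, Multiset.prod_eq_zero_iff, Multiset.map_map, Multiset.mem_map] at hr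
    obtain ⟨r₀, -, h2⟩ := hr
    refine ⟨r₀, ?_⟩
    simp only [Function.comp_apply, map_sub, aeval_X, aeval_C, sub_eq_zero] at h2
    exact h2.symm

/-- The polynomial `N(T) - τ D(T)` whose roots are the preimages of `τ` under `N / D`. -/
def fibrePoly {M : Type*} [Field M] [Algebra k M] (N D : k[X]) (τ : M) : M[X] :=
  N.map (algebraMap k M) - C τ * D.map (algebraMap k M)

lemma fibrePoly_eval {M : Type*} [Field M] [Algebra k M] (N D : k[X]) (τ r : M) :
    (fibrePoly N D τ).eval r = aeval r N - τ * aeval r D := by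
  simp [fibrePoly, aeval_def, eval_map]

/-- A fibre that contains no critical point is separable. -/
lemma fibrePoly_separable {M : Type*} [Field M] [Algebra k M] {N D : k[X]} {τ : M}
    (hW : ∀ r : AlgebraicClosure M, aeval r N = algebraMap M _ τ * aeval r D →
      aeval r (quotDeriv N D) ≠ 0) :
    (fibrePoly N D τ).Separable := by
  rw [separable_def, isCoprime_iff_aeval_ne_zero_of_isAlgClosed M (AlgebraicClosure M)]
  intro r
  by_contra! hcon
  obtain ⟨h1, h2⟩ := hcon
  have h1' : aeval r N = algebraMap M _ τ * aeval r D := by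
    simpa [fibrePoly, sub_eq_zero, aeval_map_algebraMap] using h1
  have h2' : aeval r (derivative N) = algebraMap M _ τ * aeval r (derivative D) := by
    simpa [fibrePoly, sub_eq_zero, aeval_map_algebraMap, derivative_map] using h2
  apply hW r h1'
  simp only [quotDeriv, map_sub, map_mul, h1', h2']
  ring

namespace StandardMap

variable {a b a' b' c : k} {N D : k[X]} (h : StandardMap a b a' b' c N D)
include h

lemma fibrePoly_natDegree {M : Type*} [Field M] [Algebra k M] (τ : M) :
    (fibrePoly N D τ).natDegree = N.natDegree := by
  unfold fibrePoly
  rw [natDegree_sub_eq_left_of_natDegree_lt, natDegree_map]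
  refine (natDegree_C_mul_le _ _).trans_lt ?_
  rw [natDegree_map, natDegree_map]
  exact h.degree_lt

lemma fibrePoly_leadingCoeff {M : Type*} [Field M] [Algebra k M] (τ : M) :
    (fibrePoly N D τ).leadingCoeff = algebraMap k M N.leadingCoeff := by
  rw [leadingCoeff, h.fibrePoly_natDegree]
  unfold fibrePoly
  have : D.coeff N.natDegree = 0 := coeff_eq_zero_of_natDegree_lt h.degree_lt
  simp [this]

lemma aeval_D_ne_zero {M : Type*} [Field M] [Algebra k M] {τ r : M}
    (hr : (fibrePoly N D τ).eval r = 0) : aeval r D ≠ 0 := by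
  intro h0
  rw [fibrePoly_eval, h0, mul_zero, sub_zero] at hr
  obtain ⟨u, v, huv⟩ := h.coprime
  have := congrArg (aeval r) huv
  simp [hr, h0] at this

/-- No root of `quotDeriv N D` lies in the fibre over a transcendental element. -/
lemma aeval_quotDeriv_ne_zero [IsAlgClosed k] {M : Type*} [Field M] [Algebra k M] {τ : M}
    (hτ : Transcendental k τ) {r : M} (hr : aeval r N = τ * aeval r D) :
    aeval r (quotDeriv N D) ≠ 0 := by
  intro h0
  obtain ⟨r₀, rfl⟩ := exists_algebraMap_eq_of_aeval_eq_zero h.quotDeriv_ne_zero h0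
  have hD : aeval (algebraMap k M r₀) D ≠ 0 := by
    apply h.aeval_D_ne_zero (τ := τ)
    rw [fibrePoly_eval, hr, sub_self]
  apply hτ
  rw [aeval_algebraMap_apply] at hr hD
  rw [aeval_algebraMap_apply] at hr
  have : τ = algebraMap k M (aeval r₀ N / aeval r₀ D) := by
    rw [map_div₀, eq_div_iff hD, hr]
  rw [this]
  exact isAlgebraic_algebraMap _

end StandardMap

end GenericFibre

/-! ### Integral extensions and the norm of a line function -/

section Generic

/-- Every maximal ideal `(X - x₀)` of `k[X]`, for `k` algebraically closed, extends to a
`k`-point of an integral extension of `k[X]`. -/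
lemma exists_algHom_of_isIntegral {k : Type*} [Field k] [IsAlgClosed k] {S : Type*} [CommRing S]
    [IsDomain S] [Algebra k[X] S] [Algebra k S] [IsScalarTower k k[X] S]
    [Algebra.IsIntegral k[X] S] [FaithfulSMul k[X] S] (x₀ : k) :
    ∃ θ : S →ₐ[k] k, ∀ q : k[X], θ (algebraMap k[X] S q) = q.eval x₀ := by
  let I : Ideal k[X] := RingHom.ker (Polynomial.evalRingHom x₀)
  have hI : I.IsMaximal := RingHom.ker_isMaximal_of_surjective _ fun a => ⟨C a, by simp⟩
  obtain ⟨Q, hQ, hQI⟩ := Ideal.exists_ideal_over_prime_of_isIntegral_of_isDomain (S := S) I (by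
    rw [(RingHom.injective_iff_ker_eq_bot _).1 (FaithfulSMul.algebraMap_injective k[X] S)]
    exact bot_le)
  have hint : Algebra.IsIntegral k (S ⧸ Q) := by
    constructor
    intro z
    obtain ⟨z, rfl⟩ := Ideal.Quotient.mk_surjective z
    obtain ⟨f, hf, hfz⟩ := Algebra.IsIntegral.isIntegral (R := k[X]) z
    refine ⟨f.map (Polynomial.evalRingHom x₀), hf.map _, ?_⟩
    have key : (algebraMap k (S ⧸ Q)).comp (Polynomial.evalRingHom x₀) =
        (Ideal.Quotient.mk Q).comp (algebraMap k[X] S) := by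
      ext q
      · simp [← Ideal.Quotient.mk_algebraMap]
        rw [IsScalarTower.algebraMap_apply k k[X] S]
        rfl
      · simp only [RingHom.comp_apply, coe_evalRingHom, eval_X]
        rw [← sub_eq_zero, ← Ideal.Quotient.mk_algebraMap, ← map_sub,
          Ideal.Quotient.eq_zero_iff_mem, IsScalarTower.algebraMap_apply k k[X] S, ← map_sub,
          ← Ideal.mem_comap, hQI]
        simp [I, RingHom.mem_ker]
    rw [eval₂_map, key, ← Polynomial.hom_eval₂, hfz, map_zero]
  have hbij := IsAlgClosed.algebraMap_bijective_of_isIntegral (k := k) (K := S ⧸ Q)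
  let e := (AlgEquiv.ofBijective (Algebra.ofId k (S ⧸ Q)) hbij).symm
  refine ⟨(e : (S ⧸ Q) →ₐ[k] k).comp (Ideal.Quotient.mkₐ k Q), fun q => ?_⟩
  have h1 : q - C (q.eval x₀) ∈ I := by simp [I, RingHom.mem_ker]
  rw [← hQI, Ideal.mem_comap, ← Ideal.Quotient.eq_zero_iff_mem, map_sub, map_sub, sub_eq_zero] at h1
  simp only [AlgHom.comp_apply, Ideal.Quotient.mkₐ_eq_mk]
  rw [h1]
  have : algebraMap k[X] S (C (q.eval x₀)) = algebraMap k S (q.eval x₀) := by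
    rw [IsScalarTower.algebraMap_apply k k[X] S]; rfl
  rw [this, Ideal.Quotient.mk_algebraMap]
  exact e.commutes (q.eval x₀)

/-- An element of a Galois extension of `Frac R`, integral over the integrally closed ring `R` and
fixed by the Galois group, lies in `R`. -/
lemma exists_algebraMap_eq_of_forall_fixed {R E M : Type*} [CommRing R] [IsDomain R]
    [IsIntegrallyClosed R]
    [Field E] [Algebra R E] [IsFractionRing R E] [Field M] [Algebra E M] [Algebra R M]
    [IsScalarTower R E M] [IsGalois E M] {z : M} (hz : IsIntegral R z)
    (hfix : ∀ σ : M ≃ₐ[E] M, σ z = z) : ∃ q : R, algebraMap R M q = z := by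
  obtain ⟨w, rfl⟩ := (InfiniteGalois.mem_range_algebraMap_iff_fixed z).2 hfix
  have hw : IsIntegral R w :=
    (isIntegral_algebraMap_iff (FaithfulSMul.algebraMap_injective E M)).1 hz
  obtain ⟨q, rfl⟩ := IsIntegrallyClosed.isIntegral_iff.1 hw
  exact ⟨q, IsScalarTower.algebraMap_apply R E M q⟩

variable {k : Type*} [Field k]

/-- The ratio `D² / (c (N' D - N D'))`, that is `1 / (c f')`, at `r`: the point over `(f(r), Y)`
with abscissa `r` has ordinate `Y` times this factor. -/
def yFactor {M : Type*} [Field M] [Algebra k M] (c : k) (N D : k[X]) (r : M) : M :=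
  aeval r D ^ 2 / (algebraMap k M c * aeval r (quotDeriv N D))

/-- The product of `Z s(ρ) - (l ρ + m)` over the fibre of `N / D` over `τ`, where `s` is
`yFactor`. At `Z = Y` it is the norm of the line function `y - (l x + m)` to the function field of
the target curve. -/
def lineNorm {M : Type*} [Field M] [Algebra k M] (c : k) (N D : k[X]) (τ : M) (l m : k) (Z : M) :
    M :=
  ((fibrePoly N D τ).roots.map fun r =>
    Z * yFactor c N D r - (algebraMap k M l * r + algebraMap k M m)).prod

/-- An automorphism that fixes `τ` permutes the fibre over `τ`. -/
lemma map_lineNorm {E M : Type*} [Field M] [Algebra k M] [Field E] [Algebra E M] [Algebra k E]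
    [IsScalarTower k E M] (c : k) (N D : k[X]) (τ : E) (l m : k) (Z : M)
    (hs : (fibrePoly N D (algebraMap E M τ)).Splits) (σ : M ≃ₐ[E] M) :
    σ (lineNorm c N D (algebraMap E M τ) l m Z) =
      lineNorm c N D (algebraMap E M τ) l m (σ Z) := by
  have hσ : ∀ x : k, σ (algebraMap k M x) = algebraMap k M x := fun x => by
    rw [IsScalarTower.algebraMap_apply k E M, σ.commutes]
  have hσp : ∀ (q : k[X]) (r : M), σ (aeval r q) = aeval (σ r) q := fun q r =>
    (aeval_algHom_apply ((σ : M →ₐ[E] M).restrictScalars k) r q).symm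
  have hmap : (fibrePoly N D (algebraMap E M τ)).map (σ : M →+* M) =
      fibrePoly N D (algebraMap E M τ) := by
    have : (σ : M →+* M).comp (algebraMap k M) = algebraMap k M := by
      ext x; simpa using hσ x
    simp [fibrePoly, Polynomial.map_sub, Polynomial.map_mul, Polynomial.map_map, this]
  have hroots : (fibrePoly N D (algebraMap E M τ)).roots.map σ =
      (fibrePoly N D (algebraMap E M τ)).roots := by
    have := hs.roots_map (σ : M →+* M)
    rw [hmap] at this
    exact this.symm
  unfold lineNorm
  rw [map_multiset_prod, Multiset.map_map]
  conv_rhs => rw [← hroots, Multiset.map_map]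
  congr 1
  apply Multiset.map_congr rfl
  intro r _
  simp [yFactor, hσ, hσp]

end Generic

/-! ### Images of collinear points -/

section Line

variable {k : Type*} [Field k]

lemma StandardMap.isIntegral_of_mem_roots {a b a' b' c : k} {N D : k[X]}
    (h : StandardMap a b a' b' c N D) {M : Type*} [Field M] [Algebra k[X] M] [Algebra k M]
    [IsScalarTower k k[X] M] {r : M}
    (hr : (fibrePoly N D (algebraMap k[X] M X)).eval r = 0) : IsIntegral k[X] r := by
  have hν : N.leadingCoeff ≠ 0 := leadingCoeff_ne_zero.2 h.N_ne_zero
  let P : k[X][X] := N.map C - C X * D.map C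
  have hdeg : (C X * D.map C : k[X][X]).natDegree < (N.map C : k[X][X]).natDegree := by
    refine (natDegree_C_mul_le _ _).trans_lt ?_
    rw [natDegree_map_eq_of_injective C_injective, natDegree_map_eq_of_injective C_injective]
    exact h.degree_lt
  have hlead : P.leadingCoeff = C N.leadingCoeff := by
    rw [leadingCoeff_sub_of_degree_lt (degree_lt_degree hdeg),
      leadingCoeff_map_of_injective C_injective]
  refine ⟨C (C N.leadingCoeff⁻¹) * P, monic_C_mul_of_mul_leadingCoeff_eq_one ?_, ?_⟩
  · rw [hlead, ← C_mul, inv_mul_cancel₀ hν, C_1]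
  · have e1 : (algebraMap k[X] M).comp C = algebraMap k M := by
      rw [IsScalarTower.algebraMap_eq k k[X] M]; rfl
    rw [fibrePoly_eval] at hr
    simp only [P, eval₂_mul, eval₂_sub, eval₂_C, eval₂_map, e1]
    simp only [aeval_def] at hr
    rw [hr, mul_zero]

/-- A point of the fibre, with ordinate obtained from `Y` by `yFactor`, lies on the source curve. -/
lemma StandardMap.sq_eq_of_mem_roots {a b a' b' c : k} {N D : k[X]}
    (h : StandardMap a b a' b' c N D) {M : Type*} [Field M] [Algebra k M] {τ Y r : M}
    (hY : Y ^ 2 = aeval τ (cubic a' b')) (hr : (fibrePoly N D τ).eval r = 0)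
    (hW : aeval r (quotDeriv N D) ≠ 0) :
    (Y * yFactor c N D r) ^ 2 = aeval r (cubic a b) := by
  have hc : algebraMap k M c ≠ 0 := by simpa using h.c_ne_zero
  have hN : aeval r N = τ * aeval r D := by
    rw [fibrePoly_eval] at hr
    exact sub_eq_zero.1 hr
  have hode := congrArg (aeval r) h.ode
  simp only [map_mul, map_add, map_pow, aeval_C, hN] at hode
  unfold yFactor
  rw [mul_pow, div_pow, hY, mul_div_assoc', div_eq_iff (by positivity)]
  simp only [cubic, map_mul, map_add, map_pow, aeval_C, aeval_X] at hode ⊢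
  linear_combination -hode

/-- The norm of a line function, computed in a separable closure `M` of the function field
`E = k(X)` of the line. -/
theorem StandardMap.exists_norm_of_line_aux [IsAlgClosed k] (h2 : (2 : k) ≠ 0) {a b a' b' c : k}
    {N D : k[X]} (h : StandardMap a b a' b' c N D) (hg : Squarefree (cubic a' b')) (l m : k)
    (x : Fin 3 → k) (hx : cubic a b - (C l * X + C m) ^ 2 = ∏ i, (X - C (x i)))
    (hD : ∀ i, D.eval (x i) ≠ 0)
    (E M : Type*) [Field E] [Algebra k[X] E] [IsFractionRing k[X] E] [Field M] [Algebra E M]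
    [Algebra k[X] M] [IsScalarTower k[X] E M] [Algebra k M] [IsScalarTower k k[X] M]
    [Algebra k E] [IsScalarTower k E M] [IsSepClosed M] [IsGalois E M] :
    ∃ A B : k[X], ∃ κ : k, κ ≠ 0 ∧
      A ^ 2 - cubic a' b' * B ^ 2 = C κ * ∏ i, (X - C (N.eval (x i) / D.eval (x i))) ∧
      ∀ i, A.eval (N.eval (x i) / D.eval (x i)) + B.eval (N.eval (x i) / D.eval (x i)) *
        (c * (l * x i + m) * ((quotDeriv N D).eval (x i) / D.eval (x i) ^ 2)) = 0 := by
  have hν : N.leadingCoeff ≠ 0 := leadingCoeff_ne_zero.2 h.N_ne_zero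
  have hinj : Function.Injective (algebraMap k[X] M) := by
    rw [IsScalarTower.algebraMap_eq k[X] E M]
    exact (algebraMap E M).injective.comp (IsFractionRing.injective k[X] E)
  have : FaithfulSMul k[X] M := (faithfulSMul_iff_algebraMap_injective _ _).2 hinj
  set τ : M := algebraMap k[X] M X with hτ
  have hτE : τ = algebraMap E M (algebraMap k[X] E X) := IsScalarTower.algebraMap_apply _ _ _ _
  have hat : ∀ q : k[X], aeval τ q = algebraMap k[X] M q := fun q => by
    rw [hτ, aeval_algebraMap_apply, aeval_X_left_apply]
  have hconst : ∀ z : k, algebraMap k[X] M (C z) = algebraMap k M z := fun z => by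
    rw [IsScalarTower.algebraMap_apply k k[X] M]; rfl
  have htr : Transcendental k τ := by
    rw [transcendental_iff]
    intro q hq
    rw [hat] at hq
    exact hinj (by rw [hq, map_zero])
  have htr' : Transcendental k (algebraMap M (AlgebraicClosure M) τ) :=
    (transcendental_algebraMap_iff (algebraMap M (AlgebraicClosure M)).injective).2 htr
  have hsep : (fibrePoly N D τ).Separable :=
    fibrePoly_separable fun r hr => h.aeval_quotDeriv_ne_zero htr' hr
  have hsplit : (fibrePoly N D τ).Splits := IsSepClosed.splits_of_separable _ hsep
  have hP0 : fibrePoly N D τ ≠ 0 := hsep.ne_zero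
  have hroot : ∀ r ∈ (fibrePoly N D τ).roots, (fibrePoly N D τ).eval r = 0 :=
    fun r hr => (mem_roots hP0).1 hr
  have hrootW : ∀ r ∈ (fibrePoly N D τ).roots, aeval r (quotDeriv N D) ≠ 0 := fun r hr => by
    apply h.aeval_quotDeriv_ne_zero htr
    have := hroot r hr
    rwa [fibrePoly_eval, sub_eq_zero] at this
  have : NeZero (2 : M) := ⟨by
    rw [← map_ofNat (algebraMap k M) 2]
    simpa using h2⟩
  have h2M : (2 : M) ≠ 0 := NeZero.ne _
  obtain ⟨Y, hYY⟩ := IsSepClosed.exists_eq_mul_self (aeval τ (cubic a' b'))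
  have hY : Y ^ 2 = aeval τ (cubic a' b') := by rw [hYY, sq]
  have hY0 : Y ≠ 0 := by
    rintro rfl
    rw [zero_pow two_ne_zero, hat, eq_comm, map_eq_zero_iff _ hinj] at hY
    exact cubic_ne_zero a' b' hY
  set V : M → M := lineNorm c N D τ l m with hV
  -- the norm and its factors are integral over `k[X]`
  have hint_const : ∀ z : k, IsIntegral k[X] (algebraMap k M z) := fun z => by
    rw [← hconst]; exact isIntegral_algebraMap
  have hint_root : ∀ r ∈ (fibrePoly N D τ).roots, IsIntegral k[X] r := fun r hr =>
    h.isIntegral_of_mem_roots (hroot r hr)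
  have hint_y : ∀ Z : M, Z ^ 2 = aeval τ (cubic a' b') → ∀ r ∈ (fibrePoly N D τ).roots,
      IsIntegral k[X] (Z * yFactor c N D r) := fun Z hZ r hr => by
    apply IsIntegral.of_pow two_pos
    rw [h.sq_eq_of_mem_roots hZ (hroot r hr) (hrootW r hr)]
    simp only [cubic, map_add, map_mul, map_pow, aeval_X, aeval_C]
    exact (((hint_root r hr).pow 3).add ((hint_const a).mul (hint_root r hr))).add (hint_const b)
  have hint_factor : ∀ Z : M, Z ^ 2 = aeval τ (cubic a' b') → ∀ r ∈ (fibrePoly N D τ).roots,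
      IsIntegral k[X] (Z * yFactor c N D r - (algebraMap k M l * r + algebraMap k M m)) :=
    fun Z hZ r hr => (hint_y Z hZ r hr).sub
      (((hint_const l).mul (hint_root r hr)).add (hint_const m))
  have hint_V : ∀ Z : M, Z ^ 2 = aeval τ (cubic a' b') → IsIntegral k[X] (V Z) := fun Z hZ => by
    apply IsIntegral.multiset_prod
    intro z hz
    obtain ⟨r, hr, rfl⟩ := Multiset.mem_map.1 hz
    exact hint_factor Z hZ r hr
  have hY' : (-Y) ^ 2 = aeval τ (cubic a' b') := by rw [neg_sq, hY]
  have hintY : IsIntegral k[X] Y := by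
    apply IsIntegral.of_pow two_pos
    rw [hY, hat]; exact isIntegral_algebraMap
  -- `V Y` and `V (-Y)` are permuted by the Galois group, so their sum, and the quotient of their
  -- difference by `Y`, descend to polynomials
  have hσ : ∀ σ : M ≃ₐ[E] M, (σ Y = Y ∨ σ Y = -Y) ∧ ∀ Z, σ (V Z) = V (σ Z) := fun σ => by
    constructor
    · rw [← sq_eq_sq_iff_eq_or_eq_neg, ← map_pow, hY, hat, IsScalarTower.algebraMap_apply k[X] E M,
        σ.commutes]
    · intro Z
      rw [hV, hτE] at *
      exact map_lineNorm c N D _ l m Z hsplit σ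
  obtain ⟨q₁, hq₁⟩ : ∃ q : k[X], algebraMap k[X] M q = V Y + V (-Y) := by
    refine exists_algebraMap_eq_of_forall_fixed (E := E) ((hint_V Y hY).add (hint_V _ hY'))
      fun σ => ?_
    obtain ⟨h1 | h1, h3⟩ := hσ σ <;> simp [h3, h1, add_comm]
  obtain ⟨q₂, hq₂⟩ : ∃ q : k[X], algebraMap k[X] M q = (V Y - V (-Y)) * Y := by
    refine exists_algebraMap_eq_of_forall_fixed (E := E)
      (((hint_V Y hY).sub (hint_V _ hY')).mul hintY) fun σ => ?_
    obtain ⟨h1 | h1, h3⟩ := hσ σ <;> simp [h3, h1]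
    ring
  obtain ⟨q₃, hq₃⟩ : ∃ q : k[X], algebraMap k[X] M q = (V Y - V (-Y)) ^ 2 := by
    refine exists_algebraMap_eq_of_forall_fixed (E := E)
      (((hint_V Y hY).sub (hint_V _ hY')).pow 2) fun σ => ?_
    obtain ⟨h1 | h1, h3⟩ := hσ σ <;> simp [h3, h1]
    ring
  -- the square of `q₂` is divisible by the squarefree cubic, since `Y²` is the cubic
  have hgq : cubic a' b' ∣ q₂ := by
    rw [← hg.dvd_pow_iff_dvd two_ne_zero]
    refine ⟨q₃, hinj ?_⟩
    rw [map_pow, map_mul, hq₂, hq₃, ← hat, ← hY]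
    ring
  obtain ⟨q₄, rfl⟩ := hgq
  have hq₄ : algebraMap k[X] M q₄ * Y = V Y - V (-Y) := by
    rw [map_mul, ← hat, ← hY] at hq₂
    apply mul_right_cancel₀ hY0
    linear_combination hq₂
  set A : k[X] := C (1 / 2) * q₁ with hA
  set B : k[X] := C (1 / 2) * q₄ with hB
  have hhalf : algebraMap k M (1 / 2) * 2 = 1 := by
    rw [← map_ofNat (algebraMap k M) 2, ← map_mul, one_div_mul_cancel h2, map_one]
  have hVp : V Y = algebraMap k[X] M A + algebraMap k[X] M B * Y := by
    rw [hA, hB, map_mul, map_mul, hconst]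
    linear_combination (-algebraMap k M (1 / 2)) * hq₄ - algebraMap k M (1 / 2) * hq₁ -
      V Y * hhalf
  have hVm : V (-Y) = algebraMap k[X] M A - algebraMap k[X] M B * Y := by
    rw [hA, hB, map_mul, map_mul, hconst]
    linear_combination (algebraMap k M (1 / 2)) * hq₄ - algebraMap k M (1 / 2) * hq₁ -
      V (-Y) * hhalf
  -- the product of the two conjugates
  have hevalx : ∀ z : k, algebraMap k M N.leadingCoeff *
      ((fibrePoly N D τ).roots.map fun r => algebraMap k M z - r).prod =
        algebraMap k[X] M (C (N.eval z) - X * C (D.eval z)) := fun z => by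
    have := hsplit.eval_eq_prod_roots (algebraMap k M z)
    rw [h.fibrePoly_leadingCoeff] at this
    rw [← this, fibrePoly_eval, map_sub, map_mul, hconst, hconst, aeval_algebraMap_apply,
      aeval_algebraMap_apply, ← hτ]
    rfl
  have hVV : V Y * V (-Y) =
      ∏ i, ((fibrePoly N D τ).roots.map fun r => algebraMap k M (x i) - r).prod := by
    rw [hV]
    simp only [lineNorm]
    rw [← Multiset.prod_map_mul, Fin.prod_univ_three, ← Multiset.prod_map_mul,
      ← Multiset.prod_map_mul]
    congr 1
    apply Multiset.map_congr rfl
    intro r hr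
    have e1 := h.sq_eq_of_mem_roots hY (hroot r hr) (hrootW r hr)
    have e2 := congrArg (aeval r) hx
    rw [Fin.prod_univ_three] at e2
    simp only [map_mul, map_add, map_sub, map_pow, aeval_C, aeval_X] at e2
    linear_combination -e1 - e2
  refine ⟨A, B, (N.leadingCoeff ^ 3)⁻¹ * ∏ i, (-D.eval (x i)), ?_, ?_, ?_⟩
  · refine mul_ne_zero (inv_ne_zero (pow_ne_zero _ hν)) ?_
    exact Finset.prod_ne_zero_iff.2 fun i _ => neg_ne_zero.2 (hD i)
  · have e1 : C (N.leadingCoeff ^ 3) * (A ^ 2 - cubic a' b' * B ^ 2) =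
        ∏ i, (C (N.eval (x i)) - X * C (D.eval (x i))) := by
      apply hinj
      rw [map_prod, ← Finset.prod_congr rfl fun i _ => hevalx (x i), Finset.prod_mul_distrib,
        ← hVV, hVp, hVm, map_mul, hconst, map_sub, map_mul, map_pow, map_pow, ← hat (cubic a' b'),
        ← hY, Finset.prod_const, Finset.card_univ, Fintype.card_fin, map_pow]
      ring
    have e2 : C (N.leadingCoeff ^ 3)⁻¹ * C (N.leadingCoeff ^ 3) = 1 := by
      rw [← C_mul, inv_mul_cancel₀ (pow_ne_zero _ hν), C_1]
    have e3 : ∏ i, (C (N.eval (x i)) - X * C (D.eval (x i))) =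
        C (∏ i, (-D.eval (x i))) * ∏ i, (X - C (N.eval (x i) / D.eval (x i))) := by
      rw [map_prod, ← Finset.prod_mul_distrib]
      refine Finset.prod_congr rfl fun i _ => ?_
      have : C (N.eval (x i)) = C (D.eval (x i)) * C (N.eval (x i) / D.eval (x i)) := by
        rw [← C_mul, mul_div_cancel₀ _ (hD i)]
      rw [this, C_neg]
      ring
    calc A ^ 2 - cubic a' b' * B ^ 2
        = C (N.leadingCoeff ^ 3)⁻¹ * (C (N.leadingCoeff ^ 3) * (A ^ 2 - cubic a' b' * B ^ 2)) := by
          rw [← mul_assoc, e2, one_mul]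
      _ = _ := by rw [e1, e3, C_mul, mul_assoc]
  · intro i
    set x₀ := x i
    set X₀ := N.eval x₀ / D.eval x₀ with hX₀
    have hDx := hD i
    -- the vanishing at `X₀` is tested by specializing the integral closure of `k[X]` at `X = X₀`
    obtain ⟨θ, hθ⟩ := exists_algHom_of_isIntegral (S := integralClosure k[X] M) X₀
    have hθp : ∀ (q : k[X]) (s : integralClosure k[X] M), θ (aeval s q) = q.eval (θ s) :=
      fun q s => by rw [← aeval_algHom_apply]; rfl
    have hcoe : ∀ (q : k[X]) (s : integralClosure k[X] M),
        ((aeval s q : integralClosure k[X] M) : M) = aeval (s : M) q := fun q s =>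
      (aeval_algHom_apply (((integralClosure k[X] M).val).restrictScalars k) s q).symm
    -- a root of the fibre polynomial lying over `x₀`
    obtain ⟨R, hR⟩ : ∃ R : Multiset (integralClosure k[X] M),
        Multiset.map (fun s : integralClosure k[X] M => (s : M)) R = (fibrePoly N D τ).roots :=
      have hmem : ∀ r ∈ (fibrePoly N D τ).roots, r ∈ integralClosure k[X] M := hint_root
      ⟨(fibrePoly N D τ).roots.pmap (fun r hr => ⟨r, hr⟩) hmem, by
        rw [Multiset.map_pmap, Multiset.pmap_eq_map, Multiset.map_id']⟩
    obtain ⟨s, hsR, hsx⟩ : ∃ s ∈ R, θ s = x₀ := by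
      have e1 : algebraMap k (integralClosure k[X] M) N.leadingCoeff *
          (R.map fun r => algebraMap k _ x₀ - r).prod =
            algebraMap k[X] _ (C (N.eval x₀) - X * C (D.eval x₀)) := by
        apply Subtype.val_injective
        have := hevalx x₀
        rw [← hR, Multiset.map_map] at this
        simp only [MulMemClass.coe_mul]
        rw [← (integralClosure k[X] M).coe_val, map_multiset_prod, Multiset.map_map]
        exact this
      have e2 := congrArg θ e1
      rw [hθ, map_mul, map_multiset_prod, Multiset.map_map, AlgHom.commutes] at e2
      have e3 : (C (N.eval x₀) - X * C (D.eval x₀)).eval X₀ = 0 := by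
        simp only [hX₀, eval_sub, eval_mul, eval_C, eval_X]
        rw [div_mul_cancel₀ _ hDx, sub_self]
      rw [e3, mul_eq_zero] at e2
      rcases e2 with e2 | e2
      · exact absurd e2 hν
      · obtain ⟨s, hs, hs0⟩ := Multiset.mem_map.1 (Multiset.prod_eq_zero_iff.1 e2)
        refine ⟨s, hs, ?_⟩
        simp only [Function.comp_apply, map_sub, AlgHom.commutes, sub_eq_zero] at hs0
        exact hs0.symm
    have hs_root : (s : M) ∈ (fibrePoly N D τ).roots := by
      rw [← hR]; exact Multiset.mem_map_of_mem _ hsR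
    let Y' : integralClosure k[X] M := ⟨Y, hintY⟩
    let y' : integralClosure k[X] M := ⟨Y * yFactor c N D (s : M), hint_y Y hY _ hs_root⟩
    have hy'sq : θ y' ^ 2 = (l * x₀ + m) ^ 2 := by
      have e1 : y' ^ 2 = aeval s (cubic a b) := by
        apply Subtype.val_injective
        rw [hcoe]
        exact h.sq_eq_of_mem_roots hY (hroot _ hs_root) (hrootW _ hs_root)
      rw [← map_pow, e1, hθp, hsx]
      have e2 := congrArg (eval x₀) hx
      rw [eval_prod, Finset.prod_eq_zero (Finset.mem_univ i) (by simp [x₀])] at e2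
      simp only [eval_sub, eval_pow, eval_add, eval_mul, eval_C, eval_X] at e2
      linear_combination e2
    have hrel : θ Y' * D.eval x₀ ^ 2 = c * (quotDeriv N D).eval x₀ * θ y' := by
      have e1 : Y' * aeval s D ^ 2 = algebraMap k _ c * aeval s (quotDeriv N D) * y' := by
        apply Subtype.val_injective
        simp only [MulMemClass.coe_mul, SubmonoidClass.coe_pow, hcoe]
        have hc : algebraMap k M c ≠ 0 := by simpa using h.c_ne_zero
        have hW := hrootW _ hs_root
        change Y * aeval (s : M) D ^ 2 = algebraMap k M c * aeval (s : M) (quotDeriv N D) *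
          (Y * yFactor c N D (s : M))
        unfold yFactor
        field_simp
      have e2 := congrArg θ e1
      simpa only [map_mul, map_pow, hθp, hsx, AlgHom.commutes, Algebra.algebraMap_self,
        RingHom.id_apply] using e2
    -- the factor belonging to `s` divides the norm
    have hfac : ∀ Z : M, Z ^ 2 = aeval τ (cubic a' b') → ∃ w : M, IsIntegral k[X] w ∧
        V Z = (Z * yFactor c N D (s : M) - (algebraMap k M l * s + algebraMap k M m)) * w := by
      intro Z hZ
      obtain ⟨R', hR'⟩ := Multiset.exists_cons_of_mem hs_root
      refine ⟨(R'.map fun r => Z * yFactor c N D r -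
        (algebraMap k M l * r + algebraMap k M m)).prod, ?_, ?_⟩
      · apply IsIntegral.multiset_prod
        intro z hz
        obtain ⟨r, hr, rfl⟩ := Multiset.mem_map.1 hz
        exact hint_factor Z hZ r (by rw [hR']; exact Multiset.mem_cons_of_mem hr)
      · rw [hV]
        simp only [lineNorm]
        rw [hR', Multiset.map_cons, Multiset.prod_cons]
    obtain ⟨wp, hwp, hVwp⟩ := hfac Y hY
    obtain ⟨wm, hwm, hVwm⟩ := hfac (-Y) hY'
    have hp : A.eval X₀ + B.eval X₀ * θ Y' = (θ y' - (l * x₀ + m)) * θ ⟨wp, hwp⟩ := by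
      have e1 : algebraMap k[X] _ A + algebraMap k[X] _ B * Y' =
          (y' - (algebraMap k _ l * s + algebraMap k _ m)) * ⟨wp, hwp⟩ := by
        apply Subtype.val_injective
        exact hVp.symm.trans hVwp
      have e2 := congrArg θ e1
      simpa only [map_mul, map_add, map_sub, hθ, hsx, AlgHom.commutes, Algebra.algebraMap_self,
        RingHom.id_apply] using e2
    have hm : A.eval X₀ - B.eval X₀ * θ Y' = (-θ y' - (l * x₀ + m)) * θ ⟨wm, hwm⟩ := by
      have e1 : algebraMap k[X] _ A - algebraMap k[X] _ B * Y' =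
          (-y' - (algebraMap k _ l * s + algebraMap k _ m)) * ⟨wm, hwm⟩ := by
        apply Subtype.val_injective
        refine hVm.symm.trans (hVwm.trans ?_)
        rw [neg_mul]
        rfl
      have e2 := congrArg θ e1
      simpa only [map_mul, map_add, map_sub, map_neg, hθ, hsx, AlgHom.commutes,
        Algebra.algebraMap_self, RingHom.id_apply] using e2
    rcases sq_eq_sq_iff_eq_or_eq_neg.1 hy'sq with hy | hy
    · have : c * (l * x₀ + m) * ((quotDeriv N D).eval x₀ / D.eval x₀ ^ 2) = θ Y' := by
        rw [mul_div_assoc', div_eq_iff (pow_ne_zero _ hDx), hrel, hy]; ring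
      rw [this, hp, hy, sub_self, zero_mul]
    · have : c * (l * x₀ + m) * ((quotDeriv N D).eval x₀ / D.eval x₀ ^ 2) = -θ Y' := by
        rw [mul_div_assoc', div_eq_iff (pow_ne_zero _ hDx), neg_mul, hrel, hy]; ring
      rw [this, mul_neg, ← sub_eq_add_neg, hm, hy]; ring

/-- The image of the line section `y = l x + m` under `(x, y) ↦ (f(x), c y f'(x))`: the norm
`A + B Y` of the line function cuts out on the target curve the images of the three points. -/
theorem StandardMap.exists_norm_of_line [IsAlgClosed k] (h2 : (2 : k) ≠ 0) {a b a' b' c : k}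
    {N D : k[X]} (h : StandardMap a b a' b' c N D) (hg : Squarefree (cubic a' b')) (l m : k)
    (x : Fin 3 → k) (hx : cubic a b - (C l * X + C m) ^ 2 = ∏ i, (X - C (x i)))
    (hD : ∀ i, D.eval (x i) ≠ 0) :
    ∃ A B : k[X], ∃ κ : k, κ ≠ 0 ∧
      A ^ 2 - cubic a' b' * B ^ 2 = C κ * ∏ i, (X - C (N.eval (x i) / D.eval (x i))) ∧
      ∀ i, A.eval (N.eval (x i) / D.eval (x i)) + B.eval (N.eval (x i) / D.eval (x i)) *
        (c * (l * x i + m) * ((quotDeriv N D).eval (x i) / D.eval (x i) ^ 2)) = 0 := by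
  let E := FractionRing k[X]
  let M := SeparableClosure E
  let _ : Algebra k[X] M := ((algebraMap E M).comp (algebraMap k[X] E)).toAlgebra
  have : IsScalarTower k[X] E M := IsScalarTower.of_algebraMap_eq fun _ => rfl
  let _ : Algebra k M := ((algebraMap E M).comp (algebraMap k E)).toAlgebra
  have : IsScalarTower k E M := IsScalarTower.of_algebraMap_eq fun _ => rfl
  have : IsScalarTower k k[X] M := IsScalarTower.of_algebraMap_eq fun z => by
    change algebraMap E M (algebraMap k E z) =
      algebraMap E M (algebraMap k[X] E (algebraMap k k[X] z))
    rw [IsScalarTower.algebraMap_apply k k[X] E]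
  exact h.exists_norm_of_line_aux h2 hg l m x hx hD E M

/-- The images of three collinear points are collinear. -/
theorem StandardMap.exists_line [IsAlgClosed k] (h2 : (2 : k) ≠ 0) {a b a' b' c : k}
    {N D : k[X]} (h : StandardMap a b a' b' c N D) (hg : Squarefree (cubic a' b')) (l m : k)
    (x : Fin 3 → k) (hx : cubic a b - (C l * X + C m) ^ 2 = ∏ i, (X - C (x i)))
    (hD : ∀ i, D.eval (x i) ≠ 0) :
    ∃ l' m' : k,
      cubic a' b' - (C l' * X + C m') ^ 2 = ∏ i, (X - C (N.eval (x i) / D.eval (x i))) ∧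
      ∀ i, c * (l * x i + m) * ((quotDeriv N D).eval (x i) / D.eval (x i) ^ 2) =
        l' * (N.eval (x i) / D.eval (x i)) + m' := by
  obtain ⟨A, B, κ, hκ, hAB, h0⟩ := h.exists_norm_of_line h2 hg l m x hx hD
  set Q : k[X] := ∏ i, (X - C (N.eval (x i) / D.eval (x i))) with hQ
  have hQm : Q.Monic := monic_prod_of_monic _ _ fun i _ => monic_X_sub_C _
  have hQd : Q.natDegree = 3 := by
    rw [hQ, natDegree_prod_of_monic _ _ fun i _ => monic_X_sub_C _]; simp
  have hdeg : (A ^ 2 - cubic a' b' * B ^ 2).natDegree = 3 := by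
    rw [hAB, natDegree_C_mul hκ, hQd]
  have hA2 : (A ^ 2).natDegree = 2 * A.natDegree := natDegree_pow _ _
  have hB0 : B ≠ 0 := by
    rintro rfl
    rw [zero_pow two_ne_zero, mul_zero, sub_zero, hA2] at hdeg
    omega
  have hB2 : (cubic a' b' * B ^ 2).natDegree = 3 + 2 * B.natDegree := by
    rw [natDegree_mul (cubic_ne_zero _ _) (pow_ne_zero _ hB0), cubic_natDegree, natDegree_pow]
  -- the degrees `2 deg A` and `3 + 2 deg B` have different parity, so nothing cancels
  have hlt : (A ^ 2).natDegree < (cubic a' b' * B ^ 2).natDegree := by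
    by_contra! hle
    have hlt : (cubic a' b' * B ^ 2).natDegree < (A ^ 2).natDegree := by omega
    rw [natDegree_sub_eq_left_of_natDegree_lt hlt] at hdeg
    omega
  rw [natDegree_sub_eq_right_of_natDegree_lt hlt] at hdeg
  obtain ⟨β, rfl⟩ : ∃ β, B = C β := ⟨_, eq_C_of_natDegree_eq_zero (by omega)⟩
  obtain ⟨α, hα⟩ : ∃ α, ∃ δ, A = C α * X + C δ :=
    ⟨_, _, eq_X_add_C_of_natDegree_le_one (by omega)⟩
  obtain ⟨δ, rfl⟩ := hα
  have hβ : β ≠ 0 := by simpa using hB0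
  have hκβ : κ = -β ^ 2 := by
    have h3 := congrArg (fun q => q.coeff 3) hAB
    simp only [coeff_C_mul] at h3
    rw [show Q.coeff 3 = 1 by rw [← hQd]; exact hQm.coeff_natDegree, mul_one] at h3
    rw [← h3, coeff_sub, coeff_eq_zero_of_natDegree_lt (by omega : _ < 3), ← C_pow,
      coeff_mul_C, show (cubic a' b').coeff 3 = 1 by
        rw [← cubic_natDegree a' b']; exact (cubic_monic a' b').coeff_natDegree]
    ring
  refine ⟨-α / β, -δ / β, ?_, fun i => ?_⟩
  · have hC : (C β : k[X]) ≠ 0 := by simpa using hβ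
    apply mul_left_cancel₀ (pow_ne_zero 2 hC)
    have e1 : (C β : k[X]) * C (-α / β) = - C α := by
      rw [← C_mul, mul_div_cancel₀ _ hβ, C_neg]
    have e2 : (C β : k[X]) * C (-δ / β) = - C δ := by
      rw [← C_mul, mul_div_cancel₀ _ hβ, C_neg]
    rw [hκβ, C_neg, C_pow] at hAB
    calc (C β : k[X]) ^ 2 * (cubic a' b' - (C (-α / β) * X + C (-δ / β)) ^ 2)
        = cubic a' b' * C β ^ 2 - (C β * C (-α / β) * X + C β * C (-δ / β)) ^ 2 := by ring
      _ = C β ^ 2 * Q := by rw [e1, e2]; linear_combination -hAB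
  · have h1 := h0 i
    simp only [eval_add, eval_mul, eval_C, eval_X] at h1
    field_simp
    linear_combination h1

end Line

/-! ### Additivity in general position -/

section Points

open Filter

/-- A map of abelian groups that is additive up to finite exceptional sets agrees with a
homomorphism outside the exceptional set. -/
lemma exists_addMonoidHom_of_eventually_additive {G H : Type*} [AddCommGroup G] [Infinite G]
    [AddCommGroup H] (f : G → H) {S : Set G} (hS : S.Finite)
    (hf : ∀ P ∉ S, ∀ᶠ Q in cofinite, f (P + Q) = f P + f Q) :
    ∃ φ : G →+ H, ∀ P ∉ S, φ P = f P := by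
  have htrans : ∀ (P : G) {p : G → Prop}, (∀ᶠ Q in cofinite, p Q) → ∀ᶠ Q in cofinite, p (P + Q) :=
    fun P p hp => (add_right_injective P).tendsto_cofinite.eventually hp
  have hnotS : ∀ᶠ Q in cofinite, Q ∉ S := hS.compl_mem_cofinite
  -- the difference `f (P + Q) - f Q` does not depend on the generic point `Q`
  have hex : ∀ P, ∃ v, ∀ᶠ Q in cofinite, f (P + Q) = v + f Q := fun P => by
    obtain ⟨R, hR, hPR⟩ := (hnotS.and (htrans P hnotS)).exists
    refine ⟨f (P + R) - f R, ?_⟩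
    filter_upwards [hf _ hPR, htrans P (hf _ hR)] with Q h1 h2
    rw [show P + R + Q = R + (P + Q) by abel, h2] at h1
    rw [sub_add_eq_add_sub, ← h1, add_sub_cancel_left]
  choose g hg using hex
  have huniq : ∀ P v, (∀ᶠ Q in cofinite, f (P + Q) = v + f Q) → g P = v := fun P v hv => by
    obtain ⟨Q, h1, h2⟩ := ((hg P).and hv).exists
    exact add_right_cancel (h1.symm.trans h2)
  refine ⟨AddMonoidHom.mk' g fun P Q => huniq _ _ ?_, fun P hP => huniq _ _ (hf P hP)⟩
  filter_upwards [htrans Q (hg P), hg Q] with R h1 h2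
  rw [add_assoc, h1, h2, add_assoc]

variable {k : Type*} [Field k]

lemma cubic_squarefree {a b : k} (h : 4 * a ^ 3 + 27 * b ^ 2 ≠ 0) : Squarefree (cubic a b) := by
  apply Separable.squarefree
  have hd : derivative (cubic a b) = 3 * X ^ 2 + C a := by
    simp only [cubic, derivative_add, derivative_X_pow, derivative_C_mul, derivative_X,
      derivative_C]
    norm_num
    exact map_ofNat C 3
  rw [separable_def, hd]
  refine ⟨C (4 * a ^ 3 + 27 * b ^ 2)⁻¹ * (-(18 * C a * X - 27 * C b)),
    C (4 * a ^ 3 + 27 * b ^ 2)⁻¹ * (6 * C a * X ^ 2 - 9 * C b * X + 4 * C a ^ 2), ?_⟩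
  calc _ = C (4 * a ^ 3 + 27 * b ^ 2)⁻¹ * C (4 * a ^ 3 + 27 * b ^ 2) := by
        simp only [cubic, map_add, map_mul, map_pow, map_ofNat]
        ring
    _ = 1 := by rw [← C_mul, inv_mul_cancel₀ h, C_1]

variable {W W' : WeierstrassCurve.Affine k} [W.IsShortNF] [W'.IsShortNF]

lemma equation_iff_of_isShortNF {W : WeierstrassCurve.Affine k} [W.IsShortNF] {x y : k} :
    W.Equation x y ↔ y ^ 2 = (cubic W.a₄ W.a₆).eval x := by
  rw [Affine.equation_iff]
  simp [cubic]

lemma Δ_of_isShortNF' {W : WeierstrassCurve.Affine k} [W.IsShortNF] :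
    W.Δ = -16 * (4 * W.a₄ ^ 3 + 27 * W.a₆ ^ 2) := by
  rw [WeierstrassCurve.Δ, WeierstrassCurve.b₂, WeierstrassCurve.b₄, WeierstrassCurve.b₆,
    WeierstrassCurve.b₈]
  simp only [a₁_of_isShortNF, a₂_of_isShortNF, a₃_of_isShortNF]
  ring

lemma squarefree_of_isElliptic {W : WeierstrassCurve.Affine k} [W.IsShortNF] [W.IsElliptic] :
    Squarefree (cubic W.a₄ W.a₆) := by
  apply cubic_squarefree
  intro h
  have := W.isUnit_Δ
  rw [Δ_of_isShortNF', h, mul_zero] at this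
  exact not_isUnit_zero this

lemma infinite_point [IsAlgClosed k] [W.IsElliptic] : Infinite W.Point := by
  have hex : ∀ x : k, ∃ y, W.Nonsingular x y := fun x => by
    obtain ⟨y, hy⟩ := IsAlgClosed.exists_pow_nat_eq ((cubic W.a₄ W.a₆).eval x) two_pos
    exact ⟨y, Affine.equation_iff_nonsingular.1 (equation_iff_of_isShortNF.2 hy)⟩
  choose y hy using hex
  have : Infinite k := IsAlgClosed.instInfinite
  refine Infinite.of_injective (fun x => Affine.Point.some x (y x) (hy x)) fun x x' h => ?_
  simp only [Affine.Point.some.injEq] at h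
  exact h.1

/-- The affine points at which a polynomial in `x` vanishes. -/
def zeroSet (W : WeierstrassCurve.Affine k) (q : k[X]) : Set W.Point :=
  {P | ∃ x y h, P = Affine.Point.some x y h ∧ q.eval x = 0}

/-- The affine points at which `q` vanishes are contained in a finite set with at most two elements
for each root of `q`. -/
lemma zeroSet_subset (q : k[X]) (hq : q ≠ 0) : ∃ T : Finset (k × k), T.card ≤ 2 * q.natDegree ∧
    ∀ x y, W.Nonsingular x y → q.eval x = 0 → (x, y) ∈ T := by
  classical
  refine ⟨q.roots.toFinset.biUnion fun x =>
    ((X ^ 2 - C ((cubic W.a₄ W.a₆).eval x)).roots.toFinset.image fun y => (x, y)), ?_, ?_⟩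
  · refine (Finset.card_biUnion_le_card_mul _ _ 2 fun x _ => ?_).trans ?_
    · refine Finset.card_image_le.trans ((Multiset.toFinset_card_le _).trans ?_)
      refine (card_roots' _).trans ?_
      compute_degree
    · rw [mul_comm]
      gcongr
      exact (Multiset.toFinset_card_le _).trans (card_roots' _)
  · intro x y h hx
    have hne : (X ^ 2 - C ((cubic W.a₄ W.a₆).eval x) : k[X]) ≠ 0 := X_pow_sub_C_ne_zero two_pos _
    simp only [Finset.mem_biUnion, Finset.mem_image, Multiset.mem_toFinset, mem_roots hq,
      IsRoot.def, Prod.mk.injEq]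
    refine ⟨x, hx, y, (mem_roots hne).2 ?_, rfl, rfl⟩
    simp [equation_iff_of_isShortNF.1 h.1]

omit [W.IsShortNF] in
lemma zeroSet_ncard_le (q : k[X]) {T : Finset (k × k)}
    (hT : ∀ x y, W.Nonsingular x y → q.eval x = 0 → (x, y) ∈ T) :
    (zeroSet W q).Finite ∧ (zeroSet W q).ncard ≤ T.card := by
  let e : W.Point → k × k := fun P => match P with
    | .zero => (0, 0)
    | .some x y _ => (x, y)
  have hmaps : ∀ P ∈ zeroSet W q, e P ∈ (T : Set (k × k)) := by
    rintro P ⟨x, y, h, rfl, hx⟩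
    exact hT x y h hx
  have hinj : Set.InjOn e (zeroSet W q) := by
    rintro P ⟨x, y, h, rfl, hx⟩ P' ⟨x', y', h', rfl, hx'⟩ heq
    simp only [e, Prod.mk.injEq] at heq
    obtain ⟨rfl, rfl⟩ := heq
    rfl
  refine ⟨Set.Finite.of_finite_image (T.finite_toSet.subset (Set.image_subset_iff.2 hmaps)) hinj,
    ?_⟩
  rw [← hinj.ncard_image, ← Set.ncard_coe_finset]
  exact Set.ncard_le_ncard (Set.image_subset_iff.2 hmaps) T.finite_toSet

lemma zeroSet_finite {q : k[X]} (hq : q ≠ 0) : (zeroSet W q).Finite := by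
  obtain ⟨T, -, hT⟩ := zeroSet_subset (W := W) q hq
  exact (zeroSet_ncard_le q hT).1

namespace StandardMap

variable {c : k} {N D : k[X]} (h : StandardMap W.a₄ W.a₆ W'.a₄ W'.a₆ c N D)
include h

lemma equation_image {x y : k} (hxy : W.Equation x y) (hD : D.eval x ≠ 0) :
    W'.Equation (N.eval x / D.eval x) (c * y * ((quotDeriv N D).eval x / D.eval x ^ 2)) := by
  rw [equation_iff_of_isShortNF] at *
  have hode := congrArg (eval x) h.ode
  simp only [eval_mul, eval_add, eval_pow, eval_C, cubic, eval_X] at hode hxy ⊢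
  field_simp
  linear_combination hode + (c ^ 2 * (quotDeriv N D).eval x ^ 2) * hxy

open Classical in
/-- The map `(x, y) ↦ (f(x), c y f'(x))` on nonsingular points, where `f = N / D`; the zeros of `D`
are sent to the point at infinity. -/
def toFun [W'.IsElliptic] : W.Point → W'.Point
  | .zero => 0
  | .some x y hxy => if hD : D.eval x = 0 then 0 else
      .some (N.eval x / D.eval x) (c * y * ((quotDeriv N D).eval x / D.eval x ^ 2))
        (Affine.equation_iff_nonsingular.1 (h.equation_image hxy.1 hD))

variable [W'.IsElliptic]

lemma toFun_zero : h.toFun 0 = 0 := rfl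

lemma toFun_some_of_eq {x y : k} (hxy : W.Nonsingular x y) (hD : D.eval x = 0) :
    h.toFun (.some x y hxy) = 0 := by
  simp [toFun, hD]

lemma toFun_some_of_ne {x y : k} (hxy : W.Nonsingular x y) (hD : D.eval x ≠ 0) :
    h.toFun (.some x y hxy) =
      .some (N.eval x / D.eval x) (c * y * ((quotDeriv N D).eval x / D.eval x ^ 2))
        (Affine.equation_iff_nonsingular.1 (h.equation_image hxy.1 hD)) := by
  simp [toFun, hD]

/-- The map is additive on pairs of points in general position. -/
lemma toFun_add [IsAlgClosed k] [DecidableEq k] {x₁ y₁ x₂ y₂ x₃ y₃ : k} (h₁ : W.Nonsingular x₁ y₁)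
    (h₂ : W.Nonsingular x₂ y₂) (h₃ : W.Nonsingular x₃ y₃)
    (hadd : Affine.Point.some x₁ y₁ h₁ + .some x₂ y₂ h₂ = .some x₃ y₃ h₃) (hx : x₁ ≠ x₂)
    (hD₁ : D.eval x₁ ≠ 0) (hD₂ : D.eval x₂ ≠ 0) (hD₃ : D.eval x₃ ≠ 0)
    (hX : N.eval x₁ / D.eval x₁ ≠ N.eval x₂ / D.eval x₂) :
    h.toFun (.some x₃ y₃ h₃) = h.toFun (.some x₁ y₁ h₁) + h.toFun (.some x₂ y₂ h₂) := by
  have h2 : (2 : k) ≠ 0 := by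
    intro h0
    have := W'.isUnit_Δ
    rw [Δ_of_isShortNF', show (-16 : k) = -8 * 2 by norm_num, h0, mul_zero, zero_mul] at this
    exact not_isUnit_zero this
  rw [Affine.Point.add_of_X_ne hx, Affine.Point.some.injEq] at hadd
  have hline := Affine.addPolynomial_slope h₁.1 h₂.1 fun H => hx H.1
  set l := W.slope x₁ x₂ y₁ y₂ with hl
  have hl' : l = (y₁ - y₂) / (x₁ - x₂) := Affine.slope_of_X_ne hx
  have hx12 : x₁ - x₂ ≠ 0 := sub_ne_zero.2 hx
  rw [hadd.1] at hline
  have hy₃ : y₃ = -(l * (x₃ - x₁) + y₁) := by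
    rw [← hadd.2, Affine.addY, Affine.negAddY, Affine.negY, hadd.1]
    simp
  have hprod : cubic W.a₄ W.a₆ - (C l * X + C (y₁ - l * x₁)) ^ 2 =
      ∏ i, (X - C ((![x₁, x₂, x₃] : Fin 3 → k) i)) := by
    rw [Fin.prod_univ_three, ← neg_inj]
    simp only [Matrix.cons_val]
    rw [← hline, Affine.addPolynomial, Affine.polynomial, Affine.linePolynomial]
    simp [cubic]
    ring
  obtain ⟨l', m', hl'm', hYi⟩ := h.exists_line h2 squarefree_of_isElliptic l (y₁ - l * x₁)
    ![x₁, x₂, x₃] hprod (by intro i; fin_cases i <;> assumption)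
  have hY₁ := hYi 0
  have hY₂ := hYi 1
  have hY₃ := hYi 2
  simp only [Matrix.cons_val] at hY₁ hY₂ hY₃
  rw [show l * x₁ + (y₁ - l * x₁) = y₁ by ring] at hY₁
  rw [show l * x₂ + (y₁ - l * x₁) = y₂ by rw [hl']; field_simp; ring] at hY₂
  rw [show l * x₃ + (y₁ - l * x₁) = -y₃ by rw [hy₃]; ring] at hY₃
  rw [h.toFun_some_of_ne h₁ hD₁, h.toFun_some_of_ne h₂ hD₂, h.toFun_some_of_ne h₃ hD₃,
    Affine.Point.add_of_X_ne hX]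
  set X₁ := N.eval x₁ / D.eval x₁
  set X₂ := N.eval x₂ / D.eval x₂
  set X₃ := N.eval x₃ / D.eval x₃
  have hX12 : X₁ - X₂ ≠ 0 := sub_ne_zero.2 hX
  have hsl : W'.slope X₁ X₂ (c * y₁ * ((quotDeriv N D).eval x₁ / D.eval x₁ ^ 2))
      (c * y₂ * ((quotDeriv N D).eval x₂ / D.eval x₂ ^ 2)) = l' := by
    rw [Affine.slope_of_X_ne hX, hY₁, hY₂]
    field_simp
    ring
  have hsum : X₁ + X₂ + X₃ = l' ^ 2 := by
    have e1 : cubic W'.a₄ W'.a₆ - (C l' * X + C m') ^ 2 = X ^ 3 - C (l' ^ 2) * X ^ 2 +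
        C (W'.a₄ - 2 * l' * m') * X + C (W'.a₆ - m' ^ 2) := by
      simp only [cubic, map_sub, map_mul, map_pow, map_ofNat]
      ring
    have e2 : (X - C X₁) * (X - C X₂) * (X - C X₃) = X ^ 3 - C (X₁ + X₂ + X₃) * X ^ 2 +
        C (X₁ * X₂ + X₁ * X₃ + X₂ * X₃) * X + C (-(X₁ * X₂ * X₃)) := by
      simp only [map_add, map_mul, map_neg]
      ring
    rw [Fin.prod_univ_three] at hl'm'
    simp only [Matrix.cons_val] at hl'm'
    rw [e1] at hl'm'
    have e3 := hl'm'.trans e2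
    have e4 := congrArg (fun q => q.coeff 2) e3
    simp only [coeff_add, coeff_sub, coeff_X_pow, coeff_C_mul, coeff_X, coeff_C] at e4
    norm_num at e4
    linear_combination e4
  have hx₃ : W'.addX X₁ X₂ l' = X₃ := by
    simp only [Affine.addX, a₁_of_isShortNF, a₂_of_isShortNF]
    linear_combination -hsum
  rw [Affine.Point.some.injEq]
  constructor
  · rw [hsl, hx₃]
  · rw [hsl, Affine.addY, Affine.negAddY, Affine.negY, hx₃]
    simp only [a₁_of_isShortNF, a₃_of_isShortNF]
    linear_combination -hY₃ + hY₁

end StandardMap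

end Points

/-! ### The homomorphism and its kernel -/

section Homomorphism

variable {k : Type*} [Field k] [IsAlgClosed k]
variable {W W' : WeierstrassCurve.Affine k} [W.IsShortNF] [W'.IsShortNF] [W.IsElliptic]
  [W'.IsElliptic]

namespace StandardMap

variable {c : k} {N D : k[X]} (h : StandardMap W.a₄ W.a₆ W'.a₄ W'.a₆ c N D)
include h

omit [IsAlgClosed k] [W.IsShortNF] [W'.IsShortNF] [W.IsElliptic] [W'.IsElliptic] in
lemma fibrePoly_ne_zero (τ : k) : fibrePoly N D τ ≠ 0 := by
  intro h0
  have h1 := h.fibrePoly_natDegree τ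
  have := h.degree_lt
  rw [h0, natDegree_zero] at h1
  omega

open Filter in
/-- Additivity at generic pairs of points extends to a homomorphism, with the given values off the
zeros of the denominator. -/
lemma exists_hom_of_generic [DecidableEq k] :
    ∃ φ : W.Point →+ W'.Point, ∀ P ∉ zeroSet W D, φ P = h.toFun P := by
  have : Infinite W.Point := infinite_point
  have hS : (zeroSet W D ∪ {0}).Finite :=
    (zeroSet_finite h.D_ne_zero).union (Set.finite_singleton _)
  obtain ⟨φ, hφ⟩ := exists_addMonoidHom_of_eventually_additive h.toFun hS (fun P hP => by
    match P, hP with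
    | .zero, hP => exact absurd (Or.inr rfl) hP
    | .some x₁ y₁ h₁, hP =>
      have hD₁ : D.eval x₁ ≠ 0 := fun h0 => hP (Or.inl ⟨x₁, y₁, h₁, rfl, h0⟩)
      set q : k[X] := (X - C x₁) * D * fibrePoly N D (N.eval x₁ / D.eval x₁) with hq
      have hq0 : q ≠ 0 := mul_ne_zero (mul_ne_zero (X_sub_C_ne_zero _) h.D_ne_zero)
        (h.fibrePoly_ne_zero _)
      have h1 : ∀ᶠ Q in cofinite, Q ∉ zeroSet W q ∪ {0} :=
        ((zeroSet_finite hq0).union (Set.finite_singleton _)).compl_mem_cofinite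
      have h2 : ∀ᶠ Q in cofinite, Affine.Point.some x₁ y₁ h₁ + Q ∉ zeroSet W D ∪ {0} :=
        (add_right_injective _).tendsto_cofinite.eventually hS.compl_mem_cofinite
      filter_upwards [h1, h2] with Q hQ hPQ
      match Q, hQ, hPQ with
      | .zero, hQ, _ => exact absurd (Or.inr rfl) hQ
      | .some x₂ y₂ h₂, hQ, hPQ =>
        have hq2 : q.eval x₂ ≠ 0 := fun h0 => hQ (Or.inl ⟨x₂, y₂, h₂, rfl, h0⟩)
        rw [hq, eval_mul, eval_mul] at hq2
        have hx : x₁ ≠ x₂ := by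
          rintro rfl
          simp at hq2
        have hD₂ : D.eval x₂ ≠ 0 := right_ne_zero_of_mul (left_ne_zero_of_mul hq2)
        have hX : N.eval x₁ / D.eval x₁ ≠ N.eval x₂ / D.eval x₂ := by
          intro h0
          apply right_ne_zero_of_mul hq2
          rw [fibrePoly_eval, h0, aeval_def, aeval_def, eval₂_eq_eval_map, eval₂_eq_eval_map]
          simp [hD₂]
        generalize hR : Affine.Point.some x₁ y₁ h₁ + .some x₂ y₂ h₂ = R at hPQ
        match R, hR, hPQ with
        | .zero, _, hPQ => exact absurd (Or.inr rfl) hPQ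
        | .some x₃ y₃ h₃, hR, hPQ =>
          have hD₃ : D.eval x₃ ≠ 0 := fun h0 => hPQ (Or.inl ⟨x₃, y₃, h₃, rfl, h0⟩)
          exact h.toFun_add h₁ h₂ h₃ hR hx hD₁ hD₂ hD₃ hX)
  refine ⟨φ, fun P hP => ?_⟩
  by_cases hP0 : P = 0
  · rw [hP0, map_zero, h.toFun_zero]
  · exact hφ P (by simp [hP, hP0])

omit [W.IsElliptic] in
/-- Every root of the fibre polynomial is the abscissa of a preimage. -/
lemma exists_toFun_eq {X₀ Y₀ x : k} (h₀ : W'.Nonsingular X₀ Y₀)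
    (hx : (fibrePoly N D X₀).eval x = 0) :
    ∃ y, ∃ _ : W.Equation x y, ∀ h' : W.Nonsingular x y,
      h.toFun (.some x y h') = .some X₀ Y₀ h₀ := by
  have hD : D.eval x ≠ 0 := by
    have := h.aeval_D_ne_zero hx
    rwa [coe_aeval_eq_eval] at this
  have hX : N.eval x / D.eval x = X₀ := by
    rw [fibrePoly_eval, coe_aeval_eq_eval, sub_eq_zero] at hx
    rw [hx, mul_div_cancel_right₀ _ hD]
  obtain ⟨y, hy⟩ := IsAlgClosed.exists_pow_nat_eq ((cubic W.a₄ W.a₆).eval x) two_pos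
  have hY := equation_iff_of_isShortNF.1 (h.equation_image (equation_iff_of_isShortNF.2 hy) hD)
  rw [hX, ← equation_iff_of_isShortNF.1 h₀.1] at hY
  rcases sq_eq_sq_iff_eq_or_eq_neg.1 hY with h1 | h1
  · refine ⟨y, equation_iff_of_isShortNF.2 hy, fun h' => ?_⟩
    rw [h.toFun_some_of_ne h' hD, Affine.Point.some.injEq]
    exact ⟨hX, h1⟩
  · refine ⟨-y, equation_iff_of_isShortNF.2 (by rw [neg_sq, hy]), fun h' => ?_⟩
    rw [h.toFun_some_of_ne h' hD, Affine.Point.some.injEq]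
    exact ⟨hX, by linear_combination -h1⟩

omit [W.IsShortNF] [W'.IsShortNF] [W.IsElliptic] [W'.IsElliptic] in
/-- All but finitely many fibres of `N / D` have as many points as the degree of `N / D`. -/
lemma exists_card_fibre : ∃ X₀ : k, ∃ T : Finset k, T.card = N.natDegree ∧
    ∀ x ∈ T, (fibrePoly N D X₀).eval x = 0 := by
  classical
  have : Infinite k := IsAlgClosed.instInfinite
  obtain ⟨X₀, hX₀⟩ := Infinite.exists_notMem_finset
    ((quotDeriv N D).roots.toFinset.image fun x => N.eval x / D.eval x)
  have hsep : (fibrePoly N D X₀).Separable := by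
    apply fibrePoly_separable
    intro r hr h0
    obtain ⟨r₀, rfl⟩ := exists_algebraMap_eq_of_aeval_eq_zero h.quotDeriv_ne_zero h0
    rw [aeval_algebraMap_apply, coe_aeval_eq_eval] at hr h0
    rw [aeval_algebraMap_apply, coe_aeval_eq_eval, ← map_mul] at hr
    rw [map_eq_zero] at h0
    have hr' := (algebraMap k (AlgebraicClosure k)).injective hr
    have hf : (fibrePoly N D X₀).eval r₀ = 0 := by
      rw [fibrePoly_eval, coe_aeval_eq_eval, hr', sub_self]
    have hD := h.aeval_D_ne_zero hf
    rw [coe_aeval_eq_eval] at hD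
    refine hX₀ (Finset.mem_image.2 ⟨r₀, ?_, by rw [hr', mul_div_cancel_right₀ _ hD]⟩)
    rw [Multiset.mem_toFinset, mem_roots h.quotDeriv_ne_zero]
    exact h0
  refine ⟨X₀, (fibrePoly N D X₀).roots.toFinset, ?_, fun x hx => ?_⟩
  · rw [Multiset.toFinset_card_of_nodup (nodup_roots hsep),
      ← (IsAlgClosed.splits _).natDegree_eq_card_roots, h.fibrePoly_natDegree]
  · rw [Multiset.mem_toFinset, mem_roots (h.fibrePoly_ne_zero _)] at hx
    exact hx

/-- If the zeros of the denominator leave room for at most `deg f` kernel points, the map is a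
surjective homomorphism whose kernel has order `deg f`. -/
theorem exists_hom [DecidableEq k] (hcard : (zeroSet W D ∪ {0}).ncard ≤ N.natDegree) :
    ∃ φ : W.Point →+ W'.Point, Function.Surjective φ ∧ (∀ P, φ P = h.toFun P) ∧
      Nat.card φ.ker = N.natDegree := by
  obtain ⟨φ, hφ⟩ := h.exists_hom_of_generic
  have hS : (zeroSet W D ∪ {0}).Finite :=
    (zeroSet_finite h.D_ne_zero).union (Set.finite_singleton _)
  have hker : (φ.ker : Set W.Point) ⊆ zeroSet W D ∪ {0} := by
    intro P hP
    by_contra hPS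
    have hP0 : h.toFun P = 0 := by
      rw [← hφ P fun h0 => hPS (Or.inl h0)]
      exact hP
    match P, hPS, hP0 with
    | .zero, hPS, _ => exact hPS (Or.inr rfl)
    | .some x y hxy, hPS, hP0 =>
      have hD : D.eval x ≠ 0 := fun h0 => hPS (Or.inl ⟨x, y, hxy, rfl, h0⟩)
      rw [h.toFun_some_of_ne hxy hD] at hP0
      exact Affine.Point.some_ne_zero _ hP0
  have hpre : ∀ X₀ Y₀ x (h₀ : W'.Nonsingular X₀ Y₀), (fibrePoly N D X₀).eval x = 0 →
      ∃ y, ∃ hxy : W.Nonsingular x y, φ (.some x y hxy) = .some X₀ Y₀ h₀ := by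
    intro X₀ Y₀ x h₀ hx
    obtain ⟨y, hy, hy'⟩ := h.exists_toFun_eq h₀ hx
    have hxy := Affine.equation_iff_nonsingular.1 hy
    refine ⟨y, hxy, ?_⟩
    rw [hφ, hy' hxy]
    rintro ⟨x', y', hxy', he, h0⟩
    obtain ⟨rfl, -⟩ := (Affine.Point.some.injEq ..).mp he
    have := h.aeval_D_ne_zero hx
    rw [coe_aeval_eq_eval] at this
    exact this h0
  -- the differences of the points of a separable fibre give `deg f` elements of the kernel
  have hle : N.natDegree ≤ (φ.ker : Set W.Point).ncard := by
    obtain ⟨X₀, T, hT, hTr⟩ := h.exists_card_fibre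
    obtain ⟨Y₀, hY₀⟩ := IsAlgClosed.exists_pow_nat_eq ((cubic W'.a₄ W'.a₆).eval X₀) two_pos
    have h₀ : W'.Nonsingular X₀ Y₀ :=
      Affine.equation_iff_nonsingular.1 (equation_iff_of_isShortNF.2 hY₀)
    have hTne : T.Nonempty := by
      rw [← Finset.card_pos, hT]
      exact (Nat.zero_le _).trans_lt h.degree_lt
    obtain ⟨x₀, hx₀⟩ := hTne
    have hch : ∀ x : T, ∃ P : W.Point, (∃ y hxy, P = .some x y hxy) ∧ φ P = .some X₀ Y₀ h₀ := by
      intro x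
      obtain ⟨y, hxy, hP⟩ := hpre X₀ Y₀ x h₀ (hTr x x.2)
      exact ⟨_, ⟨y, hxy, rfl⟩, hP⟩
    choose p hp1 hp2 using hch
    have hinj : Function.Injective fun x => p x - p ⟨x₀, hx₀⟩ := by
      intro x x' hxx
      have hpp := sub_left_injective hxx
      obtain ⟨y, hy, e⟩ := hp1 x
      obtain ⟨y', hy', e'⟩ := hp1 x'
      rw [e, e', Affine.Point.some.injEq] at hpp
      exact Subtype.ext hpp.1
    have hmem : Set.range (fun x => p x - p ⟨x₀, hx₀⟩) ⊆ φ.ker := by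
      rintro _ ⟨x, rfl⟩
      simp [AddMonoidHom.mem_ker, hp2]
    have := Set.ncard_le_ncard hmem (hS.subset hker)
    rwa [← Nat.card_coe_set_eq, Nat.card_range_of_injective hinj, Nat.card_eq_fintype_card,
      Fintype.card_coe, hT] at this
  have heq : (φ.ker : Set W.Point) = zeroSet W D ∪ {0} :=
    Set.eq_of_subset_of_ncard_le hker (hcard.trans hle) hS
  refine ⟨φ, ?_, fun P => ?_, ?_⟩
  · intro P'
    match P' with
    | .zero => exact ⟨0, map_zero φ⟩
    | .some X₀ Y₀ h₀ =>
      obtain ⟨x, hx⟩ := IsAlgClosed.exists_root (fibrePoly N D X₀) (by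
        rw [degree_eq_natDegree (h.fibrePoly_ne_zero _), h.fibrePoly_natDegree]
        exact_mod_cast ((Nat.zero_le _).trans_lt h.degree_lt).ne')
      obtain ⟨y, hxy, hP⟩ := hpre X₀ Y₀ x h₀ hx
      exact ⟨_, hP⟩
  · by_cases hP : P ∈ zeroSet W D
    · have hPk : P ∈ (φ.ker : Set W.Point) := by
        rw [heq]
        exact Or.inl hP
      rw [show φ P = 0 from hPk]
      obtain ⟨x, y, hxy, rfl, hD⟩ := hP
      rw [h.toFun_some_of_eq hxy hD]
    · exact hφ P hP
  · refine le_antisymm ?_ ?_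
    · change Nat.card (φ.ker : Set W.Point) ≤ _
      rw [Nat.card_coe_set_eq, heq]
      exact hcard
    · change _ ≤ Nat.card (φ.ker : Set W.Point)
      rwa [Nat.card_coe_set_eq]

end StandardMap

end Homomorphism

/-! ### Isogenies over a field -/

section Isogenies

variable {F : Type*} [Field F]

lemma quotDeriv_map {R S : Type*} [CommRing R] [CommRing S] (σ : R →+* S) (N D : R[X]) :
    quotDeriv (N.map σ) (D.map σ) = (quotDeriv N D).map σ := by
  simp [quotDeriv, derivative_map]

lemma StandardMap.map {k : Type*} [Field k] (σ : F →+* k) {a b a' b' c : F} {N D : F[X]}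
    (h : StandardMap a b a' b' c N D) :
    StandardMap (σ a) (σ b) (σ a') (σ b') (σ c) (N.map σ) (D.map σ) where
  coprime := h.coprime.map (mapRingHom σ)
  degree_lt := by simpa using h.degree_lt
  c_ne_zero := by simpa using h.c_ne_zero
  ode := by
    have := congrArg (Polynomial.map σ) h.ode
    rw [quotDeriv_map]
    simpa [cubic] using this

instance isShortNF_map {R S : Type*} [CommRing R] [CommRing S] (σ : R →+* S)
    (W : WeierstrassCurve R) [W.IsShortNF] : (W.map σ).IsShortNF where
  a₁ := by simp
  a₂ := by simp
  a₃ := by simp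

variable {W W' W'' : WeierstrassCurve F}

open scoped Classical in
/-- A map in standard form of prime degree is an isogeny with cyclic kernel, provided that its
denominator has few zeros. -/
theorem StandardMap.exists_isogeny_of_ncard_le [W.IsShortNF] [W'.IsShortNF] [W.IsElliptic]
    [W'.IsElliptic] {c : F} {N D : F[X]} (h : StandardMap W.a₄ W.a₆ W'.a₄ W'.a₆ c N D)
    (hcard : (zeroSet (W.baseChange (AlgebraicClosure F)).toAffine
      (D.map (algebraMap F (AlgebraicClosure F))) ∪ {0}).ncard ≤ N.natDegree)
    (hp : N.natDegree.Prime) :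
    ∃ ψ : Isogeny W W', ψ.HasCyclicKernel N.natDegree ∧ ψ.HasStandardForm N.natDegree c := by
  set k := AlgebraicClosure F
  have : (W.baseChange k).toAffine.IsShortNF := isShortNF_map _ _
  have : (W'.baseChange k).toAffine.IsShortNF := isShortNF_map _ _
  have : (W.baseChange k).toAffine.IsElliptic := inferInstanceAs (W.map (algebraMap F k)).IsElliptic
  have : (W'.baseChange k).toAffine.IsElliptic :=
    inferInstanceAs (W'.map (algebraMap F k)).IsElliptic
  have h' : StandardMap (W.baseChange k).toAffine.a₄ (W.baseChange k).toAffine.a₆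
      (W'.baseChange k).toAffine.a₄ (W'.baseChange k).toAffine.a₆ (algebraMap F k c)
      (N.map (algebraMap F k)) (D.map (algebraMap F k)) := h.map _
  obtain ⟨φ, hφs, hφ, hφk⟩ := h'.exists_hom (by rwa [natDegree_map])
  rw [natDegree_map] at hφk
  have hform : ∀ (x y : k) (hxy : (W.baseChange k).toAffine.Nonsingular x y),
      (aeval x D = 0 → φ (.some x y hxy) = 0) ∧
      (aeval x D ≠ 0 → ∃ h', φ (.some x y hxy) = .some (aeval x N / aeval x D)
        (algebraMap F k c * y *
          (aeval x (derivative N * D - N * derivative D) / aeval x D ^ 2)) h') := by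
    intro x y hxy
    have e1 : ∀ p : F[X], aeval x p = (p.map (algebraMap F k)).eval x := fun p => by
      rw [eval_map_algebraMap]
    have e2 : (derivative N * D - N * derivative D).map (algebraMap F k) =
      quotDeriv (N.map (algebraMap F k)) (D.map (algebraMap F k)) := (quotDeriv_map _ _ _).symm
    simp only [e1, e2]
    refine ⟨fun hD => ?_, fun hD => ?_⟩
    · rw [hφ, h'.toFun_some_of_eq hxy hD]
    · have hns := Affine.equation_iff_nonsingular.1 (h'.equation_image hxy.1 hD)
      exact ⟨hns, (hφ _).trans (h'.toFun_some_of_ne hxy hD)⟩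
  refine ⟨⟨φ, hφs, ?_⟩, ?_, ?_⟩
  · refine ⟨aeval (MvPolynomial.X 0) N, aeval (MvPolynomial.X 0) D,
      MvPolynomial.C c * MvPolynomial.X 1 *
        aeval (MvPolynomial.X 0 : MvPolynomial (Fin 2) F) (quotDeriv N D),
      aeval (MvPolynomial.X 0 : MvPolynomial (Fin 2) F) (D ^ 2), ?_⟩
    refine ((zeroSet_finite h'.D_ne_zero).union (Set.finite_singleton 0)).subset fun P hP => ?_
    by_contra hPS
    apply hP
    match P, hPS with
    | .zero, hPS => exact absurd (Or.inr rfl) hPS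
    | .some x y hxy, hPS =>
      have hD : aeval x D ≠ 0 := fun h0 => hPS (Or.inl ⟨x, y, hxy, rfl, by
        rw [eval_map_algebraMap, h0]⟩)
      obtain ⟨h'', he⟩ := (hform x y hxy).2 hD
      have e3 : ∀ p : F[X], MvPolynomial.aeval ![x, y]
          (aeval (MvPolynomial.X 0 : MvPolynomial (Fin 2) F) p) = aeval x p := fun p => by
        rw [← aeval_algHom_apply]
        simp
      have e4 : algebraMap F k c * y *
          (aeval x (derivative N * D - N * derivative D) / aeval x D ^ 2) =
          MvPolynomial.aeval ![x, y] (MvPolynomial.C c * MvPolynomial.X 1 *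
            aeval (MvPolynomial.X 0 : MvPolynomial (Fin 2) F) (quotDeriv N D)) /
          MvPolynomial.aeval ![x, y]
            (aeval (MvPolynomial.X 0 : MvPolynomial (Fin 2) F) (D ^ 2)) := by
        rw [map_mul, map_mul, e3, e3, map_pow, MvPolynomial.aeval_X, MvPolynomial.aeval_C,
          quotDeriv, mul_div_assoc]
        rfl
      simp only [e4] at he h''
      simp only [← e3 N, ← e3 D] at he h''
      refine ⟨x, y, hxy, h'', rfl, ?_, ?_, he⟩
      · rwa [e3]
      · rw [e3, map_pow]
        exact pow_ne_zero 2 hD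
  · have := Fact.mk hp
    have hc : IsAddCyclic φ.ker := isAddCyclic_of_prime_card hφk
    exact ⟨(hφk ▸ zmodAddCyclicAddEquiv hc).symm⟩
  · refine ⟨N, D, h.coprime, rfl, h.degree_lt, hform⟩

/-- The case in which the denominator is a square: each of its zeros lies under two points. -/
theorem StandardMap.exists_isogeny_of_sq [W.IsShortNF] [W'.IsShortNF] [W.IsElliptic]
    [W'.IsElliptic] {c : F} {N H : F[X]} (h : StandardMap W.a₄ W.a₆ W'.a₄ W'.a₆ c N (H ^ 2))
    (hH : N.natDegree = 2 * H.natDegree + 1) (hp : N.natDegree.Prime) :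
    ∃ ψ : Isogeny W W', ψ.HasCyclicKernel N.natDegree ∧ ψ.HasStandardForm N.natDegree c := by
  apply h.exists_isogeny_of_ncard_le _ hp
  set k := AlgebraicClosure F
  have : (W.baseChange k).toAffine.IsShortNF := isShortNF_map _ _
  have h0 : H.map (algebraMap F k) ≠ 0 := by
    rw [Polynomial.map_ne_zero_iff (algebraMap F k).injective]
    rintro rfl
    exact h.D_ne_zero (by simp)
  obtain ⟨T, hT, hT'⟩ := zeroSet_subset (W := (W.baseChange k).toAffine) _ h0
  have h1 := (zeroSet_ncard_le (W := (W.baseChange k).toAffine) (q := (H ^ 2).map (algebraMap F k))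
    (T := T) (fun x y hxy hx => hT' x y hxy (by simpa using hx))).2
  refine (Set.ncard_union_le _ _).trans ?_
  rw [Set.ncard_singleton, hH]
  rw [natDegree_map] at hT
  exact Nat.add_le_add_right (h1.trans hT) 1

/-- The case of degree two: the zero of the denominator lies under a single point. -/
theorem StandardMap.exists_isogeny_of_root [W.IsShortNF] [W'.IsShortNF] [W.IsElliptic]
    [W'.IsElliptic] {c : F} {N : F[X]} {α : F}
    (h : StandardMap W.a₄ W.a₆ W'.a₄ W'.a₆ c N (X - C α)) (hN : N.natDegree = 2)
    (hα : (cubic W.a₄ W.a₆).eval α = 0) :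
    ∃ ψ : Isogeny W W', ψ.HasCyclicKernel N.natDegree ∧ ψ.HasStandardForm N.natDegree c := by
  apply h.exists_isogeny_of_ncard_le _ (hN ▸ Nat.prime_two)
  set k := AlgebraicClosure F
  have : (W.baseChange k).toAffine.IsShortNF := isShortNF_map _ _
  have h1 := (zeroSet_ncard_le (W := (W.baseChange k).toAffine)
    ((X - C α).map (algebraMap F k)) (T := {(algebraMap F k α, 0)}) (fun x y hxy hx => by
      have hx' : x = algebraMap F k α := by simpa [sub_eq_zero] using hx
      have h2 := equation_iff_of_isShortNF.1 hxy.1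
      have h3 : (cubic (W.baseChange k).toAffine.a₄ (W.baseChange k).toAffine.a₆).eval x = 0 := by
        have := congrArg (algebraMap F k) hα
        rw [hx']
        simpa [cubic] using this
      rw [h3, sq_eq_zero_iff] at h2
      simp [hx', h2])).2
  refine (Set.ncard_union_le _ _).trans ?_
  rw [Set.ncard_singleton, hN]
  exact Nat.add_le_add_right h1 1

lemma Isogeny.finite_preimage (φ : Isogeny W W') (hφ : Finite φ.toHom.ker) {S : Set (GeomPoint W')}
    (hS : S.Finite) : (φ.toHom ⁻¹' S).Finite := by
  refine hS.preimage' fun Q _ => ?_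
  obtain ⟨P, rfl⟩ := φ.surjective Q
  refine ((Set.toFinite (φ.toHom.ker : Set _)).image (fun R => P + R)).subset fun R hR => ?_
  refine ⟨R - P, ?_, add_sub_cancel P R⟩
  simpa [AddMonoidHom.mem_ker, sub_eq_zero] using hR

/-- Substituting fractions into a polynomial gives a fraction. -/
lemma exists_substitution (p q r s w : MvPolynomial (Fin 2) F) :
    ∃ P M : MvPolynomial (Fin 2) F, ∀ x y : AlgebraicClosure F,
      MvPolynomial.aeval ![x, y] q ≠ 0 → MvPolynomial.aeval ![x, y] s ≠ 0 →
      MvPolynomial.aeval ![x, y] M ≠ 0 ∧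
      MvPolynomial.aeval ![MvPolynomial.aeval ![x, y] p / MvPolynomial.aeval ![x, y] q,
        MvPolynomial.aeval ![x, y] r / MvPolynomial.aeval ![x, y] s] w =
        MvPolynomial.aeval ![x, y] P / MvPolynomial.aeval ![x, y] M := by
  induction w using MvPolynomial.induction_on with
  | C a => exact ⟨MvPolynomial.C a, 1, fun x y _ _ => by simp⟩
  | add w₁ w₂ h₁ h₂ =>
    obtain ⟨P₁, M₁, h₁⟩ := h₁
    obtain ⟨P₂, M₂, h₂⟩ := h₂
    refine ⟨P₁ * M₂ + P₂ * M₁, M₁ * M₂, fun x y hq hs => ?_⟩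
    obtain ⟨h₁, e₁⟩ := h₁ x y hq hs
    obtain ⟨h₂, e₂⟩ := h₂ x y hq hs
    simp only [map_add, map_mul, e₁, e₂]
    exact ⟨mul_ne_zero h₁ h₂, by field_simp⟩
  | mul_X w i hw =>
    obtain ⟨P, M, hw⟩ := hw
    fin_cases i
    · refine ⟨P * p, M * q, fun x y hq hs => ?_⟩
      obtain ⟨h, e⟩ := hw x y hq hs
      simp only [map_mul, e, MvPolynomial.aeval_X]
      exact ⟨mul_ne_zero h hq, div_mul_div_comm _ _ _ _⟩
    · refine ⟨P * r, M * s, fun x y hq hs => ?_⟩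
      obtain ⟨h, e⟩ := hw x y hq hs
      simp only [map_mul, e, MvPolynomial.aeval_X]
      exact ⟨mul_ne_zero h hs, div_mul_div_comm _ _ _ _⟩

/-- Existence of an isogeny with finite kernel. Finiteness is required in order that isogenies
compose. -/
def Isogenous (W W' : WeierstrassCurve F) : Prop := ∃ φ : Isogeny W W', Finite φ.toHom.ker

lemma Isogenous.refl (W : WeierstrassCurve F) : Isogenous W W := by
  refine ⟨⟨AddMonoidHom.id _, Function.surjective_id, MvPolynomial.X 0, 1, MvPolynomial.X 1, 1,
    (Set.finite_singleton 0).subset fun P hP => ?_⟩, ?_⟩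
  · match P, hP with
    | .zero, _ => rfl
    | .some x y h, hP => exact absurd ⟨x, y, h, by simpa using h, rfl, by simp⟩ hP
  · refine Set.Finite.subset (Set.finite_singleton 0) fun P hP => ?_
    simpa using hP

/-- Isogenies with finite kernel compose: the composite is given by rational functions outside a
finite set, because preimages of finite sets are finite. -/
lemma Isogenous.trans (h : Isogenous W W') (h' : Isogenous W' W'') : Isogenous W W'' := by
  obtain ⟨φ, hφ⟩ := h
  obtain ⟨ψ, hψ⟩ := h'
  obtain ⟨p, q, r, s, hE⟩ := φ.rational
  obtain ⟨p', q', r', s', hE'⟩ := ψ.rational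
  obtain ⟨P₁, M₁, h₁⟩ := exists_substitution p q r s p'
  obtain ⟨P₂, M₂, h₂⟩ := exists_substitution p q r s q'
  obtain ⟨P₃, M₃, h₃⟩ := exists_substitution p q r s r'
  obtain ⟨P₄, M₄, h₄⟩ := exists_substitution p q r s s'
  refine ⟨⟨ψ.toHom.comp φ.toHom, ψ.surjective.comp φ.surjective, P₁ * M₂, M₁ * P₂, P₃ * M₄,
    M₃ * P₄, (hE.union (φ.finite_preimage hφ hE')).subset fun P hP => ?_⟩, ?_⟩
  · by_contra hcon
    rw [Set.mem_union, not_or] at hcon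
    obtain ⟨hP1, hP2⟩ := hcon
    simp only [Set.mem_ofPred_eq, not_not, Set.mem_preimage] at hP1 hP2
    obtain ⟨x, y, hxy, hXY, rfl, hq, hs, he⟩ := hP1
    obtain ⟨X, Y, hXY', hZ, he', hq', hs', he''⟩ := hP2
    rw [he] at he'
    obtain ⟨rfl, rfl⟩ := (Affine.Point.some.injEq ..).mp he'
    obtain ⟨m₁, e₁⟩ := h₁ x y hq hs
    obtain ⟨m₂, e₂⟩ := h₂ x y hq hs
    obtain ⟨m₃, e₃⟩ := h₃ x y hq hs
    obtain ⟨m₄, e₄⟩ := h₄ x y hq hs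
    have n₂ : MvPolynomial.aeval ![x, y] P₂ ≠ 0 := fun h0 => hq' (by rw [e₂, h0, zero_div])
    have n₄ : MvPolynomial.aeval ![x, y] P₄ ≠ 0 := fun h0 => hs' (by rw [e₄, h0, zero_div])
    apply hP
    rw [he] at he''
    simp only [e₁, e₂, e₃, e₄, div_div_div_eq, ← map_mul] at he'' hZ
    exact ⟨x, y, hxy, hZ, rfl, by rw [map_mul]; exact mul_ne_zero m₁ n₂,
      by rw [map_mul]; exact mul_ne_zero m₃ n₄, by
        rw [AddMonoidHom.comp_apply, he]
        exact he''⟩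
  · refine (φ.finite_preimage hφ (Set.toFinite (ψ.toHom.ker : Set _))).subset fun P hP => ?_
    simpa [AddMonoidHom.mem_ker] using hP

lemma Isogeny.HasCyclicKernel.isogenous {φ : Isogeny W W'} {m : ℕ} [NeZero m]
    (h : φ.HasCyclicKernel m) : Isogenous W W' := by
  obtain ⟨e⟩ := h
  exact ⟨φ, Finite.of_equiv _ e.symm.toEquiv⟩

end Isogenies

/-! ### Vélu's formulas -/

section Velu

variable {F : Type*} [Field F]

/-- Composition with the isomorphism `(x, y) ↦ (κ² x, κ³ y)` of the target. -/
lemma StandardMap.scale_target {a b a' b' c : F} {N D : F[X]} (h : StandardMap a b a' b' c N D)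
    {κ : F} (hκ : κ ≠ 0) :
    StandardMap a b (κ ^ 4 * a') (κ ^ 6 * b') (κ * c) (C (κ ^ 2) * N) D where
  coprime := by
    rw [isCoprime_mul_unit_left_left (isUnit_C.2 (pow_ne_zero 2 hκ).isUnit)]
    exact h.coprime
  degree_lt := by
    rw [natDegree_C_mul (pow_ne_zero 2 hκ)]
    exact h.degree_lt
  c_ne_zero := mul_ne_zero hκ h.c_ne_zero
  ode := by
    have h1 := h.ode
    rw [quotDeriv, derivative_C_mul]
    simp only [quotDeriv, C_mul, C_pow] at h1 ⊢
    linear_combination C κ ^ 6 * h1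

/-- Quadratic twisting of source and target by `e`. -/
lemma StandardMap.twist {a b a' b' c : F} {N D : F[X]} (h : StandardMap a b a' b' c N D)
    {e : F} (he : e ≠ 0) :
    StandardMap (e ^ 2 * a) (e ^ 3 * b) (e ^ 2 * a') (e ^ 3 * b') c
      (C e * N.comp (C e⁻¹ * X)) (D.comp (C e⁻¹ * X)) where
  coprime := by
    rw [isCoprime_mul_unit_left_left (isUnit_C.2 he.isUnit)]
    exact h.coprime.map (compRingHom _)
  degree_lt := by
    rw [natDegree_C_mul he, natDegree_comp, natDegree_comp, natDegree_C_mul_X _ (inv_ne_zero he),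
      mul_one, mul_one]
    exact h.degree_lt
  c_ne_zero := h.c_ne_zero
  ode := by
    have h1 := congrArg (fun q => q.comp (C e⁻¹ * X)) h.ode
    have he' : C e * C e⁻¹ = (1 : F[X]) := by rw [← C_mul, mul_inv_cancel₀ he, C_1]
    have hd : ∀ q : F[X], derivative (q.comp (C e⁻¹ * X)) =
        C e⁻¹ * (derivative q).comp (C e⁻¹ * X) := fun q => by
      rw [derivative_comp]
      simp
    simp only [quotDeriv, cubic, mul_comp, add_comp, sub_comp, pow_comp, C_comp, X_comp, C_mul,
      C_pow, derivative_C_mul, hd] at h1 ⊢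
    set n := N.comp (C e⁻¹ * X)
    set m := D.comp (C e⁻¹ * X)
    set n' := (derivative N).comp (C e⁻¹ * X)
    set m' := (derivative D).comp (C e⁻¹ * X)
    have hw : C e * (C e⁻¹ * n') * m - C e * n * (C e⁻¹ * m') = n' * m - n * m' := by
      linear_combination (n' * m - n * m') * he'
    have hx : X ^ 3 + C e ^ 2 * C a * X + C e ^ 3 * C b =
        C e ^ 3 * ((C e⁻¹ * X) ^ 3 + C a * (C e⁻¹ * X) + C b) := by
      linear_combination (-(X ^ 3 * ((C e * C e⁻¹) ^ 2 + C e * C e⁻¹ + 1)) -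
        C e ^ 2 * C a * X) * he'
    rw [hw, hx]
    linear_combination C e ^ 3 * h1

/-- The quotient by the point of order two with abscissa `α`. -/
lemma standardMap_two {a b a' b' α : F} (hΔ : 4 * a ^ 3 + 27 * b ^ 2 ≠ 0)
    (hα : α ^ 3 + a * α + b = 0) (ha : a' = a - 5 * (3 * α ^ 2 + a))
    (hb : b' = b - 7 * α * (3 * α ^ 2 + a)) :
    StandardMap a b a' b' 1 (X * (X - C α) + C (3 * α ^ 2 + a)) (X - C α) where
  coprime := by
    have hv : 3 * α ^ 2 + a ≠ 0 := by
      intro hv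
      apply hΔ
      linear_combination (4 * a ^ 2 - 12 * α ^ 2 * a + 36 * α ^ 4) * hv +
        27 * (b - α * (α ^ 2 + a)) * hα + 27 * α ^ 2 * (a - α ^ 2) * hv
    refine ⟨C (3 * α ^ 2 + a)⁻¹, -(C (3 * α ^ 2 + a)⁻¹ * X), ?_⟩
    calc _ = C (3 * α ^ 2 + a)⁻¹ * C (3 * α ^ 2 + a) := by ring
      _ = 1 := by rw [← C_mul, inv_mul_cancel₀ hv, C_1]
  degree_lt := by
    have h1 : (X * (X - C α) + C (3 * α ^ 2 + a) : F[X]).natDegree = 2 := by compute_degree!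
    rw [h1, natDegree_X_sub_C]
    norm_num
  c_ne_zero := one_ne_zero
  ode := by
    obtain rfl : b = -(α ^ 3 + a * α) := by linear_combination hα
    subst ha hb
    have hd : derivative (X * (X - C α) + C (3 * α ^ 2 + a)) = 2 * X - C α := by
      rw [derivative_add, derivative_C, derivative_mul, derivative_X_sub_C, derivative_X]
      ring
    rw [quotDeriv, hd, derivative_X_sub_C]
    simp only [cubic, C_add, C_sub, C_mul, C_pow, C_neg, C_1, map_ofNat]
    ring

/-- The quotient by the subgroup of order three with abscissa `α`. -/
lemma standardMap_three {a b a' b' α : F} (h2 : (2 : F) ≠ 0) (hΔ : 4 * a ^ 3 + 27 * b ^ 2 ≠ 0)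
    (hα : 12 * α * (α ^ 3 + a * α + b) = (3 * α ^ 2 + a) ^ 2)
    (ha : a' = a - 10 * (3 * α ^ 2 + a))
    (hb : b' = b - 28 * (α ^ 3 + a * α + b) - 14 * α * (3 * α ^ 2 + a)) :
    StandardMap a b a' b' 1 ((X * (X - C α) + C (2 * (3 * α ^ 2 + a))) * (X - C α) +
      C (4 * (α ^ 3 + a * α + b))) ((X - C α) ^ 2) where
  coprime := by
    have hq : α ^ 3 + a * α + b ≠ 0 := by
      intro hq
      rw [hq, mul_zero] at hα
      have hv : 3 * α ^ 2 + a = 0 := by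
        rw [eq_comm, sq_eq_zero_iff] at hα
        exact hα
      apply hΔ
      linear_combination (4 * a ^ 2 - 12 * α ^ 2 * a + 36 * α ^ 4) * hv +
        27 * (b - α * (α ^ 2 + a)) * hq + 27 * α ^ 2 * (a - α ^ 2) * hv
    have hu : 4 * (α ^ 3 + a * α + b) ≠ 0 :=
      mul_ne_zero (by rw [show (4 : F) = 2 * 2 by norm_num]; exact mul_ne_zero h2 h2) hq
    refine IsCoprime.pow_right ⟨C (4 * (α ^ 3 + a * α + b))⁻¹,
      -(C (4 * (α ^ 3 + a * α + b))⁻¹ * (X * (X - C α) + C (2 * (3 * α ^ 2 + a)))), ?_⟩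
    calc _ = C (4 * (α ^ 3 + a * α + b))⁻¹ * C (4 * (α ^ 3 + a * α + b)) := by ring
      _ = 1 := by rw [← C_mul, inv_mul_cancel₀ hu, C_1]
  degree_lt := by
    have h1 : ((X * (X - C α) + C (2 * (3 * α ^ 2 + a))) * (X - C α) +
      C (4 * (α ^ 3 + a * α + b)) : F[X]).natDegree = 3 := by compute_degree!
    rw [h1, natDegree_pow, natDegree_X_sub_C]
    norm_num
  c_ne_zero := one_ne_zero
  ode := by
    subst ha hb
    have hα' := congrArg C hα
    have hd : derivative ((X * (X - C α) + C (2 * (3 * α ^ 2 + a))) * (X - C α) +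
        C (4 * (α ^ 3 + a * α + b))) =
        (2 * X - C α) * (X - C α) + (X * (X - C α) + C (2 * (3 * α ^ 2 + a))) := by
      simp only [derivative_add, derivative_C, derivative_mul, derivative_X_sub_C, derivative_X]
      ring
    have hd' : derivative ((X - C α) ^ 2) = 2 * (X - C α) := by
      rw [derivative_sq, derivative_X_sub_C, map_ofNat, mul_one]
    rw [quotDeriv, hd, hd']
    simp only [cubic, C_add, C_sub, C_mul, C_pow, C_1, map_ofNat] at hα' ⊢
    linear_combination (X - C α) ^ 2 * (-6 * (X - C α) ^ 5 +
      4 * (3 * C α ^ 2 + C a) * (X - C α) ^ 3 +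
      12 * (C α ^ 3 + C a * C α + C b) * (X - C α) ^ 2) * hα'

/-- The numerator of the quotient by the subgroup of odd order `m` whose nonzero points lie over the
roots of `H`; here `τ` is minus twice the sum of these roots. -/
def kernelNumerator {R : Type*} [CommRing R] (p H : R[X]) (m τ : R) : R[X] :=
  (C m * X + C τ) * H ^ 2 - 2 * derivative p * H * derivative H -
    4 * p * (H * derivative (derivative H) - derivative H ^ 2)

lemma natDegree_kernelNumerator {a b τ : F} {H : F[X]} {j : ℕ} (hH : H.natDegree = j + 2) :
    (kernelNumerator (cubic a b) H ((2 * (j + 2) + 1 : ℕ) : F) τ).natDegree = 2 * (j + 2) + 1 := by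
  have d0 : H.natDegree ≤ j + 2 := hH.le
  have d1 : (derivative H).natDegree ≤ j + 1 := (natDegree_derivative_le _).trans (by omega)
  have d2 : (derivative (derivative H)).natDegree ≤ j :=
    (natDegree_derivative_le _).trans (by omega)
  have p0 : (cubic a b).natDegree ≤ 3 := (cubic_natDegree a b).le
  have p1 : (derivative (cubic a b)).natDegree ≤ 2 := (natDegree_derivative_le _).trans (by omega)
  set l := H.coeff (j + 2) with hl
  have hl0 : l ≠ 0 := by
    rw [hl, ← hH, coeff_natDegree, Ne, leadingCoeff_eq_zero]
    rintro rfl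
    simp at hH
  have c1 : (derivative H).coeff (j + 1) = l * (j + 2) := by
    rw [coeff_derivative, hl]; push_cast; ring
  have c2 : (derivative (derivative H)).coeff j = l * (j + 2) * (j + 1) := by
    rw [coeff_derivative, c1]
  have e0 : (cubic a b).coeff 3 = 1 := by
    have := (cubic_monic a b).coeff_natDegree
    rwa [cubic_natDegree] at this
  have e1 : (derivative (cubic a b)).coeff 2 = 3 := by
    rw [coeff_derivative, e0]; norm_num
  have hm1 : (C ((2 * (j + 2) + 1 : ℕ) : F) * X + C τ).natDegree ≤ 1 := natDegree_linear_le
  have hm2 : (C ((2 * (j + 2) + 1 : ℕ) : F) * X + C τ).coeff 1 = ((2 * (j + 2) + 1 : ℕ) : F) := by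
    simp
  have t1 := coeff_mul_add_eq_of_natDegree_le hm1 (natDegree_mul_le_of_le d0 d0)
  rw [coeff_mul_add_eq_of_natDegree_le d0 d0] at t1
  have t2 := coeff_mul_add_eq_of_natDegree_le (natDegree_mul_le_of_le p1 d0) d1
  rw [coeff_mul_add_eq_of_natDegree_le p1 d0] at t2
  have t3 := coeff_mul_add_eq_of_natDegree_le (natDegree_mul_le_of_le p0 d0) d2
  rw [coeff_mul_add_eq_of_natDegree_le p0 d0] at t3
  have t4 := coeff_mul_add_eq_of_natDegree_le (natDegree_mul_le_of_le p0 d1) d1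
  rw [coeff_mul_add_eq_of_natDegree_le p0 d1] at t4
  have n1 := natDegree_mul_le_of_le hm1 (natDegree_mul_le_of_le d0 d0)
  have n2 := natDegree_mul_le_of_le (natDegree_mul_le_of_le p1 d0) d1
  have n3 := natDegree_mul_le_of_le (natDegree_mul_le_of_le p0 d0) d2
  have n4 := natDegree_mul_le_of_le (natDegree_mul_le_of_le p0 d1) d1
  rw [c1, c2, e0, e1, hm2] at *
  have hN : kernelNumerator (cubic a b) H ((2 * (j + 2) + 1 : ℕ) : F) τ =
      (C ((2 * (j + 2) + 1 : ℕ) : F) * X + C τ) * (H * H) -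
        C 2 * (derivative (cubic a b) * H * derivative H) -
        C 4 * (cubic a b * H * derivative (derivative H)) +
        C 4 * (cubic a b * derivative H * derivative H) := by
    simp only [kernelNumerator, map_ofNat]
    ring
  rw [hN]
  apply natDegree_eq_of_le_of_coeff_ne_zero
  · have q : ∀ {c : F} {q : F[X]} {r : ℕ}, q.natDegree ≤ r → (C c * q).natDegree ≤ r :=
      fun h => (natDegree_C_mul_le _ _).trans h
    have hs : ∀ {f g : F[X]} {r : ℕ}, f.natDegree ≤ r → g.natDegree ≤ r →
        (f - g).natDegree ≤ r :=
      fun h h' => (natDegree_sub_le_of_le h h').trans (max_le le_rfl le_rfl)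
    refine natDegree_add_le_of_degree_le (hs (hs
      (n1.trans ?_) (q (n2.trans ?_))) (q (n3.trans ?_))) (q (n4.trans ?_)) <;> omega
  · have k1 : 2 * (j + 2) + 1 = 1 + (j + 2 + (j + 2)) := by ring
    have k2 : 2 * (j + 2) + 1 = 2 + (j + 2) + (j + 1) := by ring
    have k3 : 2 * (j + 2) + 1 = 3 + (j + 2) + j := by ring
    have k4 : 2 * (j + 2) + 1 = 3 + (j + 1) + (j + 1) := by ring
    rw [coeff_add, coeff_sub, coeff_sub, coeff_C_mul, coeff_C_mul, coeff_C_mul]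
    nth_rewrite 2 [k1]
    rw [t1]
    nth_rewrite 2 [k2]
    rw [t2]
    nth_rewrite 2 [k3]
    rw [t3]
    nth_rewrite 2 [k4]
    rw [t4]
    convert pow_ne_zero 2 hl0 using 1
    push_cast
    ring

/-- The quotient by the subgroup whose nonzero points lie over the roots of `H`. That these points
form a subgroup is encoded in the differential equation `hode`. -/
lemma standardMap_of_kernelNumerator {a b a' b' τ : F} {H : F[X]} {j : ℕ} (h2 : (2 : F) ≠ 0)
    (hH : H.natDegree = j + 2) (hHp : IsCoprime H (cubic a b)) (hHH : IsCoprime H (derivative H))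
    {N : F[X]} (hN : N = kernelNumerator (cubic a b) H ((2 * (j + 2) + 1 : ℕ) : F) τ)
    (hode : (derivative N * H - 2 * N * derivative H) ^ 2 * cubic a b =
      N ^ 3 + C a' * N * H ^ 4 + C b' * H ^ 6) :
    StandardMap a b a' b' 1 N (H ^ 2) where
  coprime := by
    apply IsCoprime.pow_right
    have hcop : IsCoprime (4 * cubic a b * derivative H ^ 2) H := by
      have h4 : IsUnit (4 : F[X]) := by
        rw [show (4 : F[X]) = C (2 * 2) by rw [C_mul, map_ofNat]; norm_num]
        exact isUnit_C.2 (mul_ne_zero h2 h2).isUnit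
      rw [mul_assoc, isCoprime_mul_unit_left_left h4]
      exact IsCoprime.mul_left hHp.symm hHH.symm.pow_left
    have : N = 4 * cubic a b * derivative H ^ 2 + H * ((C ((2 * (j + 2) + 1 : ℕ) : F) * X + C τ) * H
        - 2 * derivative (cubic a b) * derivative H -
          4 * cubic a b * derivative (derivative H)) := by
      rw [hN, kernelNumerator]
      ring
    rw [this]
    exact hcop.add_mul_left_left _
  degree_lt := by
    rw [natDegree_pow, hN, natDegree_kernelNumerator hH, hH]
    omega
  c_ne_zero := one_ne_zero
  ode := by
    have h1 : quotDeriv N (H ^ 2) = H * (derivative N * H - 2 * N * derivative H) := by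
      rw [quotDeriv, derivative_sq]
      simp only [map_ofNat]
      ring
    rw [h1, one_pow, C_1]
    linear_combination H ^ 2 * hode

end Velu

/-! ### Verification of polynomial identities -/

section Reflection

/-- The value at `s` of the polynomial with the given coefficients, the constant one first. -/
def evalList {R : Type*} [CommRing R] (s : R) (L : List ℤ) : R :=
  L.foldr (fun (a : ℤ) (r : R) => (a : R) + s * r) 0

/-- The value at `(s, x)` of the polynomial in `x` whose coefficients are the given polynomials in
`s`, the constant ones first. -/
def evalList₂ {R : Type*} [CommRing R] (s x : R) (L : List (List ℤ)) : R :=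
  L.foldr (fun (c : List ℤ) (r : R) => evalList s c + x * r) 0

section EvalList

variable {R S : Type*} [CommRing R] [CommRing S] (s x : R)

@[simp] lemma evalList_nil : evalList s [] = 0 := rfl

@[simp] lemma evalList_cons (a : ℤ) (L : List ℤ) :
    evalList s (a :: L) = a + s * evalList s L := rfl

@[simp] lemma evalList₂_nil : evalList₂ s x [] = 0 := rfl

@[simp] lemma evalList₂_cons (c : List ℤ) (L : List (List ℤ)) :
    evalList₂ s x (c :: L) = evalList s c + x * evalList₂ s x L := rfl

lemma map_evalList (σ : R →+* S) (L : List ℤ) : σ (evalList s L) = evalList (σ s) L := by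
  induction L with
  | nil => simp
  | cons a L ih => simp [ih]

lemma map_evalList₂ (σ : R →+* S) (L : List (List ℤ)) :
    σ (evalList₂ s x L) = evalList₂ (σ s) (σ x) L := by
  induction L with
  | nil => simp
  | cons a L ih => simp [ih, map_evalList]

lemma evalList_map_mul (c : ℤ) (L : List ℤ) : evalList s (L.map (c * ·)) = c * evalList s L := by
  induction L with
  | nil => simp
  | cons a L ih => simp [ih]; ring

end EvalList

/-- The coefficients of the derivative with respect to `x`, up to the factor `k` of the
first one. -/
def derivAux (k : ℤ) : List (List ℤ) → List (List ℤ)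
  | [] => []
  | c :: L => c.map (k * ·) :: derivAux (k + 1) L

/-- Polynomial expressions in two variables `s` and `x`. -/
inductive PolyExpr
  | poly (L : List (List ℤ))
  | add (e f : PolyExpr)
  | sub (e f : PolyExpr)
  | mul (e f : PolyExpr)

namespace PolyExpr

instance : Add PolyExpr := ⟨add⟩
instance : Sub PolyExpr := ⟨sub⟩
instance : Mul PolyExpr := ⟨mul⟩

/-- The value of a polynomial expression. -/
def denote {R : Type*} [CommRing R] (s x : R) : PolyExpr → R
  | poly L => evalList₂ s x L
  | add e f => denote s x e + denote s x f
  | sub e f => denote s x e - denote s x f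
  | mul e f => denote s x e * denote s x f

/-- The derivative with respect to `x`. -/
def deriv : PolyExpr → PolyExpr
  | poly L => poly (derivAux 1 L.tail)
  | add e f => deriv e + deriv f
  | sub e f => deriv e - deriv f
  | mul e f => deriv e * f + e * deriv f

/-- The majorant obtained by replacing coefficients by their absolute values and subtractions by
additions. -/
def majorant : PolyExpr → PolyExpr
  | poly L => poly (L.map fun c => c.map fun a => |a|)
  | add e f => majorant e + majorant f
  | sub e f => majorant e + majorant f
  | mul e f => majorant e * majorant f

section Denote

variable {R S : Type*} [CommRing R] [CommRing S] (s x : R)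

@[simp] lemma denote_poly (L : List (List ℤ)) : denote s x (poly L) = evalList₂ s x L := rfl
@[simp] lemma denote_add (e f : PolyExpr) : denote s x (e + f) = denote s x e + denote s x f := rfl
@[simp] lemma denote_sub (e f : PolyExpr) : denote s x (e - f) = denote s x e - denote s x f := rfl
@[simp] lemma denote_mul (e f : PolyExpr) : denote s x (e * f) = denote s x e * denote s x f := rfl

lemma map_denote (σ : R →+* S) (e : PolyExpr) : σ (denote s x e) = denote (σ s) (σ x) e := by
  induction e with
  | poly L => exact map_evalList₂ s x σ L
  | add e f he hf => simp [denote, he, hf]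
  | sub e f he hf => simp [denote, he, hf]
  | mul e f he hf => simp [denote, he, hf]

lemma derivative_evalList (L : List ℤ) : derivative (evalList (C s) L) = 0 := by
  rw [← map_evalList, derivative_C]

lemma evalList₂_derivAux (k : ℤ) (L : List (List ℤ)) :
    evalList₂ (C s) X (derivAux k L) =
      (k : R[X]) * evalList₂ (C s) X L + X * derivative (evalList₂ (C s) X L) := by
  induction L generalizing k with
  | nil => simp [derivAux]
  | cons c L ih =>
    simp only [derivAux, evalList₂_cons, evalList_map_mul, ih, derivative_add, derivative_evalList,
      derivative_mul, derivative_X]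
    push_cast
    ring

lemma derivative_denote (e : PolyExpr) :
    derivative (denote (C s) X e) = denote (C s) X (deriv e) := by
  induction e with
  | poly L =>
    simp only [denote, deriv]
    cases L with
    | nil => simp [derivAux]
    | cons c L =>
      simp only [List.tail_cons, evalList₂_cons, evalList₂_derivAux, derivative_add,
        derivative_evalList, derivative_mul, derivative_X]
      push_cast
      ring
  | add e f he hf => simp [denote, deriv, he, hf]
  | sub e f he hf => simp [denote, deriv, he, hf]
  | mul e f he hf => simp [denote, deriv, he, hf]

end Denote

/-- `Q` bounds the coefficients of `P`. -/
def Dominates (P Q : ℤ[X][X]) : Prop := ∀ j i, |(P.coeff j).coeff i| ≤ (Q.coeff j).coeff i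

namespace Dominates

variable {P P' Q Q' : ℤ[X][X]}

lemma zero : Dominates 0 0 := fun j i => by simp

lemma add (h : Dominates P Q) (h' : Dominates P' Q') : Dominates (P + P') (Q + Q') := fun j i => by
  simp only [coeff_add]
  exact (abs_add_le _ _).trans (add_le_add (h j i) (h' j i))

lemma sub (h : Dominates P Q) (h' : Dominates P' Q') : Dominates (P - P') (Q + Q') := fun j i => by
  simp only [coeff_add, coeff_sub]
  exact (abs_sub _ _).trans (add_le_add (h j i) (h' j i))

lemma mul (h : Dominates P Q) (h' : Dominates P' Q') : Dominates (P * P') (Q * Q') := fun j i => by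
  simp only [coeff_mul, finsetSum_coeff]
  refine (Finset.abs_sum_le_sum_abs _ _).trans (Finset.sum_le_sum fun p _ => ?_)
  refine (Finset.abs_sum_le_sum_abs _ _).trans (Finset.sum_le_sum fun q _ => ?_)
  rw [abs_mul]
  exact mul_le_mul (h _ _) (h' _ _) (abs_nonneg _) ((abs_nonneg _).trans (h _ _))

lemma intCast (a : ℤ) : Dominates (a : ℤ[X][X]) (|a| : ℤ) := fun j i => by
  rw [← map_intCast (C : ℤ[X] →+* ℤ[X][X]), ← map_intCast (C : ℤ[X] →+* ℤ[X][X]), coeff_C, coeff_C]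
  split_ifs
  · rw [← map_intCast (C : ℤ →+* ℤ[X]), ← map_intCast (C : ℤ →+* ℤ[X]), coeff_C, coeff_C]
    split_ifs <;> simp
  · simp

lemma C_X : Dominates (C X) (C X) := fun j i => by
  rw [coeff_C]
  split_ifs
  · rw [coeff_X]; split_ifs <;> simp
  · simp

lemma X : Dominates X X := fun j i => by
  rw [coeff_X]
  split_ifs
  · rw [coeff_one]; split_ifs <;> simp
  · simp

end Dominates

lemma dominates_evalList (L : List ℤ) :
    Dominates (evalList (C X) L) (evalList (C X) (L.map fun a => |a|)) := by
  induction L with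
  | nil => exact .zero
  | cons a L ih => exact (Dominates.intCast a).add (Dominates.C_X.mul ih)

lemma dominates_majorant (e : PolyExpr) :
    Dominates (denote (C X : ℤ[X][X]) X e) (denote (C X : ℤ[X][X]) X (majorant e)) := by
  induction e with
  | poly L =>
    simp only [denote, majorant]
    induction L with
    | nil => exact .zero
    | cons c L ih => exact (dominates_evalList c).add (Dominates.X.mul ih)
  | add e f he hf => exact he.add hf
  | sub e f he hf => exact he.sub hf
  | mul e f he hf => exact he.mul hf

/-- An integer polynomial with a root that exceeds all its coefficients is zero. -/
lemma eq_zero_of_eval_eq_zero {P : ℤ[X]} {S : ℤ} (h : ∀ i, |P.coeff i| < S) (h0 : P.eval S = 0) :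
    P = 0 := by
  have hS : 0 < S := (abs_nonneg _).trans_lt (h 0)
  induction hd : P.natDegree using Nat.strong_induction_on generalizing P with
  | _ m ih =>
    have hP := divX_mul_X_add P
    have h1 : P.divX.eval S * S + P.coeff 0 = 0 := by
      rw [← hP] at h0
      simpa using h0
    have h2 : P.coeff 0 = 0 :=
      Int.eq_zero_of_abs_lt_dvd ⟨-P.divX.eval S, by linear_combination h1⟩ (h 0)
    rw [h2, add_zero, mul_eq_zero, or_iff_left hS.ne'] at h1
    have h3 : P.divX = 0 := by
      rcases Nat.eq_zero_or_pos m with hm | hm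
      · rw [eq_C_of_natDegree_eq_zero (hd.trans hm), divX_C]
      · exact ih P.divX.natDegree (by rw [natDegree_divX_eq_natDegree_tsub_one, hd]; omega)
          (fun i => by rw [coeff_divX]; exact h (i + 1)) h1 rfl
    rw [← hP, h3, h2]
    simp

lemma abs_eval_le {P Q : ℤ[X]} (h : ∀ i, |P.coeff i| ≤ Q.coeff i) {ρ : ℤ} (hρ : 0 ≤ ρ) :
    |P.eval ρ| ≤ Q.eval ρ := by
  have hP : P.natDegree < max P.natDegree Q.natDegree + 1 := by omega
  have hQ : Q.natDegree < max P.natDegree Q.natDegree + 1 := by omega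
  rw [eval_eq_sum_range' hP, eval_eq_sum_range' hQ]
  refine (Finset.abs_sum_le_sum_abs _ _).trans (Finset.sum_le_sum fun i _ => ?_)
  rw [abs_mul, abs_of_nonneg (pow_nonneg hρ i)]
  exact mul_le_mul_of_nonneg_right (h i) (pow_nonneg hρ i)

lemma coeff_le_eval_one {Q : ℤ[X]} (h : ∀ i, 0 ≤ Q.coeff i) (i : ℕ) : Q.coeff i ≤ Q.eval 1 := by
  by_cases hi : i ≤ Q.natDegree
  · rw [eval_eq_sum_range]
    simp only [one_pow, mul_one]
    exact Finset.single_le_sum (f := fun i => Q.coeff i) (fun i _ => h i)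
      (Finset.mem_range.2 (by omega))
  · rw [coeff_eq_zero_of_natDegree_lt (by omega), eval_eq_sum_range]
    simp only [one_pow, mul_one]
    exact Finset.sum_nonneg fun i _ => h i

lemma eval_map_denote (s x : ℤ) (e : PolyExpr) :
    ((denote (C X : ℤ[X][X]) X e).map (evalRingHom s)).eval x = denote s x e := by
  have := map_denote (C X : ℤ[X][X]) X ((evalRingHom x).comp (mapRingHom (evalRingHom s))) e
  simpa using this

/-- Kronecker substitution: the value at `s = 2 ^ a`, `x = 2 ^ b` vanishes, where `2 ^ a` and then
`2 ^ b` are so large that no cancellation between different monomials is possible. -/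
def vanishes (e : PolyExpr) (a b : ℕ) : Bool :=
  decide (denote ((2 ^ a : ℕ) : ℤ) ((2 ^ b : ℕ) : ℤ) e = 0 ∧
    denote 1 1 (majorant e) < ((2 ^ a : ℕ) : ℤ) ∧
    denote ((2 ^ a : ℕ) : ℤ) 1 (majorant e) < ((2 ^ b : ℕ) : ℤ))

/-- A polynomial expression that passes the test `vanishes` is identically zero. -/
theorem denote_eq_zero_of_vanishes {e : PolyExpr} {a b : ℕ} (h : vanishes e a b = true)
    {R : Type*} [CommRing R] (s x : R) : denote s x e = 0 := by
  obtain ⟨h0, h1, h2⟩ := of_decide_eq_true h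
  set A : ℤ := ((2 ^ a : ℕ) : ℤ)
  have hA : 0 ≤ A := Int.natCast_nonneg _
  have hdom := dominates_majorant e
  have hnn : ∀ j i, 0 ≤ ((denote (C X : ℤ[X][X]) X (majorant e)).coeff j).coeff i := fun j i =>
    (abs_nonneg _).trans (hdom j i)
  have hle : ∀ (ρ : ℤ), 0 ≤ ρ → ∀ j,
      ((denote (C X : ℤ[X][X]) X (majorant e)).coeff j).eval ρ ≤ denote ρ 1 (majorant e) :=
    fun ρ hρ j => by
    rw [← eval_map_denote]
    have := coeff_le_eval_one (Q := (denote (C X : ℤ[X][X]) X (majorant e)).map (evalRingHom ρ))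
      (fun i => by
        rw [coeff_map, coe_evalRingHom]
        exact (abs_nonneg _).trans (abs_eval_le (fun l => (abs_of_nonneg (hnn i l)).le) hρ)) j
    rwa [coeff_map, coe_evalRingHom] at this
  -- first the powers of `x` are separated at `s = 2 ^ a`, then those of `s`
  have hG : (denote (C X : ℤ[X][X]) X e).map (evalRingHom A) = 0 := by
    refine eq_zero_of_eval_eq_zero (fun j => ?_) ((eval_map_denote _ _ e).trans h0)
    rw [coeff_map, coe_evalRingHom]
    exact ((abs_eval_le (hdom j) hA).trans (hle A hA j)).trans_lt h2
  have hG' : denote (C X : ℤ[X][X]) X e = 0 := by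
    ext1 j
    rw [coeff_zero]
    refine eq_zero_of_eval_eq_zero (S := A) (fun i => ?_) ?_
    · exact ((hdom j i).trans ((coeff_le_eval_one (hnn j) i).trans
        (hle 1 zero_le_one j))).trans_lt h1
    · have := congrArg (fun P => P.coeff j) hG
      simpa using this
  have := map_denote (C X : ℤ[X][X]) X (eval₂RingHom (eval₂RingHom (Int.castRingHom R) s) x) e
  rw [hG', map_zero] at this
  simpa using this.symm

end PolyExpr

open PolyExpr

/-- The cubic `x³ + a x + b`. -/
def cubicExpr (a b : List ℤ) : PolyExpr := poly [b, a, [], [1]]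

/-- The expression for `kernelNumerator`. -/
def numeratorExpr (p h : PolyExpr) (m : ℤ) (τ : List ℤ) : PolyExpr :=
  poly [τ, [m]] * (h * h) - poly [[2]] * p.deriv * h * h.deriv -
    poly [[4]] * p * (h * h.deriv.deriv - h.deriv * h.deriv)

/-- The expression that vanishes if the numerator `n` satisfies the differential equation. -/
def odeExpr (p h n a' b' : PolyExpr) : PolyExpr :=
  (n.deriv * h - poly [[2]] * n * h.deriv) * (n.deriv * h - poly [[2]] * n * h.deriv) * p -
    n * (n * n + a' * ((h * h) * (h * h))) - b' * ((h * h) * (h * h) * (h * h))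

section Denote

variable {F : Type*} [Field F] (s : F)

lemma denote_cubicExpr (a b : List ℤ) :
    denote (C s) X (cubicExpr a b) = cubic (evalList s a) (evalList s b) := by
  simp only [cubicExpr, denote_poly, evalList₂_cons, evalList₂_nil, cubic, map_evalList,
    evalList_cons, evalList_nil]
  push_cast
  ring

lemma denote_numeratorExpr (p h : PolyExpr) (m : ℤ) (τ : List ℤ) :
    denote (C s) X (numeratorExpr p h m τ) =
      kernelNumerator (denote (C s) X p) (denote (C s) X h) (m : F) (evalList s τ) := by
  simp only [numeratorExpr, kernelNumerator, derivative_denote, denote_sub, denote_mul, denote_poly,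
    evalList₂_cons, evalList₂_nil, map_evalList, evalList_cons, evalList_nil, map_intCast]
  push_cast
  ring

lemma ode_of_vanishes {p h n : PolyExpr} {a' b' : List ℤ} {i j : ℕ}
    (hv : vanishes (odeExpr p h n (poly [a']) (poly [b'])) i j = true) :
    (derivative (denote (C s) X n) * denote (C s) X h -
      2 * denote (C s) X n * derivative (denote (C s) X h)) ^ 2 * denote (C s) X p =
    denote (C s) X n ^ 3 + C (evalList s a') * denote (C s) X n * denote (C s) X h ^ 4 +
      C (evalList s b') * denote (C s) X h ^ 6 := by
  have := denote_eq_zero_of_vanishes hv (C s) X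
  simp only [odeExpr, denote_sub, denote_mul, denote_add, ← derivative_denote, denote_poly,
    evalList₂_cons, evalList₂_nil, map_evalList, evalList_cons, evalList_nil] at this ⊢
  push_cast at this
  linear_combination this

end Denote

end Reflection

/-! ### Isogenies between the curves of a level -/

section Curves

variable {F : Type*} [Field F]

lemma two_ne_zero_of_isElliptic {W : WeierstrassCurve F} [W.IsShortNF] [W.IsElliptic] :
    (2 : F) ≠ 0 := by
  intro h0
  have := W.isUnit_Δ
  rw [Δ_of_isShortNF', show (-16 : F) = -8 * 2 by norm_num, h0, mul_zero, zero_mul] at this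
  exact not_isUnit_zero this

lemma disc_ne_zero_of_isElliptic {W : WeierstrassCurve F} [W.IsShortNF] [W.IsElliptic] :
    4 * W.a₄ ^ 3 + 27 * W.a₆ ^ 2 ≠ 0 := by
  intro h0
  have := W.isUnit_Δ
  rw [Δ_of_isShortNF', h0, mul_zero] at this
  exact not_isUnit_zero this

instance (n i : ℕ) (t d : F) : (curve n i t d).IsShortNF := ⟨rfl, rfl, rfl⟩

variable {n k l : ℕ} {t d : F}

/-- An isogeny of degree two onto a model of the quotient by `(d α, 0)` that is scaled by `κ`. -/
theorem exists_isogeny_two [(curve n k t d).IsElliptic] [(curve n l t d).IsElliptic]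
    {α κ : F} (hκ : κ ≠ 0)
    (hα : α ^ 3 + coeffA n k t * α + coeffB n k t = 0)
    (hA : coeffA n l t = κ ^ 4 * (coeffA n k t - 5 * (3 * α ^ 2 + coeffA n k t)))
    (hB : coeffB n l t = κ ^ 6 * (coeffB n k t - 7 * α * (3 * α ^ 2 + coeffA n k t))) :
    ∃ ψ : Isogeny (curve n k t d) (curve n l t d),
      ψ.HasCyclicKernel 2 ∧ ψ.HasStandardForm 2 κ := by
  have hα' : (d * α) ^ 3 + (curve n k t d).a₄ * (d * α) + (curve n k t d).a₆ = 0 := by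
    simp only [curve]
    linear_combination d ^ 3 * hα
  have h := (standardMap_two disc_ne_zero_of_isElliptic hα' rfl rfl).scale_target hκ
  rw [mul_one] at h
  have h1 : κ ^ 4 * ((curve n k t d).a₄ - 5 * (3 * (d * α) ^ 2 + (curve n k t d).a₄)) =
      (curve n l t d).a₄ := by
    simp only [curve, hA]
    ring
  have h2 : κ ^ 6 * ((curve n k t d).a₆ - 7 * (d * α) * (3 * (d * α) ^ 2 + (curve n k t d).a₄)) =
      (curve n l t d).a₆ := by
    simp only [curve, hB]
    ring
  rw [h1, h2] at h
  have hN : (C (κ ^ 2) * (X * (X - C (d * α)) + C (3 * (d * α) ^ 2 + (curve n k t d).a₄)) :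
      F[X]).natDegree = 2 := by
    rw [natDegree_C_mul (pow_ne_zero 2 hκ)]
    compute_degree!
  have := h.exists_isogeny_of_root hN (by simpa [cubic] using hα')
  rwa [hN] at this

/-- An isogeny of odd degree between curves that are twists by `e` of the source and target of a map
in standard form. -/
theorem exists_isogeny_of_standardMap {a b a' b' e : F} {N H : F[X]} (he : e ≠ 0)
    [(curve n k t d).IsElliptic] [(curve n l t d).IsElliptic]
    (h : StandardMap a b a' b' 1 N (H ^ 2))
    (ha : (curve n k t d).a₄ = e ^ 2 * a) (hb : (curve n k t d).a₆ = e ^ 3 * b)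
    (ha' : (curve n l t d).a₄ = e ^ 2 * a') (hb' : (curve n l t d).a₆ = e ^ 3 * b')
    (hN : N.natDegree = 2 * H.natDegree + 1) (hp : N.natDegree.Prime) :
    ∃ ψ : Isogeny (curve n k t d) (curve n l t d),
      ψ.HasCyclicKernel N.natDegree ∧ ψ.HasStandardForm N.natDegree 1 := by
  have h1 := h.twist he
  rw [← ha, ← hb, ← ha', ← hb', pow_comp] at h1
  have d1 : (C e * N.comp (C e⁻¹ * X)).natDegree = N.natDegree := by
    rw [natDegree_C_mul he, natDegree_comp, natDegree_C_mul_X _ (inv_ne_zero he), mul_one]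
  have d2 : (H.comp (C e⁻¹ * X)).natDegree = H.natDegree := by
    rw [natDegree_comp, natDegree_C_mul_X _ (inv_ne_zero he), mul_one]
  have := h1.exists_isogeny_of_sq (by rw [d1, d2, hN]) (by rwa [d1])
  rwa [d1] at this

/-- An isogeny of degree three onto the quotient by the points with abscissa `d α`. -/
theorem exists_isogeny_three (hd : d ≠ 0) [(curve n k t d).IsElliptic]
    [(curve n l t d).IsElliptic] {α : F}
    (hα : 12 * α * (α ^ 3 + coeffA n k t * α + coeffB n k t) = (3 * α ^ 2 + coeffA n k t) ^ 2)
    (hA : coeffA n l t = coeffA n k t - 10 * (3 * α ^ 2 + coeffA n k t))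
    (hB : coeffB n l t = coeffB n k t - 28 * (α ^ 3 + coeffA n k t * α + coeffB n k t) -
      14 * α * (3 * α ^ 2 + coeffA n k t)) :
    ∃ ψ : Isogeny (curve n k t d) (curve n l t d),
      ψ.HasCyclicKernel 3 ∧ ψ.HasStandardForm 3 1 := by
  have hΔ : 4 * coeffA n k t ^ 3 + 27 * coeffB n k t ^ 2 ≠ 0 := fun h0 =>
    disc_ne_zero_of_isElliptic (W := curve n k t d) (by
      simp only [curve]
      linear_combination d ^ 6 * h0)
  have h := standardMap_three (two_ne_zero_of_isElliptic (W := curve n k t d)) hΔ hα hA hB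
  have hN : ((X * (X - C α) + C (2 * (3 * α ^ 2 + coeffA n k t))) * (X - C α) +
      C (4 * (α ^ 3 + coeffA n k t * α + coeffB n k t)) : F[X]).natDegree = 3 := by
    compute_degree!
  have := exists_isogeny_of_standardMap (n := n) (k := k) (l := l) (t := t) hd h rfl rfl rfl rfl
    (by rw [hN, natDegree_X_sub_C]) (by rw [hN]; exact Nat.prime_three)
  rwa [hN] at this

end Curves

section Specialization

/-- Two polynomials over `K[s]` that stay coprime at `s = 0`, without a drop of their degrees, are
coprime over every field in which `s` is transcendental over `K`. -/
lemma isCoprime_of_specialization {K F : Type*} [Field K] [Field F] [Algebra K F] {s : F}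
    (hs : Transcendental K s) {f g : K[X][X]}
    (hf : (f.map (evalRingHom 0)).natDegree = f.natDegree)
    (hg : (g.map (evalRingHom 0)).natDegree = g.natDegree) (hf0 : f.natDegree ≠ 0)
    (h : IsCoprime (f.map (evalRingHom 0)) (g.map (evalRingHom 0))) :
    IsCoprime (f.map (aeval s : K[X] →ₐ[K] F).toRingHom)
      (g.map (aeval s : K[X] →ₐ[K] F).toRingHom) := by
  have hinj : Function.Injective (aeval s : K[X] →ₐ[K] F).toRingHom :=
    transcendental_iff_injective.1 hs
  have h1 := resultant_ne_zero _ _ h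
  rw [hf, hg, resultant_map_map] at h1
  have h2 : resultant f g ≠ 0 := fun h0 => h1 (by rw [h0, map_zero])
  have h3 := (map_ne_zero_iff _ hinj).2 h2
  rw [← resultant_map_map] at h3
  have e1 := natDegree_map_eq_of_injective hinj f
  have e2 := natDegree_map_eq_of_injective hinj g
  rw [← e1, ← e2] at h3
  by_contra hcon
  apply h3
  rw [resultant_eq_zero_iff]
  exact ⟨Or.inl fun h0 => hf0 (by rw [← e1, h0, natDegree_zero]), hcon⟩

lemma isCoprime_of_bezout {K : Type*} [Field K] {f g : K[X]} (u v : K[X]) {r : K} (hr : r ≠ 0)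
    (h : u * f + v * g = C r) : IsCoprime f g := by
  refine ⟨C r⁻¹ * u, C r⁻¹ * v, ?_⟩
  calc _ = C r⁻¹ * (u * f + v * g) := by ring
    _ = 1 := by rw [h, ← C_mul, inv_mul_cancel₀ hr, C_1]

/-- The degree in `x`, if the leading coefficient is a nonzero constant. -/
lemma natDegree_evalList₂ {R : Type*} [CommRing R] [IsDomain R] (s : R) {L : List (List ℤ)} {m : ℤ}
    (hL : L.getLast? = some [m]) (hm : (m : R) ≠ 0) :
    (evalList₂ (C s) X L).natDegree = L.length - 1 ∧ evalList₂ (C s) X L ≠ 0 := by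
  induction L with
  | nil => simp at hL
  | cons c L ih =>
    cases L with
    | nil =>
      simp only [List.getLast?_singleton, Option.some.injEq] at hL
      subst hL
      have : evalList₂ (C s) X [[m]] = C (m : R) := by simp
      rw [this]
      exact ⟨natDegree_C _, C_ne_zero.2 hm⟩
    | cons c' L =>
      rw [List.getLast?_cons_cons] at hL
      obtain ⟨h1, h2⟩ := ih hL
      have h3 : (evalList₂ (C s) X (c :: c' :: L)).natDegree = (c :: c' :: L).length - 1 := by
        rw [evalList₂_cons, ← map_evalList, natDegree_C_add, natDegree_X_mul h2, h1]
        simp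
      refine ⟨h3, fun h0 => ?_⟩
      rw [h0] at h3
      simp at h3

variable (K : Type*) [Field K]

lemma transcendental_tVar_inv : Transcendental K (tVar K)⁻¹ := by
  have h1 : Transcendental K (tVar K) := by
    rw [tVar, transcendental_algebraMap_iff (IsFractionRing.injective _ _)]
    exact MvPolynomial.transcendental_X _ _
  intro h
  exact h1 (IsAlgebraic.inv_iff.1 h)

lemma tVar_ne_zero : tVar K ≠ 0 := by
  rw [tVar, map_ne_zero_iff _ (IsFractionRing.injective _ _)]
  exact MvPolynomial.X_ne_zero 0

lemma dVar_ne_zero : dVar K ≠ 0 := by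
  rw [dVar, map_ne_zero_iff _ (IsFractionRing.injective _ _)]
  exact MvPolynomial.X_ne_zero 1

variable {K}

open PolyExpr

/-- The isogeny of odd prime degree with kernel polynomial `h`. With `s = t⁻¹` and the twist by
`d t ^ w`, all the data become polynomials in `s`, and the separability conditions may be checked at
the cusp `s = 0`. -/
theorem exists_isogeny_of_kernelPolynomial {n k l w j p q : ℕ} {d : RatFunc₂ K} (hd : d ≠ 0)
    [(curve n k (tVar K) d).IsElliptic] [(curve n l (tVar K) d).IsElliptic]
    {a b a' b' τ : List ℤ} {h : List (List ℤ)}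
    (ha : coeffA n k (tVar K) = tVar K ^ (2 * w) * evalList (tVar K)⁻¹ a)
    (hb : coeffB n k (tVar K) = tVar K ^ (3 * w) * evalList (tVar K)⁻¹ b)
    (ha' : coeffA n l (tVar K) = tVar K ^ (2 * w) * evalList (tVar K)⁻¹ a')
    (hb' : coeffB n l (tVar K) = tVar K ^ (3 * w) * evalList (tVar K)⁻¹ b')
    (hlen : h.length = j + 3) (hlast : h.getLast? = some [((2 * (j + 2) + 1 : ℕ) : ℤ)])
    {m : ℤ} (hlast' : (derivAux 1 h.tail).getLast? = some [m]) (hm : (m : K) ≠ 0)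
    (hm' : ((2 * (j + 2) + 1 : ℕ) : K) ≠ 0) (hp : (2 * (j + 2) + 1).Prime)
    (hv : vanishes (odeExpr (cubicExpr a b) (poly h) (numeratorExpr (cubicExpr a b) (poly h)
      ((2 * (j + 2) + 1 : ℕ) : ℤ) τ) (poly [a']) (poly [b'])) p q = true)
    (hcop : IsCoprime (evalList₂ 0 X h : K[X]) (evalList₂ 0 X [b, a, [], [1]]))
    (hcop' : IsCoprime (evalList₂ 0 X h : K[X]) (evalList₂ 0 X (derivAux 1 h.tail))) :
    ∃ ψ : Isogeny (curve n k (tVar K) d) (curve n l (tVar K) d),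
      ψ.HasCyclicKernel (2 * (j + 2) + 1) ∧ ψ.HasStandardForm (2 * (j + 2) + 1) 1 := by
  set t := tVar K with ht
  have ht0 : t ≠ 0 := tVar_ne_zero K
  have hs : Transcendental K t⁻¹ := transcendental_tVar_inv K
  -- coprimality at `s = 0` implies coprimality, since `s` is transcendental over `K`
  have key : ∀ (L M : List (List ℤ)) (u v : ℤ), L.getLast? = some [u] → M.getLast? = some [v] →
      (u : K) ≠ 0 → (v : K) ≠ 0 → L.length - 1 ≠ 0 →
      IsCoprime (evalList₂ 0 X L : K[X]) (evalList₂ 0 X M) →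
      IsCoprime (evalList₂ (C t⁻¹) X L) (evalList₂ (C t⁻¹) X M) := by
    intro L M u v hL hM hu hv hL0 hc
    have hu' : (u : K[X]) ≠ 0 := by
      rw [← map_intCast (C : K →+* K[X])]
      exact C_ne_zero.2 hu
    have hv' : (v : K[X]) ≠ 0 := by
      rw [← map_intCast (C : K →+* K[X])]
      exact C_ne_zero.2 hv
    have e0 : ∀ L : List (List ℤ), (evalList₂ (C (X : K[X])) X L).map (evalRingHom 0) =
        evalList₂ (C 0) X L := fun L => by
      have := map_evalList₂ (C (X : K[X])) X (mapRingHom (evalRingHom (0 : K))) L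
      simpa using this
    have e1 : ∀ L : List (List ℤ), (evalList₂ (C (X : K[X])) X L).map
        (aeval t⁻¹ : K[X] →ₐ[K] RatFunc₂ K).toRingHom = evalList₂ (C t⁻¹) X L := fun L => by
      have := map_evalList₂ (C (X : K[X])) X
        (mapRingHom (aeval t⁻¹ : K[X] →ₐ[K] RatFunc₂ K).toRingHom) L
      simpa using this
    rw [← e1, ← e1]
    apply isCoprime_of_specialization hs
    · rw [e0, (natDegree_evalList₂ 0 hL hu).1, (natDegree_evalList₂ X hL hu').1]
    · rw [e0, (natDegree_evalList₂ 0 hM hv).1, (natDegree_evalList₂ X hM hv').1]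
    · rwa [(natDegree_evalList₂ X hL hu').1]
    · rw [e0, e0, C_0]
      exact hc
  have hl1 : h.length - 1 ≠ 0 := by omega
  have hmK : (((2 * (j + 2) + 1 : ℕ) : ℤ) : K) ≠ 0 := by rwa [Int.cast_natCast]
  have hmF : (((2 * (j + 2) + 1 : ℕ) : ℤ) : RatFunc₂ K) ≠ 0 := by
    rw [← map_intCast (algebraMap K (RatFunc₂ K))]
    exact (_root_.map_ne_zero _).2 hmK
  have c1 := key h [b, a, [], [1]] _ 1 hlast rfl hmK (by simp) hl1 hcop
  have c2 := key h _ _ m hlast hlast' hmK hm hl1 hcop'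
  have hdeg := (natDegree_evalList₂ t⁻¹ hlast hmF).1
  rw [hlen, show j + 3 - 1 = j + 2 by omega] at hdeg
  have f1 : evalList₂ (C t⁻¹) X [b, a, [], [1]] = cubic (evalList t⁻¹ a) (evalList t⁻¹ b) :=
    denote_cubicExpr t⁻¹ a b
  have f2 : evalList₂ (C t⁻¹) X (derivAux 1 h.tail) = derivative (evalList₂ (C t⁻¹) X h) :=
    (derivative_denote t⁻¹ (poly h)).symm
  rw [f1] at c1
  rw [f2] at c2
  have hode := ode_of_vanishes t⁻¹ hv
  have hN := denote_numeratorExpr t⁻¹ (cubicExpr a b) (poly h) ((2 * (j + 2) + 1 : ℕ) : ℤ) τ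
  rw [denote_cubicExpr] at hN hode
  rw [Int.cast_natCast] at hN
  have hmap := standardMap_of_kernelNumerator
    (two_ne_zero_of_isElliptic (W := curve n k t d)) hdeg c1 c2 hN hode
  have hNdeg := natDegree_kernelNumerator (a := evalList t⁻¹ a) (b := evalList t⁻¹ b)
    (τ := evalList t⁻¹ τ) hdeg
  rw [denote_poly] at hN
  rw [← hN] at hNdeg
  have := exists_isogeny_of_standardMap (n := n) (k := k) (l := l) (t := t) (d := d)
    (e := d * t ^ w) (mul_ne_zero hd (pow_ne_zero _ ht0)) hmap
    (by simp only [curve, ha]; ring) (by simp only [curve, hb]; ring)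
    (by simp only [curve, ha']; ring) (by simp only [curve, hb']; ring)
    (by rw [hNdeg, hdeg]) (by rwa [hNdeg])
  rwa [hNdeg] at this

end Specialization

/-! ### Discriminants and isomorphism classes -/

section Tables

/-- The constant factor and the coefficients of `𝒜_{n,i}`, the leading one first. -/
def dataA (n i : ℕ) : ℤ × List ℤ :=
  match n, i with
  | 2, 1 => (-27, [1, 320, 16384])
  | 2, 2 => (-432, [1, 80, 1024])
  | 3, 1 => (-3, [1, 270, 6561])
  | 3, 2 => (-243, [1, 30, 81])
  | 4, 1 => (-432, [1, 16, 256])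
  | 4, 2 => (-6912, [1, 16, 16])
  | 4, 3 => (-432, [1, -224, 256])
  | 4, 4 => (-27, [1, 256, 4096])
  | 5, 1 => (-27, [1, 272, 8750, 100000, 390625])
  | 5, 2 => (-16875, [1, 32, 350, 1360, 625])
  | 6, 1 => (-3, [1, 264, 6912, 62208, 186624])
  | 6, 2 => (-48, [1, 24, 432, 3888, 11664])
  | 6, 3 => (-243, [1, 24, 192, 768, 2304])
  | 6, 4 => (-3888, [1, 24, 192, 528, 144])
  | 7, 1 => (-27, [1, 258, 5635, 43218, 117649])
  | 7, 2 => (-64827, [1, 18, 115, 258, 49])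
  | 8, 1 => (-432, [1, 0, 224, 0, 256])
  | 8, 2 => (-432, [1, -240, 2144, -3840, 256])
  | 8, 3 => (-27, [1, 240, 2144, 3840, 256])
  | 8, 4 => (-6912, [1, 0, -16, 0, 256])
  | 8, 5 => (-6912, [1, 0, -256, 0, 4096])
  | 8, 6 => (-110592, [1, 0, -16, 0, 16])
  | 9, 1 => (-3, [1, 240, 2160, 6696, 12960])
  | 9, 2 => (-243, [1, 0, 0, 216, 0])
  | 9, 3 => (-19683, [1, 0, 0, -24, 0])
  | 10, 1 => (-27, [1, 236, 1444, 2864, 9600, 7936, 15616, 1024, 1024])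
  | 10, 2 => (-432, [1, -4, 244, -496, 2400, -2864, 5776, -3776, 64])
  | 10, 3 => (-16875, [1, -4, 4, -16, 0, 256, 256, 1024, 1024])
  | 10, 4 => (-270000, [1, -4, 4, -16, 0, 16, 16, 64, 64])
  | 12, 1 => (-48, [1, 0, 228, 0, 270, 0, -972, 0, 729])
  | 12, 2 => (-3888, [1, 0, -12, 0, 30, 0, 228, 0, 9])
  | 12, 3 => (-768, [1, 0, -12, 0, 270, 0, -972, 0, 729])
  | 12, 4 => (-62208, [1, 0, -12, 0, 30, 0, -12, 0, 9])
  | 12, 5 => (-3, [1, 240, 2148, 4320, 270, -6480, -972, 0, 729])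
  | 12, 6 => (-243, [1, 0, -12, 240, 30, -1440, 2148, -720, 9])
  | 12, 7 => (-48, [1, -240, 2148, -4320, 270, 6480, -972, 0, 729])
  | 12, 8 => (-3888, [1, 0, -12, -240, 30, 1440, 2148, 720, 9])
  | 13, 1 => (-27, [1, 258, 6153, 66534, 422500, 1700478, 4369833, 6683274, 4826809])
  | 13, 2 => (-771147, [1, 18, 153, 774, 2500, 5118, 6153, 3354, 169])
  | 16, 1 => (-432, [1, 0, 240, 0, 2144, 0, 3840, 0, 256])
  | 16, 2 => (-27, [1, 240, 2160, 6720, 17504, 26880, 34560, 15360, 256])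
  | 16, 3 => (-432, [1, -240, 2160, -6720, 17504, -26880, 34560, -15360, 256])
  | 16, 4 => (-6912, [1, 0, 0, 0, 224, 0, 0, 0, 256])
  | 16, 5 => (-6912, [1, 0, -240, 0, 2144, 0, -3840, 0, 256])
  | 16, 6 => (-110592, [1, 0, 0, 0, -16, 0, 0, 0, 256])
  | 16, 7 => (-110592, [1, 0, 0, 0, -256, 0, 0, 0, 4096])
  | 16, 8 => (-1769472, [1, 0, 0, 0, -16, 0, 0, 0, 16])
  | 18, 1 => (-3, [1, 240, 2160, 6712, 15840, 17280, 26880, 11520, 34560, 256, 15360, 0, 256])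
  | 18, 2 => (-48, [1, 0, 240, -8, 2160, -1440, 6720, -8640, 15840, -13424, 8640, -1920, 16])
  | 18, 3 => (-243, [1, 0, 0, 232, 0, 0, 960, 0, 0, 256, 0, 0, 256])
  | 18, 4 => (-3888, [1, 0, 0, -8, 0, 0, 240, 0, 0, -464, 0, 0, 16])
  | 18, 5 => (-19683, [1, 0, 0, -8, 0, 0, 0, 0, 0, 256, 0, 0, 256])
  | 18, 6 => (-314928, [1, 0, 0, -8, 0, 0, 0, 0, 0, 16, 0, 0, 16])
  | 25, 1 =>
    (-27, [1, 240, 2174, 9840, 43515, 119268, 345550, 648372, 1328385, 1678260, 2389556,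
    1698960, 1501504])
  | 25, 2 => (-16875, [1, 0, 14, 0, 75, 228, 190, 2052, 225, 5700, 596, 4560, 1984])
  | 25, 3 => (-10546875, [1, 0, 14, 0, 75, -12, 190, -108, 225, -300, 116, -240, 64])
  | _, _ => (0, [])

/-- The constant factor and the coefficients of `ℬ_{n,i}`, the leading one first. -/
def dataB (n i : ℕ) : ℤ × List ℤ :=
  match n, i with
  | 2, 1 => (54, [1, -384, -61440, -2097152])
  | 2, 2 => (3456, [1, 120, 3072, -32768])
  | 3, 1 => (-2, [1, -459, -32805, -531441])
  | 3, 2 => (-1458, [1, 45, 459, -729])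
  | 4, 1 => (3456, [1, 24, -384, -4096])
  | 4, 2 => (221184, [1, 24, 120, -64])
  | 4, 3 => (3456, [1, 528, -8448, -4096])
  | 4, 4 => (54, [1, -480, -24576, -262144])
  | 5, 1 => (54, [1, -456, -36891, -1049000, -14203125, -93750000, -244140625])
  | 5, 2 => (843750, [1, 48, 909, 8392, 36891, 57000, -15625])
  | 6, 1 => (-2, [1, -468, -31752, -730944, -7838208, -40310784, -80621568])
  | 6, 2 => (-128, [1, 36, 0, -9720, -122472, -629856, -1259712])
  | 6, 3 => (-1458, [1, 36, 504, 2880, 0, -55296, -110592])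
  | 6, 4 => (-93312, [1, 36, 504, 3384, 10584, 11232, -1728])
  | 7, 1 => (54, [1, -477, -27930, -540225, -4941258, -22235661, -40353607])
  | 7, 2 => (6353046, [1, 27, 294, 1575, 3990, 3339, -343])
  | 8, 1 => (3456, [1, 0, -528, 0, -8448, 0, 4096])
  | 8, 2 => (3456, [1, 504, -16656, 112896, -266496, 129024, 4096])
  | 8, 3 => (54, [1, -504, -16656, -112896, -266496, -129024, 4096])
  | 8, 4 => (221184, [1, 0, -24, 0, -384, 0, 4096])
  | 8, 5 => (221184, [1, 0, 480, 0, -24576, 0, 262144])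
  | 8, 6 => (14155776, [1, 0, -24, 0, 120, 0, 64])
  | 9, 1 => (-2, [1, -504, -16632, -123012, -517104, -1143072, -1475496])
  | 9, 2 => (-1458, [1, 0, 0, -540, 0, 0, -5832])
  | 9, 3 => (-1062882, [1, 0, 0, -36, 0, 0, 216])
  | 10, 1 =>
    (54, [1, -510, -14100, -60512, -233808, -524640, -1257408, -1420032, -2445312, -1015808,
    -1007616, 49152, 32768])
  | 10, 2 =>
    (3456, [1, -6, -492, 1984, -19104, 44376, -157176, 262320, -467616, 484096, -451200, 65280,
    512])
  | 10, 3 => (843750, [1, -6, 12, -32, 48, -480, 576, -768, 6144, 16384, 24576, 49152, 32768])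
  | 10, 4 => (54000000, [1, -6, 12, -32, 48, 24, 72, 240, 96, 256, 384, 768, 512])
  | 12, 1 => (-128, [1, 0, -522, 0, -9477, 0, 18468, 0, -24057, 0, 39366, 0, -19683])
  | 12, 2 => (-93312, [1, 0, -18, 0, 99, 0, -684, 0, 3159, 0, 1566, 0, -27])
  | 12, 3 => (-8192, [1, 0, -18, 0, -405, 0, 4860, 0, -24057, 0, 39366, 0, -19683])
  | 12, 4 => (-5971968, [1, 0, -18, 0, 99, 0, -180, 0, 135, 0, 54, 0, -27])
  | 12, 5 =>
    (-2, [1, -504, -16650, -114912, -299781, -136080, 453924, 489888, -24057, -367416, 39366, 0,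
    -19683])
  | 12, 6 =>
    (-1458, [1, 0, -18, -504, 99, 6048, -16812, -15120, 99927, -114912, 49950, -4536, -27])
  | 12, 7 =>
    (-128, [1, 504, -16650, 114912, -299781, 136080, 453924, -489888, -24057, 367416, 39366, 0,
    -19683])
  | 12, 8 => (-93312, [1, 0, -18, 504, 99, -6048, -16812, 15120, 99927, 114912, 49950, 4536, -27])
  | 13, 1 =>
    (54, [1, -477, -28881, -653850, -8436441, -71768385, -430497756, -1877228847, -5993782899,
    -13814327358, -22024729467, -22024729467, -10604499373])
  | 13, 2 =>
    (260647686, [1, 27, 351, 2862, 16143, 65727, 195948, 424665, 648957, 653850, 375453, 80613,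
    -2197])
  | 16, 1 => (3456, [1, 0, -504, 0, -16656, 0, -112896, 0, -266496, 0, -129024, 0, 4096])
  | 16, 2 =>
    (54, [1, -504, -16632, -122976, -532752, -1564416, -3725568, -6257664, -8524032, -7870464,
    -4257792, -516096, 4096])
  | 16, 3 =>
    (3456, [1, 504, -16632, 122976, -532752, 1564416, -3725568, 6257664, -8524032, 7870464,
    -4257792, 516096, 4096])
  | 16, 4 => (221184, [1, 0, 0, 0, -528, 0, 0, 0, -8448, 0, 0, 0, 4096])
  | 16, 5 => (221184, [1, 0, 504, 0, -16656, 0, 112896, 0, -266496, 0, 129024, 0, 4096])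
  | 16, 6 => (14155776, [1, 0, 0, 0, -24, 0, 0, 0, -384, 0, 0, 0, 4096])
  | 16, 7 => (14155776, [1, 0, 0, 0, 480, 0, 0, 0, -24576, 0, 0, 0, 262144])
  | 16, 8 => (905969664, [1, 0, 0, 0, -24, 0, 0, 0, 120, 0, 0, 0, 64])
  | 18, 1 =>
    (-2, [1, -504, -16632, -122988, -527184, -1409184, -2951400, -4217472, -6168960, -5903296,
    -8596224, -4257792, -7868928, -645120, -4257792, 6144, -516096, 0, 4096])
  | 18, 2 =>
    (-128, [1, 0, -504, -12, -16632, 5040, -122952, 133056, -537264, 737912, -1542240, 2108736,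
    -2951400, 2818368, -2108736, 983904, -266112, 16128, 64])
  | 18, 3 =>
    (-1458, [1, 0, 0, -516, 0, 0, -12072, 0, 0, -24640, 0, 0, -30720, 0, 0, 6144, 0, 0, 4096])
  | 18, 4 => (-93312, [1, 0, 0, -12, 0, 0, -480, 0, 0, 3080, 0, 0, -12072, 0, 0, 4128, 0, 0, 64])
  | 18, 5 => (-1062882, [1, 0, 0, -12, 0, 0, 24, 0, 0, -448, 0, 0, 1536, 0, 0, 6144, 0, 0, 4096])
  | 18, 6 => (-68024448, [1, 0, 0, -12, 0, 0, 24, 0, 0, 56, 0, 0, 24, 0, 0, 96, 0, 0, 64])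
  | 25, 1 =>
    (54, [1, -504, -16611, -133056, -848550, -3873258, -15583283, -50025312, -148053462,
    -359395650, -820470687, -1538388072, -2734681643, -3903040458, -5302026300, -5402959056,
    -5275448016, -3122753184, -1839881024])
  | 25, 2 =>
    (843750, [1, 0, 21, 0, 186, -522, 901, -8352, 2586, -52722, -5559, -164952, -105659,
    -261522, -407964, -187920, -559824, -41760, -160064])
  | 25, 3 =>
    (13183593750, [1, 0, 21, 0, 186, -18, 901, -288, 2586, -1818, 4521, -5688, 5221, -9018,
    5316, -6480, 4656, -1440, 1216])
  | _, _ => (0, [])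

/-- The weight `w` of the level: `𝒜_{n,i}` has degree `2 w` and `ℬ_{n,i}` has degree `3 w`. -/
def weight (n : ℕ) : ℕ :=
  match n with
  | 2 | 3 | 4 => 1
  | 5 | 6 | 7 | 8 | 9 => 2
  | 10 | 12 | 13 | 16 => 4
  | _ => 6

/-- The coefficients of `t ^ (-2 w) 𝒜_{n,i}(t)` as a polynomial in `t⁻¹`, the constant one first. -/
def listA (n i : ℕ) : List ℤ := (dataA n i).2.map ((dataA n i).1 * ·)

/-- The coefficients of `t ^ (-3 w) ℬ_{n,i}(t)` as a polynomial in `t⁻¹`, the constant one first. -/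
def listB (n i : ℕ) : List ℤ := (dataB n i).2.map ((dataB n i).1 * ·)

set_option maxHeartbeats 2000000 in
lemma coeffA_eq_horner {F : Type*} [Field F] {n i : ℕ} (hn : n ∈ genusZeroLevels)
    (hi : i ∈ Finset.Icc 1 (numCurves n)) (t : F) :
    coeffA n i t = (dataA n i).1 * horner t (dataA n i).2 := by
  simp only [genusZeroLevels, Finset.mem_insert, Finset.mem_singleton] at hn
  rcases hn with rfl | rfl | rfl | rfl | rfl | rfl | rfl | rfl | rfl | rfl | rfl | rfl | rfl | rfl
  all_goals
    obtain ⟨h1, h2⟩ := Finset.mem_Icc.1 hi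
    simp only [numCurves] at h2
    interval_cases i
  all_goals
    refine congrArg (· * horner t _) ?_
    simp [dataA]

set_option maxHeartbeats 2000000 in
lemma coeffB_eq_horner {F : Type*} [Field F] {n i : ℕ} (hn : n ∈ genusZeroLevels)
    (hi : i ∈ Finset.Icc 1 (numCurves n)) (t : F) :
    coeffB n i t = (dataB n i).1 * horner t (dataB n i).2 := by
  simp only [genusZeroLevels, Finset.mem_insert, Finset.mem_singleton] at hn
  rcases hn with rfl | rfl | rfl | rfl | rfl | rfl | rfl | rfl | rfl | rfl | rfl | rfl | rfl | rfl
  all_goals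
    obtain ⟨h1, h2⟩ := Finset.mem_Icc.1 hi
    simp only [numCurves] at h2
    interval_cases i
  all_goals
    refine congrArg (· * horner t _) ?_
    simp [dataB]

lemma length_data : ∀ n ∈ genusZeroLevels, ∀ i ∈ Finset.Icc 1 (numCurves n),
    (dataA n i).2.length = 2 * weight n + 1 ∧ (dataB n i).2.length = 3 * weight n + 1 := by
  decide +kernel

lemma foldl_horner {R : Type*} [CommRing R] (t : R) (L : List ℤ) (r : R) :
    L.foldl (fun (s : R) (a : ℤ) => s * t + (a : R)) r = r * t ^ L.length + horner t L := by
  induction L generalizing r with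
  | nil => simp [horner]
  | cons a L ih =>
    rw [horner, List.foldl_cons, List.foldl_cons, ih, ih (0 * t + (a : R)), List.length_cons]
    ring

lemma mul_horner {F : Type*} [Field F] {t : F} (ht : t ≠ 0) (L : List ℤ) :
    t * horner t L = t ^ L.length * evalList t⁻¹ L := by
  induction L with
  | nil => simp [horner]
  | cons a L ih =>
    rw [horner, List.foldl_cons, foldl_horner, mul_add, ih, evalList_cons, List.length_cons]
    field_simp
    ring

lemma coeffA_eq {F : Type*} [Field F] {n i : ℕ} (hn : n ∈ genusZeroLevels)
    (hi : i ∈ Finset.Icc 1 (numCurves n)) {t : F} (ht : t ≠ 0) :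
    coeffA n i t = t ^ (2 * weight n) * evalList t⁻¹ (listA n i) := by
  have h1 := mul_horner ht (dataA n i).2
  rw [(length_data n hn i hi).1, pow_succ'] at h1
  rw [coeffA_eq_horner hn hi, listA, evalList_map_mul]
  apply mul_left_cancel₀ ht
  linear_combination ((dataA n i).1 : F) * h1

lemma coeffB_eq {F : Type*} [Field F] {n i : ℕ} (hn : n ∈ genusZeroLevels)
    (hi : i ∈ Finset.Icc 1 (numCurves n)) {t : F} (ht : t ≠ 0) :
    coeffB n i t = t ^ (3 * weight n) * evalList t⁻¹ (listB n i) := by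
  have h1 := mul_horner ht (dataB n i).2
  rw [(length_data n hn i hi).2, pow_succ'] at h1
  rw [coeffB_eq_horner hn hi, listB, evalList_map_mul]
  apply mul_left_cancel₀ ht
  linear_combination ((dataB n i).1 : F) * h1

/-- The sum of two polynomials given by their coefficients. -/
def listAdd : List ℤ → List ℤ → List ℤ
  | [], M => M
  | L, [] => L
  | a :: L, b :: M => (a + b) :: listAdd L M

/-- The product of two polynomials given by their coefficients. -/
def listMul : List ℤ → List ℤ → List ℤ
  | [], _ => []
  | a :: L, M => listAdd (M.map (a * ·)) (0 :: listMul L M)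

lemma evalList_listAdd {R : Type*} [CommRing R] (s : R) (L M : List ℤ) :
    evalList s (listAdd L M) = evalList s L + evalList s M := by
  induction L generalizing M with
  | nil => simp [listAdd]
  | cons a L ih =>
    cases M with
    | nil => simp [listAdd]
    | cons b M => simp [listAdd, ih]; ring

lemma evalList_listMul {R : Type*} [CommRing R] (s : R) (L M : List ℤ) :
    evalList s (listMul L M) = evalList s L * evalList s M := by
  induction L with
  | nil => simp [listMul]
  | cons a L ih => simp [listMul, evalList_listAdd, evalList_map_mul, ih]; ring

/-- The greatest common divisor of a list of integers. -/
def content (L : List ℤ) : ℕ := L.foldr (fun a g => Nat.gcd a.natAbs g) 0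

lemma content_eq_zero_of_forall {K : Type*} [Field K] {L : List ℤ} (h : ∀ a ∈ L, (a : K) = 0) :
    (content L : K) = 0 := by
  induction L with
  | nil => simp [content]
  | cons a L ih =>
    have h1 := ih fun b hb => h b (List.mem_cons_of_mem _ hb)
    have h2 := h a List.mem_cons_self
    have h3 := Int.gcd_eq_gcd_ab a (content L : ℤ)
    have h4 : content (a :: L) = Int.gcd a (content L : ℤ) := rfl
    have h5 := congrArg (Int.cast : ℤ → K) h3
    push_cast at h5
    rw [h4, h5, h1, h2]
    ring

/-- A polynomial in `t⁻¹` with vanishing value has vanishing coefficients. -/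
lemma eq_zero_of_evalList_eq_zero {K : Type*} [Field K] {L : List ℤ}
    (h : evalList (tVar K)⁻¹ L = 0) : ∀ a ∈ L, (a : K) = 0 := by
  have h1 : evalList (X : K[X]) L = 0 := by
    apply transcendental_iff_injective.1 (transcendental_tVar_inv K)
    rw [map_zero, ← h]
    have := map_evalList (X : K[X]) (aeval (tVar K)⁻¹ : K[X] →ₐ[K] RatFunc₂ K).toRingHom L
    simpa using this
  clear h
  induction L with
  | nil => simp
  | cons a L ih =>
    rw [evalList_cons] at h1
    have h2 : (a : K) = 0 := by
      have := congrArg (eval 0) h1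
      simpa using this
    have h3 : ((a : ℤ) : K[X]) = 0 := by
      rw [← map_intCast (C : K →+* K[X]), h2, C_0]
    rw [h3, zero_add, mul_eq_zero, or_iff_right X_ne_zero] at h1
    intro b hb
    rcases List.mem_cons.1 hb with rfl | hb
    · exact h2
    · exact ih h1 b hb

lemma content_take_eq_zero {K : Type*} [Field K] {L : List ℤ} (h : evalList (tVar K)⁻¹ L = 0)
    (r : ℕ) : (content (L.take r) : K) = 0 :=
  content_eq_zero_of_forall fun a ha => eq_zero_of_evalList_eq_zero h a (List.mem_of_mem_take ha)

/-- All prime factors of `m` divide `6 n`. The exponent exceeds all multiplicities in the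
tables. -/
def isUnitAt (n m : ℕ) : Bool := decide (m ∣ (6 * n) ^ 200)

lemma natCast_ne_zero_of_isUnitAt {K : Type*} [Field K] {n m : ℕ} (hn : ((6 * n : ℕ) : K) ≠ 0)
    (h : isUnitAt n m = true) : (m : K) ≠ 0 := by
  intro h0
  obtain ⟨q, hq⟩ := of_decide_eq_true h
  have h1 := congrArg (Nat.cast : ℕ → K) hq
  rw [Nat.cast_mul, h0, zero_mul, Nat.cast_pow] at h1
  exact pow_ne_zero 200 hn h1

/-- The coefficients of `4 𝒜³ + 27 ℬ²` as a polynomial in `t⁻¹`, up to a power of `t`. -/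
def discList (n i : ℕ) : List ℤ :=
  listAdd ((listMul (listA n i) (listMul (listA n i) (listA n i))).map (4 * ·))
    ((listMul (listB n i) (listB n i)).map (27 * ·))

/-- The coefficients of `𝒜_i³ ℬ_k² - 𝒜_k³ ℬ_i²` as a polynomial in `t⁻¹`, up to a power of `t`. -/
def crossList (n i k : ℕ) : List ℤ :=
  listAdd (listMul (listMul (listA n i) (listMul (listA n i) (listA n i)))
      (listMul (listB n k) (listB n k)))
    ((listMul (listMul (listA n k) (listMul (listA n k) (listA n k)))
      (listMul (listB n i) (listB n i))).map (-1 * ·))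

/-- Already the first coefficients of the discriminants have a greatest common divisor composed of
primes that divide `6 n`. -/
lemma isUnitAt_discList : ∀ n ∈ genusZeroLevels, ∀ i ∈ Finset.Icc 1 (numCurves n),
    isUnitAt n (content ((discList n i).take 40)) = true := by
  decide +kernel

/-- Already the first coefficients of the polynomials that separate the isomorphism classes have a
greatest common divisor composed of primes that divide `6 n`. -/
lemma isUnitAt_crossList : ∀ n ∈ genusZeroLevels, ∀ i ∈ Finset.Icc 1 (numCurves n),
    ∀ k ∈ Finset.Icc 1 (numCurves n), i < k →
      isUnitAt n (content ((crossList n i k).take 10)) = true := by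
  decide +kernel

section Curves

variable {K : Type*} [Field K] {n : ℕ}

lemma disc_ne_zero (hn : n ∈ genusZeroLevels) (hK : ((6 * n : ℕ) : K) ≠ 0) {i : ℕ}
    (hi : i ∈ Finset.Icc 1 (numCurves n)) :
    4 * coeffA n i (tVar K) ^ 3 + 27 * coeffB n i (tVar K) ^ 2 ≠ 0 := by
  intro h0
  refine natCast_ne_zero_of_isUnitAt hK (isUnitAt_discList n hn i hi)
    (content_take_eq_zero (L := discList n i) ?_ 40)
  have ht := tVar_ne_zero K
  rw [coeffA_eq hn hi ht, coeffB_eq hn hi ht] at h0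
  simp only [discList, evalList_listAdd, evalList_map_mul, evalList_listMul]
  refine (mul_eq_zero.1 (?_ : tVar K ^ (6 * weight n) * _ = 0)).resolve_left (pow_ne_zero _ ht)
  push_cast
  linear_combination h0

lemma cross_ne_zero (hn : n ∈ genusZeroLevels) (hK : ((6 * n : ℕ) : K) ≠ 0) {i k : ℕ}
    (hi : i ∈ Finset.Icc 1 (numCurves n)) (hk : k ∈ Finset.Icc 1 (numCurves n)) (hik : i < k) :
    coeffA n i (tVar K) ^ 3 * coeffB n k (tVar K) ^ 2 ≠
      coeffA n k (tVar K) ^ 3 * coeffB n i (tVar K) ^ 2 := by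
  intro h0
  refine natCast_ne_zero_of_isUnitAt hK (isUnitAt_crossList n hn i hi k hk hik)
    (content_take_eq_zero (L := crossList n i k) ?_ 10)
  have ht := tVar_ne_zero K
  rw [coeffA_eq hn hi ht, coeffB_eq hn hi ht, coeffA_eq hn hk ht, coeffB_eq hn hk ht] at h0
  simp only [crossList, evalList_listAdd, evalList_map_mul, evalList_listMul]
  refine (mul_eq_zero.1 (?_ : tVar K ^ (12 * weight n) * _ = 0)).resolve_left (pow_ne_zero _ ht)
  push_cast
  linear_combination h0

lemma six_mul_ne_zero (hn : n ∈ genusZeroLevels)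
    (hK : ringChar K = 0 ∨ (ringChar K).Coprime (6 * n)) : ((6 * n : ℕ) : K) ≠ 0 := by
  have hn0 : 6 * n ≠ 0 := by
    rintro h
    obtain rfl : n = 0 := by omega
    revert hn
    decide
  intro h0
  rw [ringChar.spec] at h0
  rcases hK with h | h
  · rw [h, zero_dvd_iff] at h0
    exact hn0 h0
  · have h1 := Nat.eq_one_of_dvd_coprimes h dvd_rfl h0
    exact CharP.ringChar_ne_one h1

lemma two_three_ne_zero (hK : ((6 * n : ℕ) : K) ≠ 0) : (2 : K) ≠ 0 ∧ (3 : K) ≠ 0 := by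
  push_cast at hK
  have h6 : (6 : K) ≠ 0 := left_ne_zero_of_mul hK
  rw [show (6 : K) = 2 * 3 by norm_num] at h6
  exact mul_ne_zero_iff.1 h6

lemma two_three_ne_zero' (hK : ((6 * n : ℕ) : K) ≠ 0) :
    (2 : RatFunc₂ K) ≠ 0 ∧ (3 : RatFunc₂ K) ≠ 0 := by
  obtain ⟨h2, h3⟩ := two_three_ne_zero hK
  rw [← map_ofNat (algebraMap K (RatFunc₂ K)) 2, ← map_ofNat (algebraMap K (RatFunc₂ K)) 3]
  exact ⟨(_root_.map_ne_zero _).2 h2, (_root_.map_ne_zero _).2 h3⟩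

variable {d : RatFunc₂ K}

lemma curve_Δ {F : Type*} [Field F] (n i : ℕ) (t d : F) : (curve n i t d).Δ =
    -16 * d ^ 6 * (4 * coeffA n i t ^ 3 + 27 * coeffB n i t ^ 2) := by
  rw [Δ_of_isShortNF']
  simp only [curve]
  ring

lemma curve_isElliptic (hn : n ∈ genusZeroLevels) (hK : ((6 * n : ℕ) : K) ≠ 0) (hd : d ≠ 0)
    {i : ℕ} (hi : i ∈ Finset.Icc 1 (numCurves n)) : (curve n i (tVar K) d).IsElliptic := by
  refine ⟨(?_ : _ ≠ (0 : RatFunc₂ K)).isUnit⟩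
  rw [curve_Δ]
  refine mul_ne_zero (mul_ne_zero ?_ (pow_ne_zero 6 hd)) (disc_ne_zero hn hK hi)
  rw [show (-16 : RatFunc₂ K) = -2 ^ 4 by norm_num]
  exact neg_ne_zero.2 (pow_ne_zero 4 (two_three_ne_zero' hK).1)

lemma curve_c₄ {F : Type*} [Field F] (n i : ℕ) (t d : F) :
    (curve n i t d).c₄ = -48 * d ^ 2 * coeffA n i t := by
  simp [WeierstrassCurve.c₄, WeierstrassCurve.b₂, WeierstrassCurve.b₄, curve]
  ring

lemma curve_c₆ {F : Type*} [Field F] (n i : ℕ) (t d : F) :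
    (curve n i t d).c₆ = -864 * d ^ 3 * coeffB n i t := by
  simp [WeierstrassCurve.c₆, WeierstrassCurve.b₂, WeierstrassCurve.b₄, WeierstrassCurve.b₆, curve]
  ring

lemma curve_j_eq {F : Type*} [Field F] {n i : ℕ} {t d J Q : F}
    [(curve n i t d).IsElliptic] (hQ : Q ≠ 0)
    (h : 6912 * coeffA n i t ^ 3 * Q = J * (4 * coeffA n i t ^ 3 + 27 * coeffB n i t ^ 2)) :
    (curve n i t d).j = J / Q := by
  rw [eq_div_iff hQ]
  have hΔ : (curve n i t d).Δ ≠ 0 := (curve n i t d).isUnit_Δ.ne_zero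
  rw [WeierstrassCurve.j, Units.val_inv_eq_inv_val, WeierstrassCurve.coe_Δ']
  rw [mul_assoc, inv_mul_eq_iff_eq_mul₀ hΔ, curve_c₄, curve_Δ]
  linear_combination -16 * d ^ 6 * h

/-- The quotient `c₄³ / c₆²` is an isomorphism invariant. -/
lemma c₄_c₆_of_isoClass_eq {F : Type*} [Field F] {W W' : WeierstrassCurve F}
    (h : isoClass W = isoClass W') : W.c₄ ^ 3 * W'.c₆ ^ 2 = W'.c₄ ^ 3 * W.c₆ ^ 2 := by
  obtain ⟨g, rfl⟩ := MulAction.orbitRel_apply.1 (Quotient.exact h)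
  simp only [variableChange_c₄, variableChange_c₆]
  ring

lemma isoClass_ne (hn : n ∈ genusZeroLevels) (hK : ((6 * n : ℕ) : K) ≠ 0) (hd : d ≠ 0)
    {i k : ℕ} (hi : i ∈ Finset.Icc 1 (numCurves n)) (hk : k ∈ Finset.Icc 1 (numCurves n))
    (hik : i ≠ k) : isoClass (curve n i (tVar K) d) ≠ isoClass (curve n k (tVar K) d) := by
  wlog hlt : i < k generalizing i k
  · exact (this hk hi hik.symm (by omega)).symm
  intro h
  have h1 := c₄_c₆_of_isoClass_eq h
  rw [curve_c₄, curve_c₆, curve_c₄, curve_c₆] at h1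
  apply cross_ne_zero hn hK hi hk hlt
  obtain ⟨h2, h3⟩ := two_three_ne_zero' hK
  have h4 : (-48 * d ^ 2) ^ 3 * (-864 * d ^ 3) ^ 2 ≠ 0 := by
    rw [show (-48 : RatFunc₂ K) = -(2 ^ 4 * 3) by norm_num,
      show (-864 : RatFunc₂ K) = -(2 ^ 5 * 3 ^ 3) by norm_num]
    simp [h2, h3, hd]
  apply mul_left_cancel₀ h4
  linear_combination h1

end Curves

end Tables

/-! ### Kernels of order at least five -/

section OddKernels

open PolyExpr

/-- An isogeny `𝒞_{n,k} → 𝒞_{n,l}` of degree `2 (j + 2) + 1`, given by its kernel polynomial. The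
list `h` holds the coefficients, as polynomials in `s = t⁻¹`, of the monic kernel polynomial times
`2 (j + 2) + 1`. Further, `τ` is minus twice the sum of its
roots; the numbers `a`, `b` are the exponents of the Kronecker substitution; and at `s = 0` the
relations `u h + v (x³ + 𝒜 x + ℬ) = r` and `u' h + v' h' = r'` hold. -/
structure KernelData where
  (n k l j : ℕ)
  h : List (List ℤ)
  τ : List ℤ
  (a b : ℕ)
  (u v : List ℤ)
  r : ℕ
  (u' v' : List ℤ)
  r' : ℕ

/-- The polynomial `u f + v g` is the constant `r`. -/
def isBezout (u v f g : List ℤ) (r : ℕ) : Bool :=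
  match listAdd (listMul u f) (listMul v g) with
  | [] => false
  | c :: L => decide (c = r) && L.all (fun a => decide (a = 0))

namespace KernelData

/-- All the conditions that make the kernel polynomial define an isogeny. -/
def isValid (D : KernelData) : Bool :=
  decide (D.n ∈ genusZeroLevels) && decide (D.k ∈ Finset.Icc 1 (numCurves D.n)) &&
  decide (D.l ∈ Finset.Icc 1 (numCurves D.n)) && decide (D.h.length = D.j + 3) &&
  decide (D.h.getLast? = some [((2 * (D.j + 2) + 1 : ℕ) : ℤ)]) &&
  decide ((derivAux 1 D.h.tail).getLast? =
    some [(((D.j + 2) * (2 * (D.j + 2) + 1) : ℕ) : ℤ)]) &&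
  isUnitAt D.n ((D.j + 2) * (2 * (D.j + 2) + 1)) && isUnitAt D.n D.r && isUnitAt D.n D.r' &&
  isBezout D.u D.v (D.h.map fun c => c.headD 0)
    ([listB D.n D.k, listA D.n D.k, [], [1]].map fun c => c.headD 0) D.r &&
  isBezout D.u' D.v' (D.h.map fun c => c.headD 0)
    ((derivAux 1 D.h.tail).map fun c => c.headD 0) D.r' &&
  vanishes (odeExpr (cubicExpr (listA D.n D.k) (listB D.n D.k)) (poly D.h)
    (numeratorExpr (cubicExpr (listA D.n D.k) (listB D.n D.k)) (poly D.h)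
      ((2 * (D.j + 2) + 1 : ℕ) : ℤ) D.τ)
    (poly [listA D.n D.l]) (poly [listB D.n D.l])) D.a D.b

end KernelData

lemma evalList₂_zero {R : Type*} [CommRing R] (x : R) (L : List (List ℤ)) :
    evalList₂ 0 x L = evalList x (L.map fun c => c.headD 0) := by
  induction L with
  | nil => rfl
  | cons c L ih => cases c <;> simp [ih]

lemma isCoprime_of_isBezout {K : Type*} [Field K] {n : ℕ} (hK : ((6 * n : ℕ) : K) ≠ 0)
    {h g : List (List ℤ)} {u v : List ℤ} {r : ℕ} (hr : isUnitAt n r = true)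
    (huv : isBezout u v (h.map fun c => c.headD 0) (g.map fun c => c.headD 0) r = true) :
    IsCoprime (evalList₂ 0 X h : K[X]) (evalList₂ 0 X g) := by
  rw [evalList₂_zero, evalList₂_zero]
  refine isCoprime_of_bezout (evalList X u) (evalList X v) (natCast_ne_zero_of_isUnitAt hK hr) ?_
  rw [← evalList_listMul, ← evalList_listMul, ← evalList_listAdd]
  unfold isBezout at huv
  split at huv
  · cases huv
  · rename_i c L hL
    rw [Bool.and_eq_true, decide_eq_true_eq, List.all_eq_true] at huv
    obtain ⟨rfl, h0⟩ := huv
    have h1 : evalList (X : K[X]) L = 0 := by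
      clear hL
      induction L with
      | nil => rfl
      | cons a L ih =>
        have ha : a = 0 := of_decide_eq_true (h0 a List.mem_cons_self)
        rw [evalList_cons, ha, ih fun b hb => h0 b (List.mem_cons_of_mem _ hb)]
        simp
    rw [hL, evalList_cons, h1]
    simp

/-- Valid kernel data define an isogeny in every characteristic prime to `6 n`. -/
theorem KernelData.exists_isogeny {K : Type*} [Field K] (D : KernelData) (hD : D.isValid = true)
    (hp : (2 * (D.j + 2) + 1).Prime) (hK : ((6 * D.n : ℕ) : K) ≠ 0) {d : RatFunc₂ K} (hd : d ≠ 0) :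
    ∃ ψ : Isogeny (curve D.n D.k (tVar K) d) (curve D.n D.l (tVar K) d),
      ψ.HasCyclicKernel (2 * (D.j + 2) + 1) ∧ ψ.HasStandardForm (2 * (D.j + 2) + 1) 1 := by
  simp only [isValid, Bool.and_eq_true, decide_eq_true_eq] at hD
  obtain ⟨⟨⟨⟨⟨⟨⟨⟨⟨⟨⟨hn, hk⟩, hl⟩, hlen⟩, hlast⟩, hlast'⟩, hm⟩, hr⟩, hr'⟩, hb⟩, hb'⟩, hv⟩ := hD
  have hm1 := natCast_ne_zero_of_isUnitAt hK hm
  have hm2 : ((2 * (D.j + 2) + 1 : ℕ) : K) ≠ 0 := by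
    rw [Nat.cast_mul] at hm1
    exact right_ne_zero_of_mul hm1
  have ht := tVar_ne_zero K
  have := curve_isElliptic hn hK hd hk
  have := curve_isElliptic hn hK hd hl
  exact exists_isogeny_of_kernelPolynomial hd (coeffA_eq hn hk ht) (coeffB_eq hn hk ht)
    (coeffA_eq hn hl ht) (coeffB_eq hn hl ht) hlen hlast hlast'
    (by rwa [Int.cast_natCast]) hm2 hp hv (isCoprime_of_isBezout hK hr hb)
    (isCoprime_of_isBezout hK hr' hb')

/-- The isogeny of degree `5` from `𝒞_{5,1}` to `𝒞_{5,2}`. -/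
def kernelFive : KernelData where
  n := 5
  k := 1
  l := 2
  j := 0
  h := [[801, 42372, 785250, 6187500, 17578125], [150, 3300, 18750], [5]]
  τ := [60, 1320, 7500]
  a := 200
  b := 6197
  u := [954, -375, 55]
  v := [-6375, -275]
  r := 419904
  u' := [-2]
  v' := [15, 1]
  r' := 648

/-- The isogeny of degree `7` from `𝒞_{7,1}` to `𝒞_{7,2}`. -/
def kernelSeven : KernelData where
  n := 7
  k := 1
  l := 2
  j := 1
  h := [[23787, 1338525, 28743498, 317587473, 1924972938, 6070335453, 7626831723], [6237,
    201474, 2324511, 11798514, 22235661], [441, 5733, 21609], [7]]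
  τ := [126, 1638, 6174]
  a := 257
  b := 11045
  u := [2718, -1533, 245]
  v := [-917343, -97314, -1715]
  r := 15116544
  u' := [-675, -21]
  v' := [2709, 372, 7]
  r' := 839808

/-- The isogeny of degree `5` from `𝒞_{10,1}` to `𝒞_{10,3}`. -/
def kernelTenA : KernelData where
  n := 10
  k := 1
  l := 3
  j := 0
  h := [[801, 13536, 22644, 188064, 345600, 740736, 1276416, 820224, 820224], [150, 600, 1800,
    2400, 4800], [5]]
  τ := [60, 240, 720, 960, 1920]
  a := 177
  b := 10775
  u := [954, -375, 55]
  v := [-6375, -275]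
  r := 419904
  u' := [-2]
  v' := [15, 1]
  r' := 648

/-- The isogeny of degree `5` from `𝒞_{10,2}` to `𝒞_{10,4}`. -/
def kernelTenB : KernelData where
  n := 10
  k := 2
  l := 4
  j := 0
  h := [[12816, -51264, 319104, -740736, 1382400, -3009024, 1449216, -3465216, 820224], [600,
    -1200, 3600, -4800, 4800], [5]]
  τ := [240, -480, 1440, -1920, 1920]
  a := 192
  b := 11675
  u := [15264, -1500, 55]
  v := [-25500, -275]
  r := 107495424
  u' := [-2]
  v' := [60, 1]
  r' := 10368

/-- The isogeny of degree `13` from `𝒞_{13,1}` to `𝒞_{13,2}`. -/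
def kernelThirteen : KernelData where
  n := 13
  k := 1
  l := 2
  j := 4
  h := [[622980801, 67506946938, 3356279114787, 103300287222006, 2233915731557235,
    36407440779507504, 467244678719249964, 4863295288308467556, 41906561590255386609,
    303348821268237041466, 1863798819157615717377, 9788595229330076393442,
    44138240189368590164562, 171227991383758224759402, 571384854792671610766725,
    1636133561416468284955434, 4000275330765235434196245, 8284586643485214269107212,
    14361170212157308972118388, 20479193784291462549824664, 23418702189712030595428359,
    20656047368081621548317798, 13186166352133829283451287, 5410679450086478013008706,
    1065739891683700214683533], [303358770, 25600997214, 987315110964, 23553023522418,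
    394257850494300, 4958265317199714, 48845028011905944, 387271892652141978,
    2516052360074875362, 13552154315506638468, 60938890933866971688, 229437149682478743252,
    722756806364513463426, 1896173114635356868818, 4105455623891345796696,
    7226703791456367381930, 10103011360869277125756, 10810611436379050820394,
    8324007417006866874900, 4104596760799937803830, 970177416189076208178], [55538379,
    3456135540, 98229907386, 1726993583640, 21225858702867, 194467741057512, 1378738957388130,
    7734988234538604, 34765525075390668, 125777228312419164, 365490176195652066,
    844908619262832072, 1524564834370313931, 2077244035105188456, 2016341737727088330,
    1245515630647834260, 367993254509587395], [4735692, 200385900, 3894015060, 46643334192,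
    385690915116, 2326217600772, 10512405456696, 35918013024036, 92217672602172,
    173785280754384, 228616691867460, 188972178826860, 74443585598460], [188487, 4733586,
    55240731, 387991890, 1792620180, 5581561986, 11478523095, 14335622730, 8471049795], [3042,
    33462, 170352, 435006, 514098], [13]]
  τ := [468, 5148, 26208, 66924, 79092]
  a := 589
  b := 92431
  u := [147978, -98319, 16367]
  v := [-1694114360991, -544086341487, -60725654262, -2793548862, -48510267, -212771]
  r := 705277476864
  u' := [-13529798226, -3049378488, -208498212, -4725864, -25194]
  v' := [27787950801, 9617298075, 1131746850, 53828190, 951405, 4199]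
  r' := 914039610015744

/-- The isogeny of degree `5` from `𝒞_{25,1}` to `𝒞_{25,2}`. -/
def kernelTwentyFiveA : KernelData where
  n := 25
  k := 1
  l := 2
  j := 0
  h := [[801, 16740, 80874, 524340, 1713015, 5893668, 14359050, 31334472, 56531385, 80078760,
    102874356, 79068960, 66976704], [150, 900, 3750, 9000, 21750, 21600, 36600], [5]]
  τ := [60, 360, 1500, 3600, 8700, 8640, 14640]
  a := 232
  b := 21092
  u := [954, -375, 55]
  v := [-6375, -275]
  r := 419904
  u' := [-2]
  v' := [15, 1]
  r' := 648

/-- The isogeny of degree `5` from `𝒞_{25,2}` to `𝒞_{25,3}`. -/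
def kernelTwentyFiveB : KernelData where
  n := 25
  k := 2
  l := 3
  j := 0
  h := [[500625, 0, 7008750, 0, 37546875, 4455000, 95118750, 40095000, 112640625, 111375000,
    28372500, 89100000, -86760000], [3750, 0, 26250, 0, 48750, 0, 15000], [5]]
  τ := [1500, 0, 10500, 0, 19500, 0, 6000]
  a := 233
  b := 21180
  u := [119250, -1875, 11]
  v := [-31875, -55]
  r := 32805000000
  u' := [-2]
  v' := [375, 1]
  r' := 405000

lemma kernelFive_isValid : kernelFive.isValid = true := by decide +kernel

lemma kernelSeven_isValid : kernelSeven.isValid = true := by decide +kernel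

lemma kernelTenA_isValid : kernelTenA.isValid = true := by decide +kernel

lemma kernelTenB_isValid : kernelTenB.isValid = true := by decide +kernel

lemma kernelThirteen_isValid : kernelThirteen.isValid = true := by decide +kernel

lemma kernelTwentyFiveA_isValid : kernelTwentyFiveA.isValid = true := by decide +kernel

lemma kernelTwentyFiveB_isValid : kernelTwentyFiveB.isValid = true := by decide +kernel

end OddKernels

/-! ### The isogeny graphs -/

section SmallKernels

/-- The abscissa `α` of the nonzero points in the kernel of the isogeny `𝒞_{n,k} → 𝒞_{n,l}` of
degree two or three, for `d = 1`: the coefficients of the polynomial `α` in `t`, the leading one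
first. -/
def abscissa (n k l : ℕ) : List ℤ :=
  match n, k, l with
  | 2, 1, 2 => [-6, -384]
  | 3, 1, 2 => [3, 81]
  | 4, 1, 2 => [-24, -192]
  | 4, 1, 3 => [12, -192]
  | 4, 1, 4 => [12, 384]
  | 4, 4, 1 => [-6, -192]
  | 6, 1, 2 => [2, 72, 432]
  | 6, 1, 3 => [3, 72, 432]
  | 6, 2, 4 => [12, 144, 432]
  | 6, 3, 4 => [18, 216, 432]
  | 8, 1, 2 => [12, -288, 192]
  | 8, 1, 3 => [12, 288, 192]
  | 8, 1, 4 => [-24, 0, -384]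
  | 8, 3, 1 => [-6, -144, -96]
  | 8, 4, 5 => [48, 0, -1536]
  | 8, 4, 6 => [-96, 0, 768]
  | 9, 1, 2 => [3, 36, 108]
  | 9, 2, 3 => [27, 0, 0]
  | 10, 1, 2 => [-6, -132, 0, -528, 96]
  | 10, 3, 4 => [-150, 300, 0, 1200, 2400]
  | 12, 1, 2 => [12, 0, 72, 0, 108]
  | 12, 1, 3 => [8, 0, 144, 0, -216]
  | 12, 1, 5 => [-4, -96, -72, 0, 108]
  | 12, 1, 7 => [-4, 96, -72, 0, 108]
  | 12, 2, 4 => [72, 0, -432, 0, -216]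
  | 12, 3, 4 => [48, 0, -288, 0, 432]
  | 12, 5, 1 => [2, 48, 36, 0, -54]
  | 12, 5, 6 => [3, 36, 90, -108, 27]
  | 12, 6, 2 => [18, 0, -108, 432, -54]
  | 12, 7, 8 => [12, -144, 360, 432, 108]
  | 12, 8, 2 => [72, 0, -432, -1728, -216]
  | 16, 1, 2 => [12, 288, 288, 1152, 192]
  | 16, 1, 3 => [12, -288, 288, -1152, 192]
  | 16, 1, 4 => [-24, 0, -576, 0, -384]
  | 16, 2, 1 => [-6, -144, -144, -576, -96]
  | 16, 4, 5 => [48, 0, -1152, 0, 768]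
  | 16, 4, 6 => [-96, 0, 0, 0, -1536]
  | 16, 6, 7 => [192, 0, 0, 0, -6144]
  | 16, 6, 8 => [-384, 0, 0, 0, 3072]
  | 18, 1, 2 => [2, 48, 48, 184, -96, 192, -16]
  | 18, 1, 3 => [3, 36, 108, 24, 144, 0, 48]
  | 18, 2, 4 => [12, 0, 144, -48, 432, -288, 48]
  | 18, 3, 4 => [18, 0, 0, 360, 0, 0, -144]
  | 18, 3, 5 => [27, 0, 0, 216, 0, 0, 432]
  | 18, 4, 6 => [108, 0, 0, -432, 0, 0, 432]
  | 18, 5, 6 => [162, 0, 0, -648, 0, 0, -1296]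
  | _, _, _ => []

/-- All coefficients of a polynomial vanish. -/
def isZeroList (L : List ℤ) : Bool := L.all fun a => decide (a = 0)

lemma evalList_eq_zero_of_isZeroList {R : Type*} [CommRing R] (s : R) {L : List ℤ}
    (h : isZeroList L = true) : evalList s L = 0 := by
  induction L with
  | nil => rfl
  | cons a L ih =>
    rw [isZeroList, List.all_cons, Bool.and_eq_true, decide_eq_true_eq] at h
    rw [evalList_cons, h.1, ih h.2]
    simp

/-- The coefficients of `3 α² + 𝒜`. -/
def tangentList (n k l : ℕ) : List ℤ :=
  listAdd ((listMul (abscissa n k l) (abscissa n k l)).map (3 * ·)) (listA n k)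

/-- The coefficients of `α³ + 𝒜 α + ℬ`. -/
def ordinateSqList (n k l : ℕ) : List ℤ :=
  listAdd (listMul (listAdd (listMul (abscissa n k l) (abscissa n k l)) (listA n k))
    (abscissa n k l)) (listB n k)

/-- The point `(α, 0)` lies on `𝒞_{n,k}`, and the quotient by it, scaled by `1 / c`, is
`𝒞_{n,l}`. -/
def isKernelTwo (n k l : ℕ) (c : ℤ) : Bool :=
  isZeroList (ordinateSqList n k l) &&
  isZeroList (listAdd ((listA n l).map (c ^ 4 * ·))
    (listAdd ((listA n k).map (-1 * ·)) ((tangentList n k l).map (5 * ·)))) &&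
  isZeroList (listAdd ((listB n l).map (c ^ 6 * ·)) (listAdd ((listB n k).map (-1 * ·))
    ((listMul (abscissa n k l) (tangentList n k l)).map (7 * ·))))

/-- The points with abscissa `α` on `𝒞_{n,k}` have order three, and the quotient by them is
`𝒞_{n,l}`. -/
def isKernelThree (n k l : ℕ) : Bool :=
  isZeroList (listAdd ((listMul (abscissa n k l) (ordinateSqList n k l)).map (12 * ·))
    ((listMul (tangentList n k l) (tangentList n k l)).map (-1 * ·))) &&
  isZeroList (listAdd (listA n l)
    (listAdd ((listA n k).map (-1 * ·)) ((tangentList n k l).map (10 * ·)))) &&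
  isZeroList (listAdd (listAdd (listB n l) (listAdd ((listB n k).map (-1 * ·))
    ((ordinateSqList n k l).map (28 * ·))))
    ((listMul (abscissa n k l) (tangentList n k l)).map (14 * ·)))

variable {K : Type*} [Field K] {n k l : ℕ} {d : RatFunc₂ K}

lemma exists_isogeny_of_isKernelTwo (hn : n ∈ genusZeroLevels) (hK : ((6 * n : ℕ) : K) ≠ 0)
    (hd : d ≠ 0) (hk : k ∈ Finset.Icc 1 (numCurves n)) (hl : l ∈ Finset.Icc 1 (numCurves n))
    {c : ℤ} (hc : (c : RatFunc₂ K) ≠ 0) (h : isKernelTwo n k l c = true) :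
    ∃ ψ : Isogeny (curve n k (tVar K) d) (curve n l (tVar K) d),
      ψ.HasCyclicKernel 2 ∧ ψ.HasStandardForm 2 (c : RatFunc₂ K)⁻¹ := by
  have := curve_isElliptic hn hK hd hk
  have := curve_isElliptic hn hK hd hl
  have ht := tVar_ne_zero K
  simp only [isKernelTwo, Bool.and_eq_true] at h
  obtain ⟨⟨h1, h2⟩, h3⟩ := h
  have e1 := evalList_eq_zero_of_isZeroList (tVar K)⁻¹ h1
  have e2 := evalList_eq_zero_of_isZeroList (tVar K)⁻¹ h2
  have e3 := evalList_eq_zero_of_isZeroList (tVar K)⁻¹ h3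
  simp only [ordinateSqList, tangentList, evalList_listAdd, evalList_listMul,
    evalList_map_mul] at e1 e2 e3
  push_cast at e1 e2 e3
  refine exists_isogeny_two (α := tVar K ^ weight n * evalList (tVar K)⁻¹ (abscissa n k l))
    (inv_ne_zero hc) ?_ ?_ ?_
  · rw [coeffA_eq hn hk ht, coeffB_eq hn hk ht]
    linear_combination tVar K ^ (3 * weight n) * e1
  · rw [inv_pow, eq_inv_mul_iff_mul_eq₀ (pow_ne_zero 4 hc), coeffA_eq hn hk ht,
      coeffA_eq hn hl ht]
    linear_combination tVar K ^ (2 * weight n) * e2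
  · rw [inv_pow, eq_inv_mul_iff_mul_eq₀ (pow_ne_zero 6 hc), coeffA_eq hn hk ht,
      coeffB_eq hn hl ht, coeffB_eq hn hk ht]
    linear_combination tVar K ^ (3 * weight n) * e3

lemma exists_isogeny_of_isKernelThree (hn : n ∈ genusZeroLevels) (hK : ((6 * n : ℕ) : K) ≠ 0)
    (hd : d ≠ 0) (hk : k ∈ Finset.Icc 1 (numCurves n)) (hl : l ∈ Finset.Icc 1 (numCurves n))
    (h : isKernelThree n k l = true) :
    ∃ ψ : Isogeny (curve n k (tVar K) d) (curve n l (tVar K) d),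
      ψ.HasCyclicKernel 3 ∧ ψ.HasStandardForm 3 1 := by
  have := curve_isElliptic hn hK hd hk
  have := curve_isElliptic hn hK hd hl
  have ht := tVar_ne_zero K
  simp only [isKernelThree, Bool.and_eq_true] at h
  obtain ⟨⟨h1, h2⟩, h3⟩ := h
  have e1 := evalList_eq_zero_of_isZeroList (tVar K)⁻¹ h1
  have e2 := evalList_eq_zero_of_isZeroList (tVar K)⁻¹ h2
  have e3 := evalList_eq_zero_of_isZeroList (tVar K)⁻¹ h3
  simp only [ordinateSqList, tangentList, evalList_listAdd, evalList_listMul,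
    evalList_map_mul] at e1 e2 e3
  push_cast at e1 e2 e3
  refine exists_isogeny_three (α := tVar K ^ weight n * evalList (tVar K)⁻¹ (abscissa n k l))
    hd ?_ ?_ ?_
  · rw [coeffA_eq hn hk ht, coeffB_eq hn hk ht]
    linear_combination tVar K ^ (4 * weight n) * e1
  · rw [coeffA_eq hn hk ht, coeffA_eq hn hl ht]
    linear_combination tVar K ^ (2 * weight n) * e2
  · rw [coeffA_eq hn hk ht, coeffB_eq hn hl ht, coeffB_eq hn hk ht]
    linear_combination tVar K ^ (3 * weight n) * e3

/-- The tabulated abscissas are those of kernels of the arrows of degrees two and three. The model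
of the target is scaled by `1 / 2` for the arrow `ψ_{12,2}`. -/
lemma isKernel_of_mem_arrows : ∀ n ∈ genusZeroLevels, ∀ p ∈ arrows n,
    p.2.1 ∈ Finset.Icc 1 (numCurves n) ∧ p.2.2.1 ∈ Finset.Icc 1 (numCurves n) ∧
    (p.2.2.2 = 2 → isKernelTwo n p.2.1 p.2.2.1 (if n = 12 ∧ p.1 = 2 then 2 else 1) = true) ∧
    (p.2.2.2 = 3 → ¬ (n = 12 ∧ p.1 = 2) ∧ isKernelThree n p.2.1 p.2.2.1 = true) := by
  decide +kernel

/-- The isogenies of degree two from `𝒞_{n,1}` which are dual to an arrow ending at `1`. -/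
lemma isKernelTwo_dual : isKernelTwo 4 1 4 2 = true ∧ isKernelTwo 8 1 3 2 = true ∧
    isKernelTwo 12 1 5 2 = true ∧ isKernelTwo 16 1 2 2 = true := by
  decide +kernel

/-- Every arrow of the graph is an isogeny. -/
theorem exists_isogeny_of_mem_arrows (hn : n ∈ genusZeroLevels) (hK : ((6 * n : ℕ) : K) ≠ 0)
    (hd : d ≠ 0) {i m : ℕ} (h : (i, k, l, m) ∈ arrows n) :
    ∃ ψ : Isogeny (curve n k (tVar K) d) (curve n l (tVar K) d),
      ψ.HasCyclicKernel m ∧ ψ.HasStandardForm m (scale (RatFunc₂ K) n i) := by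
  obtain ⟨hk, hl, h2, h3⟩ := isKernel_of_mem_arrows n hn _ h
  by_cases hm2 : m = 2
  · subst hm2
    have h4 := h2 rfl
    simp only at hk hl h4
    have hc : (((if n = 12 ∧ i = 2 then 2 else 1 : ℤ)) : RatFunc₂ K) ≠ 0 := by
      split_ifs
      · exact_mod_cast (two_three_ne_zero' hK).1
      · simp
    have h5 := exists_isogeny_of_isKernelTwo hn hK hd hk hl hc h4
    have h6 : scale (RatFunc₂ K) n i = ((if n = 12 ∧ i = 2 then 2 else 1 : ℤ) : RatFunc₂ K)⁻¹ := by
      rw [scale]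
      split_ifs <;> simp
    rwa [h6]
  by_cases hm3 : m = 3
  · subst hm3
    obtain ⟨h4, h5⟩ := h3 rfl
    simp only at hk hl h4 h5
    rw [scale, if_neg h4]
    exact exists_isogeny_of_isKernelThree hn hK hd hk hl h5
  have hs : ∀ n : ℕ, n ≠ 12 → scale (RatFunc₂ K) n i = 1 := fun n hn12 => by
    rw [scale, if_neg fun h => hn12 h.1]
  clear h2 h3 hk hl
  simp only [genusZeroLevels, Finset.mem_insert, Finset.mem_singleton] at hn
  rcases hn with rfl | rfl | rfl | rfl | rfl | rfl | rfl | rfl | rfl | rfl | rfl | rfl | rfl | rfl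
  all_goals
    simp only [arrows, List.mem_cons, Prod.mk.injEq, List.not_mem_nil, or_false] at h
  all_goals try (exfalso; omega)
  · obtain ⟨-, rfl, rfl, rfl⟩ := h
    rw [hs 5 (by norm_num)]
    exact kernelFive.exists_isogeny kernelFive_isValid Nat.prime_five hK hd
  · obtain ⟨-, rfl, rfl, rfl⟩ := h
    rw [hs 7 (by norm_num)]
    exact kernelSeven.exists_isogeny kernelSeven_isValid (by norm_num [kernelSeven]) hK hd
  · rw [hs 10 (by norm_num)]
    rcases h with h | ⟨-, rfl, rfl, rfl⟩ | h | ⟨-, rfl, rfl, rfl⟩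
    · omega
    · exact kernelTenA.exists_isogeny kernelTenA_isValid Nat.prime_five hK hd
    · omega
    · exact kernelTenB.exists_isogeny kernelTenB_isValid Nat.prime_five hK hd
  · obtain ⟨-, rfl, rfl, rfl⟩ := h
    rw [hs 13 (by norm_num)]
    exact kernelThirteen.exists_isogeny kernelThirteen_isValid (by norm_num [kernelThirteen]) hK hd
  · rw [hs 25 (by norm_num)]
    rcases h with ⟨-, rfl, rfl, rfl⟩ | ⟨-, rfl, rfl, rfl⟩
    · exact kernelTwentyFiveA.exists_isogeny kernelTwentyFiveA_isValid Nat.prime_five hK hd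
    · exact kernelTwentyFiveB.exists_isogeny kernelTwentyFiveB_isValid Nat.prime_five hK hd

end SmallKernels

section IsogenyClass

variable {K : Type*} [Field K] {n : ℕ} {d : RatFunc₂ K}

lemma isogenous_of_mem_arrows (hn : n ∈ genusZeroLevels) (hK : ((6 * n : ℕ) : K) ≠ 0)
    (hd : d ≠ 0) {i k l m : ℕ} (h : (i, k, l, m) ∈ arrows n) (hm : m ≠ 0) :
    Isogenous (curve n k (tVar K) d) (curve n l (tVar K) d) := by
  obtain ⟨ψ, h1, -⟩ := exists_isogeny_of_mem_arrows hn hK hd h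
  have : NeZero m := ⟨hm⟩
  exact h1.isogenous

lemma isogenous_of_isKernelTwo (hn : n ∈ genusZeroLevels) (hK : ((6 * n : ℕ) : K) ≠ 0)
    (hd : d ≠ 0) {k l : ℕ} (hk : k ∈ Finset.Icc 1 (numCurves n))
    (hl : l ∈ Finset.Icc 1 (numCurves n)) (h : isKernelTwo n k l 2 = true) :
    Isogenous (curve n k (tVar K) d) (curve n l (tVar K) d) := by
  obtain ⟨ψ, h1, -⟩ := exists_isogeny_of_isKernelTwo hn hK hd hk hl
    (c := 2) (by exact_mod_cast (two_three_ne_zero' hK).1) h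
  exact h1.isogenous

/-- All curves of a level are reached from the first one. -/
theorem isogenous_curve_one (hn : n ∈ genusZeroLevels) (hK : ((6 * n : ℕ) : K) ≠ 0)
    (hd : d ≠ 0) {i : ℕ} (hi : i ∈ Finset.Icc 1 (numCurves n)) :
    Isogenous (curve n 1 (tVar K) d) (curve n i (tVar K) d) := by
  have arrow : ∀ (i k l m : ℕ), (i, k, l, m) ∈ arrows n → m ≠ 0 →
      Isogenous (curve n k (tVar K) d) (curve n l (tVar K) d) :=
    fun i k l m h hm => isogenous_of_mem_arrows hn hK hd h hm
  have dual : ∀ k l : ℕ, k ∈ Finset.Icc 1 (numCurves n) → l ∈ Finset.Icc 1 (numCurves n) →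
      isKernelTwo n k l 2 = true → Isogenous (curve n k (tVar K) d) (curve n l (tVar K) d) :=
    fun k l hk hl h => isogenous_of_isKernelTwo hn hK hd hk hl h
  have hn' := hn
  simp only [genusZeroLevels, Finset.mem_insert, Finset.mem_singleton] at hn'
  obtain ⟨i1, i2⟩ := Finset.mem_Icc.1 hi
  rcases eq_or_ne i 1 with rfl | hi1
  · exact Isogenous.refl _
  rcases hn' with rfl | rfl | rfl | rfl | rfl | rfl | rfl | rfl | rfl | rfl | rfl | rfl | rfl | rfl
  all_goals
    simp only [numCurves] at i2
  · obtain rfl : i = 2 := by omega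
    exact arrow 1 1 2 2 (by decide) (by decide)
  · obtain rfl : i = 2 := by omega
    exact arrow 1 1 2 3 (by decide) (by decide)
  · obtain rfl | rfl | rfl : i = 2 ∨ i = 3 ∨ i = 4 := by omega
    · exact arrow 1 1 2 2 (by decide) (by decide)
    · exact arrow 2 1 3 2 (by decide) (by decide)
    · exact dual 1 4 (by decide) (by decide) isKernelTwo_dual.1
  · obtain rfl : i = 2 := by omega
    exact arrow 1 1 2 5 (by decide) (by decide)
  · have h3 := arrow 2 1 3 3 (by decide) (by decide)
    obtain rfl | rfl | rfl : i = 2 ∨ i = 3 ∨ i = 4 := by omega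
    · exact arrow 1 1 2 2 (by decide) (by decide)
    · exact h3
    · exact h3.trans (arrow 3 3 4 2 (by decide) (by decide))
  · obtain rfl : i = 2 := by omega
    exact arrow 1 1 2 7 (by decide) (by decide)
  · have h4 := arrow 3 1 4 2 (by decide) (by decide)
    obtain rfl | rfl | rfl | rfl | rfl : i = 2 ∨ i = 3 ∨ i = 4 ∨ i = 5 ∨ i = 6 := by omega
    · exact arrow 1 1 2 2 (by decide) (by decide)
    · exact dual 1 3 (by decide) (by decide) isKernelTwo_dual.2.1
    · exact h4
    · exact h4.trans (arrow 4 4 5 2 (by decide) (by decide))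
    · exact h4.trans (arrow 5 4 6 2 (by decide) (by decide))
  · have h2 := arrow 1 1 2 3 (by decide) (by decide)
    obtain rfl | rfl : i = 2 ∨ i = 3 := by omega
    · exact h2
    · exact h2.trans (arrow 2 2 3 3 (by decide) (by decide))
  · have h3 := arrow 2 1 3 5 (by decide) (by decide)
    obtain rfl | rfl | rfl : i = 2 ∨ i = 3 ∨ i = 4 := by omega
    · exact arrow 1 1 2 2 (by decide) (by decide)
    · exact h3
    · exact h3.trans (arrow 3 3 4 2 (by decide) (by decide))
  · have h2 := arrow 1 1 2 3 (by decide) (by decide)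
    have h5 := dual 1 5 (by decide) (by decide) isKernelTwo_dual.2.2.1
    have h7 := arrow 4 1 7 2 (by decide) (by decide)
    obtain rfl | rfl | rfl | rfl | rfl | rfl | rfl :
      i = 2 ∨ i = 3 ∨ i = 4 ∨ i = 5 ∨ i = 6 ∨ i = 7 ∨ i = 8 := by omega
    · exact h2
    · exact arrow 10 1 3 2 (by decide) (by decide)
    · exact h2.trans (arrow 8 2 4 2 (by decide) (by decide))
    · exact h5
    · exact h5.trans (arrow 6 5 6 3 (by decide) (by decide))
    · exact h7
    · exact h7.trans (arrow 3 7 8 3 (by decide) (by decide))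
  · obtain rfl : i = 2 := by omega
    exact arrow 1 1 2 13 (by decide) (by decide)
  · have h4 := arrow 3 1 4 2 (by decide) (by decide)
    have h6 := h4.trans (arrow 5 4 6 2 (by decide) (by decide))
    obtain rfl | rfl | rfl | rfl | rfl | rfl | rfl :
      i = 2 ∨ i = 3 ∨ i = 4 ∨ i = 5 ∨ i = 6 ∨ i = 7 ∨ i = 8 := by omega
    · exact dual 1 2 (by decide) (by decide) isKernelTwo_dual.2.2.2
    · exact arrow 1 1 3 2 (by decide) (by decide)
    · exact h4
    · exact h4.trans (arrow 4 4 5 2 (by decide) (by decide))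
    · exact h6
    · exact h6.trans (arrow 6 6 7 2 (by decide) (by decide))
    · exact h6.trans (arrow 7 6 8 2 (by decide) (by decide))
  · have h2 := arrow 2 1 2 2 (by decide) (by decide)
    have h3 := arrow 1 1 3 3 (by decide) (by decide)
    have h4 := h2.trans (arrow 3 2 4 3 (by decide) (by decide))
    obtain rfl | rfl | rfl | rfl | rfl : i = 2 ∨ i = 3 ∨ i = 4 ∨ i = 5 ∨ i = 6 := by omega
    · exact h2
    · exact h3
    · exact h4
    · exact h3.trans (arrow 5 3 5 3 (by decide) (by decide))
    · exact h4.trans (arrow 7 4 6 3 (by decide) (by decide))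
  · have h2 := arrow 1 1 2 5 (by decide) (by decide)
    obtain rfl | rfl : i = 2 ∨ i = 3 := by omega
    · exact h2
    · exact h2.trans (arrow 2 2 3 5 (by decide) (by decide))

end IsogenyClass

/-! ### The Fricke parameterizations -/

section JInvariants

/-- The value at the variable `t` of a monic integral polynomial is nonzero, in every
characteristic. -/
lemma horner_tVar_ne_zero {K : Type*} [Field K] (L : List ℤ) : horner (tVar K) (1 :: L) ≠ 0 := by
  intro h0
  have h1 := mul_horner (tVar_ne_zero K) (1 :: L)
  rw [h0, mul_zero, eq_comm, mul_eq_zero, or_iff_right (pow_ne_zero _ (tVar_ne_zero K))] at h1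
  have := eq_zero_of_evalList_eq_zero h1 1 List.mem_cons_self
  simp at this

variable {F : Type*} [Field F] {n : ℕ} {t d : F}

lemma ne_zero_of_eq_horner (h : ∀ L, horner t (1 :: L) ≠ 0) {x : F} {L : List ℤ}
    (hx : x = horner t (1 :: L)) : x ≠ 0 :=
  hx ▸ h L

set_option maxRecDepth 4000 in
set_option maxHeartbeats 4000000 in
/-- The first Fricke parameterization is the `j`-invariant of the curve with index `k₁`. -/
theorem j_curve_k₁ (hn : n ∈ genusZeroLevels) (h : ∀ L, horner t (1 :: L) ≠ 0)
    [(curve n (k₁ n) t d).IsElliptic] : (curve n (k₁ n) t d).j = jFricke1 n t := by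
  have ht : t ≠ 0 := ne_zero_of_eq_horner h (L := [0]) (by simp [horner])
  have h1 : t + 16 ≠ 0 := ne_zero_of_eq_horner h (L := [16]) (by simp [horner])
  have h2 : t + 8 ≠ 0 := ne_zero_of_eq_horner h (L := [8]) (by simp [horner])
  have h3 : t + 9 ≠ 0 := ne_zero_of_eq_horner h (L := [9]) (by simp [horner])
  have h4 : t - 4 ≠ 0 := ne_zero_of_eq_horner h (L := [-4]) (by simp [horner]; ring)
  have h5 : t + 4 ≠ 0 := ne_zero_of_eq_horner h (L := [4]) (by simp [horner])
  have h6 : t - 3 ≠ 0 := ne_zero_of_eq_horner h (L := [-3]) (by simp [horner]; ring)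
  have h7 : t ^ 3 - 27 ≠ 0 := ne_zero_of_eq_horner h (L := [0, 0, -27]) (by simp [horner]; ring)
  have h8 : t + 1 ≠ 0 := ne_zero_of_eq_horner h (L := [1]) (by simp [horner])
  have h9 : t - 1 ≠ 0 := ne_zero_of_eq_horner h (L := [-1]) (by simp [horner]; ring)
  have h10 : t + 3 ≠ 0 := ne_zero_of_eq_horner h (L := [3]) (by simp [horner])
  have h11 : t - 2 ≠ 0 := ne_zero_of_eq_horner h (L := [-2]) (by simp [horner]; ring)
  have h12 : t + 2 ≠ 0 := ne_zero_of_eq_horner h (L := [2]) (by simp [horner])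
  have h13 : t ^ 2 + 4 ≠ 0 := ne_zero_of_eq_horner h (L := [0, 4]) (by simp [horner]; ring)
  have h14 : t ^ 2 - t + 1 ≠ 0 := ne_zero_of_eq_horner h (L := [-1, 1]) (by simp [horner]; ring)
  have h15 : t ^ 2 + 2 * t + 4 ≠ 0 := ne_zero_of_eq_horner h (L := [2, 4]) (by simp [horner]; ring)
  have h16 : t ^ 4 + t ^ 3 + 6 * t ^ 2 + 6 * t + 11 ≠ 0 :=
    ne_zero_of_eq_horner h (L := [1, 6, 6, 11]) (by simp [horner]; ring)
  simp only [genusZeroLevels, Finset.mem_insert, Finset.mem_singleton] at hn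
  rcases hn with rfl | rfl | rfl | rfl | rfl | rfl | rfl | rfl | rfl | rfl | rfl | rfl | rfl | rfl
  all_goals simp only [jFricke1]
  · refine curve_j_eq (pow_ne_zero 2 ht) ?_
    simp only [k₁, coeffA, coeffB, horner, List.foldl]
    push_cast
    ring
  · refine curve_j_eq (pow_ne_zero 3 ht) ?_
    simp only [k₁, coeffA, coeffB, horner, List.foldl]
    push_cast
    ring
  · refine curve_j_eq (mul_ne_zero (pow_ne_zero 4 ht) h1) ?_
    simp only [k₁, coeffA, coeffB, horner, List.foldl]
    push_cast
    ring
  · refine curve_j_eq (pow_ne_zero 5 ht) ?_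
    simp only [k₁, coeffA, coeffB, horner, List.foldl]
    push_cast
    ring
  · refine curve_j_eq
      (mul_ne_zero (mul_ne_zero (pow_ne_zero 6 ht) (pow_ne_zero 2 h2)) (pow_ne_zero 3 h3)) ?_
    simp only [k₁, coeffA, coeffB, horner, List.foldl]
    push_cast
    ring
  · refine curve_j_eq (pow_ne_zero 7 ht) ?_
    simp only [k₁, coeffA, coeffB, horner, List.foldl]
    push_cast
    ring
  · refine curve_j_eq (mul_ne_zero (mul_ne_zero ht (pow_ne_zero 8 h4)) (pow_ne_zero 2 h5)) ?_
    simp only [k₁, coeffA, coeffB, horner, List.foldl]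
    push_cast
    ring
  · refine curve_j_eq (mul_ne_zero (pow_ne_zero 8 h6) h7) ?_
    simp only [k₁, coeffA, coeffB, horner, List.foldl]
    push_cast
    ring
  · refine curve_j_eq
      (mul_ne_zero (mul_ne_zero (pow_ne_zero 2 ht) (pow_ne_zero 10 h4)) (pow_ne_zero 5 h8)) ?_
    simp only [k₁, coeffA, coeffB, horner, List.foldl]
    push_cast
    ring
  · refine curve_j_eq
      (mul_ne_zero (mul_ne_zero (mul_ne_zero (mul_ne_zero (pow_ne_zero 3 ht) (pow_ne_zero 12 h6))
        h9) (pow_ne_zero 4 h8)) (pow_ne_zero 3 h10)) ?_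
    simp only [k₁, coeffA, coeffB, horner, List.foldl]
    push_cast
    ring
  · refine curve_j_eq (pow_ne_zero 13 ht) ?_
    simp only [k₁, coeffA, coeffB, horner, List.foldl]
    push_cast
    ring
  · refine curve_j_eq
      (mul_ne_zero (mul_ne_zero (mul_ne_zero ht (pow_ne_zero 16 h11)) (pow_ne_zero 4 h12)) h13) ?_
    simp only [k₁, coeffA, coeffB, horner, List.foldl]
    push_cast
    ring
  · refine curve_j_eq
      (mul_ne_zero (mul_ne_zero (mul_ne_zero (mul_ne_zero (pow_ne_zero 2 ht) (pow_ne_zero 18 h11))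
        (pow_ne_zero 9 h8)) h14) (pow_ne_zero 2 h15)) ?_
    simp only [k₁, coeffA, coeffB, horner, List.foldl]
    push_cast
    ring
  · refine curve_j_eq (mul_ne_zero (pow_ne_zero 25 h9) h16) ?_
    simp only [k₁, coeffA, coeffB, horner, List.foldl]
    push_cast
    ring

set_option maxRecDepth 4000 in
set_option maxHeartbeats 4000000 in
/-- The second Fricke parameterization is the `j`-invariant of the curve with index `k₂`. -/
theorem j_curve_k₂ (hn : n ∈ genusZeroLevels) (h : ∀ L, horner t (1 :: L) ≠ 0)
    [(curve n (k₂ n) t d).IsElliptic] : (curve n (k₂ n) t d).j = jFricke2 n t := by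
  have ht : t ≠ 0 := ne_zero_of_eq_horner h (L := [0]) (by simp [horner])
  have h1 : t + 16 ≠ 0 := ne_zero_of_eq_horner h (L := [16]) (by simp [horner])
  have h2 : t + 8 ≠ 0 := ne_zero_of_eq_horner h (L := [8]) (by simp [horner])
  have h3 : t + 9 ≠ 0 := ne_zero_of_eq_horner h (L := [9]) (by simp [horner])
  have h4 : t ^ 2 - 16 ≠ 0 := ne_zero_of_eq_horner h (L := [0, -16]) (by simp [horner]; ring)
  have h5 : t ^ 3 - 27 ≠ 0 := ne_zero_of_eq_horner h (L := [0, 0, -27]) (by simp [horner]; ring)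
  have h6 : t + 1 ≠ 0 := ne_zero_of_eq_horner h (L := [1]) (by simp [horner])
  have h7 : t - 4 ≠ 0 := ne_zero_of_eq_horner h (L := [-4]) (by simp [horner]; ring)
  have h8 : t ^ 2 - 9 ≠ 0 := ne_zero_of_eq_horner h (L := [0, -9]) (by simp [horner]; ring)
  have h9 : t ^ 2 - 1 ≠ 0 := ne_zero_of_eq_horner h (L := [0, -1]) (by simp [horner]; ring)
  have h10 : t ^ 4 - 16 ≠ 0 :=
    ne_zero_of_eq_horner h (L := [0, 0, 0, -16]) (by simp [horner]; ring)
  have h11 : t ^ 3 - 8 ≠ 0 := ne_zero_of_eq_horner h (L := [0, 0, -8]) (by simp [horner]; ring)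
  have h12 : t ^ 3 + 1 ≠ 0 := ne_zero_of_eq_horner h (L := [0, 0, 1]) (by simp [horner]; ring)
  have h13 : t ^ 5 + 5 * t ^ 3 + 5 * t - 11 ≠ 0 :=
    ne_zero_of_eq_horner h (L := [0, 5, 0, 5, -11]) (by simp [horner]; ring)
  simp only [genusZeroLevels, Finset.mem_insert, Finset.mem_singleton] at hn
  rcases hn with rfl | rfl | rfl | rfl | rfl | rfl | rfl | rfl | rfl | rfl | rfl | rfl | rfl | rfl
  all_goals simp only [jFricke2]
  · refine curve_j_eq (ht) ?_
    simp only [k₂, coeffA, coeffB, horner, List.foldl]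
    push_cast
    ring
  · refine curve_j_eq (ht) ?_
    simp only [k₂, coeffA, coeffB, horner, List.foldl]
    push_cast
    ring
  · refine curve_j_eq (mul_ne_zero ht h1) ?_
    simp only [k₂, coeffA, coeffB, horner, List.foldl]
    push_cast
    ring
  · refine curve_j_eq (ht) ?_
    simp only [k₂, coeffA, coeffB, horner, List.foldl]
    push_cast
    ring
  · refine curve_j_eq (mul_ne_zero (mul_ne_zero ht (pow_ne_zero 3 h2)) (pow_ne_zero 2 h3)) ?_
    simp only [k₂, coeffA, coeffB, horner, List.foldl]
    push_cast
    ring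
  · refine curve_j_eq (ht) ?_
    simp only [k₂, coeffA, coeffB, horner, List.foldl]
    push_cast
    ring
  · refine curve_j_eq (mul_ne_zero (pow_ne_zero 2 ht) h4) ?_
    simp only [k₂, coeffA, coeffB, horner, List.foldl]
    push_cast
    ring
  · refine curve_j_eq (h5) ?_
    simp only [k₂, coeffA, coeffB, horner, List.foldl]
    push_cast
    ring
  · refine curve_j_eq (mul_ne_zero (mul_ne_zero (pow_ne_zero 5 ht) (pow_ne_zero 2 h6)) h7) ?_
    simp only [k₂, coeffA, coeffB, horner, List.foldl]
    push_cast
    ring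
  · refine curve_j_eq (mul_ne_zero (mul_ne_zero (pow_ne_zero 4 ht) h8) (pow_ne_zero 3 h9)) ?_
    simp only [k₂, coeffA, coeffB, horner, List.foldl]
    push_cast
    ring
  · refine curve_j_eq (ht) ?_
    simp only [k₂, coeffA, coeffB, horner, List.foldl]
    push_cast
    ring
  · refine curve_j_eq (mul_ne_zero (pow_ne_zero 4 ht) h10) ?_
    simp only [k₂, coeffA, coeffB, horner, List.foldl]
    push_cast
    ring
  · refine curve_j_eq (mul_ne_zero (mul_ne_zero (pow_ne_zero 9 ht) h11) (pow_ne_zero 2 h12)) ?_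
    simp only [k₂, coeffA, coeffB, horner, List.foldl]
    push_cast
    ring
  · refine curve_j_eq (h13) ?_
    simp only [k₂, coeffA, coeffB, horner, List.foldl]
    push_cast
    ring

lemma k₁_k₂_mem : ∀ n ∈ genusZeroLevels,
    k₁ n ∈ Finset.Icc 1 (numCurves n) ∧ k₂ n ∈ Finset.Icc 1 (numCurves n) := by
  decide

end JInvariants

end IsogenyGraphs

end

theorem mainTheorem4 (K : Type*) [Field K] (n : ℕ) (hn : n ∈ IsogenyGraphs.genusZeroLevels)
    (hK : ringChar K = 0 ∨ (ringChar K).Coprime (6 * n))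
    (u : IsogenyGraphs.RatFunc₂ K) (hu : u ≠ 0) :
    let C : ℕ → WeierstrassCurve (IsogenyGraphs.RatFunc₂ K) := fun i =>
      IsogenyGraphs.curve n i (IsogenyGraphs.tVar K) (u * IsogenyGraphs.dVar K)
    let I : Finset ℕ := Finset.Icc 1 (IsogenyGraphs.numCurves n)
    -- the curves are elliptic curves over `K(t, d)`
    (∀ i ∈ I, (C i).IsElliptic) ∧
    -- the `j`-invariants of the curves with index `k₁` and `k₂`
    (∃ _ : (C (IsogenyGraphs.k₁ n)).IsElliptic,
      (C (IsogenyGraphs.k₁ n)).j = IsogenyGraphs.jFricke1 n (IsogenyGraphs.tVar K)) ∧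
    (∃ _ : (C (IsogenyGraphs.k₂ n)).IsElliptic,
      (C (IsogenyGraphs.k₂ n)).j = IsogenyGraphs.jFricke2 n (IsogenyGraphs.tVar K)) ∧
    -- the curves are pairwise non-isomorphic over `K(t, d)`
    (∀ i ∈ I, ∀ k ∈ I, i ≠ k → IsogenyGraphs.isoClass (C i) ≠ IsogenyGraphs.isoClass (C k)) ∧
    -- the isogeny class of the first curve contains all of them
    ({c | ∃ i ∈ I, c = IsogenyGraphs.isoClass (C i)} ⊆ IsogenyGraphs.isogenyClass (C 1)) ∧
    -- the arrows of the partial isogeny graph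
    (∀ i k l m : ℕ, (i, k, l, m) ∈ IsogenyGraphs.arrows n →
      ∃ ψ : IsogenyGraphs.Isogeny (C k) (C l), ψ.HasCyclicKernel m ∧
        ψ.HasStandardForm m (IsogenyGraphs.scale (IsogenyGraphs.RatFunc₂ K) n i)) := by
  have hd : u * IsogenyGraphs.dVar K ≠ 0 := mul_ne_zero hu (IsogenyGraphs.dVar_ne_zero K)
  have h6 := IsogenyGraphs.six_mul_ne_zero hn hK
  have hell : ∀ i ∈ Finset.Icc 1 (IsogenyGraphs.numCurves n),
      (IsogenyGraphs.curve n i (IsogenyGraphs.tVar K) (u * IsogenyGraphs.dVar K)).IsElliptic :=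
    fun i hi => IsogenyGraphs.curve_isElliptic hn h6 hd hi
  obtain ⟨hk₁, hk₂⟩ := IsogenyGraphs.k₁_k₂_mem n hn
  refine ⟨hell, ?_, ?_, ?_, ?_, ?_⟩
  · have := hell _ hk₁
    have hj := IsogenyGraphs.j_curve_k₁ (d := u * IsogenyGraphs.dVar K) hn
      (IsogenyGraphs.horner_tVar_ne_zero (K := K))
    exact ⟨this, hj⟩
  · have := hell _ hk₂
    have hj := IsogenyGraphs.j_curve_k₂ (d := u * IsogenyGraphs.dVar K) hn
      (IsogenyGraphs.horner_tVar_ne_zero (K := K))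
    exact ⟨this, hj⟩
  · exact fun i hi k hk hik => IsogenyGraphs.isoClass_ne hn h6 hd hi hk hik
  · rintro c ⟨i, hi, rfl⟩
    obtain ⟨φ, -⟩ := IsogenyGraphs.isogenous_curve_one hn h6 hd hi
    exact ⟨_, hell i hi, ⟨φ⟩, rfl⟩
  · exact fun i k l m h => IsogenyGraphs.exists_isogeny_of_mem_arrows hn h6 hd h
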